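/- Let $n\ge 1$, write $|\cdot|$ for the Euclidean norm, and for $\lambda=(\lambda_1,\dots,\lambda_n)$ with all $\lambda_j>-1/2$ let $d\mu_\lambda(y)=\prod_{j=1}^n y_j^{2\lambda_j}\,dy$ on $(0,\infty)^n$. Let $h_\lambda$ be the Hankel transformation $$h_\lambda(f)(x)=\int_{(0,\infty)^n}\prod_{j=1}^n (x_jy_j)^{-\lambda_j+1/2}J_{\lambda_j-1/2}(x_jy_j)\,f(y)\,d\mu_\lambda(y),\qquad x\in(0,\infty)^n,$$ where $J_\nu$ is the Bessel function of the first kind; it is defined by this integral for $f\in L^2(\mu_\lambda)$ vanishing outside a compact subset of $(0,\infty)^n$, and extended by continuity (as an isometry) to all of $L^2(\mu_\lambda)$. For $m\in L^\infty((0,\infty)^n)$ let $T^m_\lambda f=h_\lambda(m\,h_\lambda(f))$, $f\in L^2(\mu_\lambda)$. Let $\phi\in L^\infty(0,\infty)$ be complex valued and let $m$ be the bounded function $$m(y)=\sum_{j=1}^n y_j^2\int_0^\infty e^{-t\sum_{j=1}^n y_j^2}\phi(t)\,dt,\qquad y\in(0,\infty)^n .$$ Put $$W^{\alpha}_t(u,v)=\frac{(uv)^{-\alpha+1/2}}{2t}\,I_{\alpha-1/2}\!\left(\frac{uv}{2t}\right)e^{-(u^2+v^2)/4t},\qquad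 t,u,v>0,\ \alpha>-1/2,$$ where $I_\nu$ is the modified Bessel function of the first kind, and $$K^\phi_\lambda(x,y)=\int_0^\infty\phi(t)\,\frac{\partial}{\partial t}\prod_{j=1}^n W_t^{\lambda_j}(x_j,y_j)\,dt,\qquad x,y\in(0,\infty)^n,\ x\ne y .$$ Let $C_c^\infty((0,\infty)^n)$ be the space of complex-valued smooth functions with compact support contained in $(0,\infty)^n$. Then the following hold. (0) The integral defining $K^\phi_\lambda(x,y)$ converges absolutely for all $x\neq y$ in $(0,\infty)^n$, and so does $\int_{(0,\infty)^n,\,|y-x|>\varepsilon}f(y)K^\phi_\lambda(x,y)\,d\mu_\lambda(y)$ for all $f\in C_c^\infty((0,\infty)^n)$, $x\in(0,\infty)^n$ and $\varepsilon>0$. (1) There is a bounded function $\alpha$ on $(0,\infty)$, depending only on $n$ and $\phi$, such that for all $\lambda\in(-1/2,\infty)^n$ and all $f\in C_c^\infty((0,\infty)^n)$, for almost every $x\in(0,\infty)^n$, the following limit exists and $$T^m_\lambda(f)(x)=-\lim_{\varepsilon\to0^+}\left(\alpha(\varepsilon)f(x)+\int_{(0,\infty)^n,\ |y-x|>\varepsilon}f(y)K^\phi_\lambda(x,y)\prod_{j=1}^n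 y_j^{2\lambda_j}\,dy\right).$$ (2) There is a constant $C>0$, depending only on $n$, such that whenever the limit $\phi(0^+)=\lim_{t\to0^+}\phi(t)$ exists, then for all $\lambda\in(-1/2,\infty)^n$ and all $f\in C_c^\infty((0,\infty)^n)$, for almost every $x\in(0,\infty)^n$, the following limit exists and $$T^m_\lambda(f)(x)=C\,\phi(0^+)f(x)-\lim_{\varepsilon\to0^+}\int_{(0,\infty)^n,\ |y-x|>\varepsilon}f(y)K^\phi_\lambda(x,y)\prod_{j=1}^n y_j^{2\lambda_j}\,dy .$$ -/

import Mathlib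

open MeasureTheory Filter Topology TopologicalSpace Set
open scoped ENNReal

namespace HankelMult

/-- The open orthant `(0,∞)^n`. -/
def orthant (n : ℕ) : Opens (EuclideanSpace ℝ (Fin n)) :=
  ⟨{x | ∀ j, 0 < x j}, by
    simp only [ofPred_forall]
    exact isOpen_iInter_of_finite fun j => isOpen_lt continuous_const (by fun_prop)⟩

/-- The density `∏ⱼ yⱼ^(2λⱼ)`. -/
noncomputable def weight {n : ℕ} (lam : Fin n → ℝ) (y : EuclideanSpace ℝ (Fin n)) : ℝ :=
  ∏ j, y j ^ (2 * lam j)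

/-- The measure `∏ⱼ yⱼ^(2λⱼ) dy` on `(0,∞)^n`. -/
noncomputable def mu {n : ℕ} (lam : Fin n → ℝ) : Measure (EuclideanSpace ℝ (Fin n)) :=
  (volume.restrict (orthant n : Set (EuclideanSpace ℝ (Fin n)))).withDensity
    fun y => ENNReal.ofReal (weight lam y)

/-- The Bessel function of the first kind `J_ν(z)`, for `z > 0`. -/
noncomputable def besselJ (ν z : ℝ) : ℝ :=
  ∑' k : ℕ, (-1) ^ k / ((k.factorial : ℝ) * Real.Gamma (k + ν + 1)) * (z / 2) ^ (2 * (k : ℝ) + ν)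

/-- The modified Bessel function of the first kind `I_ν(z)`, for `z > 0`. -/
noncomputable def besselI (ν z : ℝ) : ℝ :=
  ∑' k : ℕ, 1 / ((k.factorial : ℝ) * Real.Gamma (k + ν + 1)) * (z / 2) ^ (2 * (k : ℝ) + ν)

/-- The kernel `∏ⱼ (xⱼyⱼ)^(-λⱼ+1/2) J_{λⱼ-1/2}(xⱼyⱼ)` of the Hankel transformation. -/
noncomputable def hankelKernel {n : ℕ} (lam : Fin n → ℝ) (x y : EuclideanSpace ℝ (Fin n)) : ℝ :=
  ∏ j, (x j * y j) ^ (-lam j + 1 / 2) * besselJ (lam j - 1 / 2) (x j * y j)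

/-- The Hankel transformation as an integral. -/
noncomputable def hankel {n : ℕ} (lam : Fin n → ℝ) (f : EuclideanSpace ℝ (Fin n) → ℂ)
    (x : EuclideanSpace ℝ (Fin n)) : ℂ :=
  ∫ y, (hankelKernel lam x y : ℂ) * f y ∂(mu lam)

/-- The functions in `L²((0,∞)^n, ∏ⱼ yⱼ^(2λⱼ) dy)` that vanish almost everywhere outside some
compact subset of `(0,∞)^n`. The integral `hankel lam F x` converges absolutely for these `F`
and every `x` in `(0,∞)^n`. -/
def compactL2 {n : ℕ} (lam : Fin n → ℝ) : Set (Lp ℂ 2 (mu lam)) :=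
  {F | ∃ K : Set (EuclideanSpace ℝ (Fin n)), IsCompact K ∧ K ⊆ orthant n ∧
    ∀ᵐ y ∂(mu lam), y ∉ K → F y = 0}

lemma continuousOn_weight {n : ℕ} (lam : Fin n → ℝ) :
    ContinuousOn (weight lam) (orthant n) := by
  unfold weight
  refine continuousOn_finsetProd _ fun j _ => ?_
  refine ContinuousOn.rpow_const (by fun_prop) fun x hx => Or.inl (ne_of_gt (hx j))

lemma measurable_weight {n : ℕ} (lam : Fin n → ℝ) : Measurable (weight lam) := by
  unfold weight
  fun_prop

instance {n : ℕ} (lam : Fin n → ℝ) : SFinite (mu lam) := by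
  unfold mu; infer_instance

lemma ae_mem_orthant {n : ℕ} (lam : Fin n → ℝ) : ∀ᵐ y ∂(mu lam), y ∈ orthant n :=
  (withDensity_absolutelyContinuous _ _).ae_le
    (ae_restrict_mem (orthant n).isOpen.measurableSet)

lemma mu_lt_top {n : ℕ} (lam : Fin n → ℝ) {K : Set (EuclideanSpace ℝ (Fin n))}
    (hK : IsCompact K) (hKo : K ⊆ orthant n) : mu lam K < ∞ := by
  obtain ⟨C, hC⟩ := hK.exists_bound_of_continuousOn ((continuousOn_weight lam).mono hKo)
  rw [mu, withDensity_apply _ hK.measurableSet, Measure.restrict_restrict hK.measurableSet,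
    inter_eq_left.2 hKo]
  refine (setLIntegral_lt_top_of_le_nnreal hK.measure_lt_top.ne ⟨C.toNNReal, fun x hx => ?_⟩)
  exact ENNReal.ofReal_le_ofReal ((le_abs_self _).trans (hC x hx))

/-- An exhaustion of `(0,∞)^n` by compact boxes. -/
def box (n k : ℕ) : Set (EuclideanSpace ℝ (Fin n)) :=
  {y | ∀ j, y j ∈ Icc (1 / ((k : ℝ) + 1)) (k + 1)}

lemma isCompact_box (n k : ℕ) : IsCompact (box n k) := by
  have h : IsCompact (univ.pi fun _ : Fin n => Icc (1 / ((k : ℝ) + 1)) ((k : ℝ) + 1)) :=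
    isCompact_univ_pi fun _ => isCompact_Icc
  have := h.image (EuclideanSpace.equiv (Fin n) ℝ).symm.continuous
  convert this using 1
  ext y
  rw [ContinuousLinearEquiv.image_symm_eq_preimage]
  simp [box, Pi.le_def, forall_and]

lemma box_subset (n k : ℕ) : box n k ⊆ orthant n := fun y hy j =>
  lt_of_lt_of_le (by positivity) (hy j).1

lemma eventually_mem_box {n : ℕ} {y : EuclideanSpace ℝ (Fin n)} (hy : y ∈ orthant n) :
    ∀ᶠ k in atTop, y ∈ box n k := by
  have : ∀ j, ∀ᶠ k : ℕ in atTop, y j ∈ Icc (1 / ((k : ℝ) + 1)) (k + 1) := by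
    intro j
    have h1 : ∀ᶠ k : ℕ in atTop, 1 / ((k : ℝ) + 1) ≤ y j :=
      tendsto_one_div_add_atTop_nhds_zero_nat.eventually (ge_mem_nhds (hy j))
    have h2 : ∀ᶠ k : ℕ in atTop, y j ≤ (k : ℝ) := tendsto_natCast_atTop_atTop.eventually_ge_atTop _
    filter_upwards [h1, h2] with k a b
    exact ⟨a, by linarith⟩
  exact eventually_all.2 this

lemma dense_compactL2 {n : ℕ} (lam : Fin n → ℝ) : Dense (compactL2 lam) := by
  intro F
  have hF := Lp.memLp F
  have hm : ∀ k, MemLp ((box n k).indicator F) 2 (mu lam) := fun k =>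
    hF.indicator (isCompact_box n k).measurableSet
  refine mem_closure_of_tendsto (f := fun k => (hm k).toLp) (b := atTop) ?_
    (Eventually.of_forall fun k => ⟨box n k, isCompact_box n k, box_subset n k, ?_⟩)
  · have key : Tendsto (fun k => (hm k).toLp) atTop (𝓝 (hF.toLp F)) := by
      rw [Lp.tendsto_Lp_iff_tendsto_eLpNorm'']
      have h0 : Tendsto (fun k => ∫⁻ y, ‖((box n k).indicator F - F) y‖ₑ ^ (2 : ℝ) ∂(mu lam)) atTop
          (𝓝 (∫⁻ _, 0 ∂(mu lam))) := by
        refine tendsto_lintegral_of_dominated_convergence' (fun y => ‖F y‖ₑ ^ (2 : ℝ)) ?_ ?_ ?_ ?_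
        · intro k
          exact (((hm k).1.sub hF.1).enorm).pow_const _
        · intro k
          refine Eventually.of_forall fun y => ?_
          by_cases hy : y ∈ box n k <;> simp [hy]
        · have := lintegral_rpow_enorm_lt_top_of_eLpNorm_lt_top two_ne_zero ENNReal.ofNat_ne_top
            hF.2
          simpa using this.ne
        · filter_upwards [ae_mem_orthant lam] with y hy
          refine tendsto_const_nhds.congr' ?_
          filter_upwards [eventually_mem_box hy] with k hk
          simp [hk]
      have h1 := h0.ennrpow_const (1 / 2)
      simp only [lintegral_zero] at h1
      rw [ENNReal.zero_rpow_of_pos (by norm_num)] at h1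
      refine h1.congr fun k => ?_
      rw [eLpNorm_eq_lintegral_rpow_enorm_toReal two_ne_zero ENNReal.ofNat_ne_top]
      simp
    rwa [Lp.toLp_coeFn] at key
  · filter_upwards [(hm k).coeFn_toLp] with y hy hyk
    rw [hy]; simp [hyk]

open Classical in
/-- The integral Hankel transformation, as a map from `compactL2 lam` to `L²`. -/
noncomputable def hankelCore {n : ℕ} (lam : Fin n → ℝ) (F : compactL2 lam) : Lp ℂ 2 (mu lam) :=
  if h : MemLp (hankel lam (F : Lp ℂ 2 (mu lam))) 2 (mu lam) then h.toLp else 0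

/-- The Hankel transformation on `L²((0,∞)^n, ∏ⱼ yⱼ^(2λⱼ) dy)`: the extension by continuity of
the integral Hankel transformation from the dense subspace `compactL2 lam`. -/
noncomputable def hankelL2 {n : ℕ} (lam : Fin n → ℝ) : Lp ℂ 2 (mu lam) → Lp ℂ 2 (mu lam) :=
  (dense_compactL2 lam).extend (hankelCore lam)

/-- The Hankel multiplier `T^m = h ∘ (m ·) ∘ h` on `L²`, for `m ∈ L^∞`. -/
noncomputable def hankelMultiplier {n : ℕ} (lam : Fin n → ℝ) (m : Lp ℂ ∞ (mu lam))
    (F : Lp ℂ 2 (mu lam)) : Lp ℂ 2 (mu lam) :=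
  hankelL2 lam (m • hankelL2 lam F : Lp ℂ 2 (mu lam))

/-- The symbol of Laplace transform type
`m(y) = (∑ⱼ yⱼ²) ∫₀^∞ exp(-t ∑ⱼ yⱼ²) φ(t) dt`. -/
noncomputable def laplaceSymbol (n : ℕ) (φ : ℝ → ℂ) (y : EuclideanSpace ℝ (Fin n)) : ℂ :=
  ((∑ j, y j ^ 2 : ℝ) : ℂ) *
    ∫ t in Ioi (0 : ℝ), (Real.exp (-t * ∑ j, y j ^ 2) : ℂ) * φ t

lemma memLp_laplaceSymbol {n : ℕ} (lam : Fin n → ℝ) {φ : ℝ → ℂ}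
    (hφ : MemLp φ ∞ (volume.restrict (Ioi 0))) : MemLp (laplaceSymbol n φ) ∞ (mu lam) := by
  have hmeas : AEStronglyMeasurable (laplaceSymbol n φ) (mu lam) := by
    unfold laplaceSymbol
    refine AEStronglyMeasurable.mul (Continuous.aestronglyMeasurable (by fun_prop)) ?_
    refine AEStronglyMeasurable.integral_prod_right'
      (f := fun p : EuclideanSpace ℝ (Fin n) × ℝ =>
        (Real.exp (-p.2 * ∑ j, p.1 j ^ 2) : ℂ) * φ p.2) ?_
    exact (Continuous.aestronglyMeasurable (by fun_prop)).mul hφ.1.comp_snd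
  refine memLp_top_of_bound hmeas (eLpNorm φ ∞ (volume.restrict (Ioi 0))).toReal
    (Eventually.of_forall fun y => ?_)
  set B := (eLpNorm φ ∞ (volume.restrict (Ioi 0))).toReal with hB
  have hφB : ∀ᵐ t ∂(volume.restrict (Ioi (0 : ℝ))), ‖φ t‖ ≤ B := by
    filter_upwards [ae_le_eLpNormEssSup (f := φ) (μ := volume.restrict (Ioi (0 : ℝ)))] with t ht
    rw [hB, eLpNorm_exponent_top, ← toReal_enorm]
    refine ENNReal.toReal_mono ?_ ht
    rw [← eLpNorm_exponent_top]
    exact hφ.2.ne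
  have hs0 : 0 ≤ ∑ j, y j ^ 2 := Finset.sum_nonneg fun j _ => sq_nonneg _
  unfold laplaceSymbol
  set s := ∑ j, y j ^ 2
  rcases hs0.eq_or_lt with h | h
  · rw [← h]; simp [hB]
  · have hint : IntegrableOn (fun t : ℝ => Real.exp (-s * t)) (Ioi 0) :=
      integrableOn_exp_mul_Ioi (by linarith) 0
    have h1 : ‖∫ t in Ioi (0 : ℝ), (Real.exp (-t * s) : ℂ) * φ t‖ ≤
        ∫ t in Ioi (0 : ℝ), Real.exp (-s * t) * B := by
      refine norm_integral_le_of_norm_le (hint.mul_const B) ?_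
      filter_upwards [hφB] with t ht
      rw [norm_mul, Complex.norm_real, Real.norm_of_nonneg (Real.exp_pos _).le,
        show -t * s = -s * t by ring]
      gcongr
    rw [integral_mul_const, integral_exp_mul_Ioi (by linarith)] at h1
    rw [norm_mul, Complex.norm_real, Real.norm_of_nonneg hs0]
    calc s * _ ≤ s * (-Real.exp (-s * 0) / -s * B) := by gcongr
      _ = B := by simp; field_simp

/-- The symbol of Laplace transform type as an element of `L^∞`. -/
noncomputable def laplaceMultiplier {n : ℕ} (lam : Fin n → ℝ) {φ : ℝ → ℂ}
    (hφ : MemLp φ ∞ (volume.restrict (Ioi 0))) : Lp ℂ ∞ (mu lam) :=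
  (memLp_laplaceSymbol lam hφ).toLp (laplaceSymbol n φ)

lemma memLp_testFunction {n : ℕ} (lam : Fin n → ℝ) (f : TestFunction (orthant n) ℂ ⊤) :
    MemLp f 2 (mu lam) := by
  obtain ⟨C, hC⟩ := f.continuous.bounded_above_of_compact_support f.hasCompactSupport
  have hK : IsCompact (tsupport f) := f.hasCompactSupport
  have hfin : IsFiniteMeasure ((mu lam).restrict (tsupport f)) :=
    ⟨by simpa using mu_lt_top lam hK f.tsupport_subset⟩
  have h : MemLp f 2 ((mu lam).restrict (tsupport f)) :=
    MemLp.of_bound f.continuous.aestronglyMeasurable C (Eventually.of_forall hC)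
  rw [← memLp_indicator_iff_restrict hK.measurableSet] at h
  rwa [indicator_eq_self.2 (subset_tsupport _)] at h

/-- A function in `C_c^∞((0,∞)^n)` as an element of `L²`. -/
noncomputable def testFunctionL2 {n : ℕ} (lam : Fin n → ℝ) (f : TestFunction (orthant n) ℂ ⊤) :
    Lp ℂ 2 (mu lam) :=
  (memLp_testFunction lam f).toLp f

/-- The one-dimensional Bessel heat kernel
`W_t^λ(u,v) = (uv)^(-λ+1/2) / (2t) I_{λ-1/2}(uv/(2t)) exp(-(u²+v²)/(4t))`. -/
noncomputable def heatKernel (lam t u v : ℝ) : ℝ :=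
  (u * v) ^ (-lam + 1 / 2) / (2 * t) * besselI (lam - 1 / 2) (u * v / (2 * t)) *
    Real.exp (-(u ^ 2 + v ^ 2) / (4 * t))

/-- The integrand `φ(t) ∂/∂t ∏ⱼ W_t^{λⱼ}(xⱼ,yⱼ)` of the kernel `K^φ(x,y)`. -/
noncomputable def kernelIntegrand {n : ℕ} (lam : Fin n → ℝ) (φ : ℝ → ℂ)
    (x y : EuclideanSpace ℝ (Fin n)) (t : ℝ) : ℂ :=
  φ t * (deriv (fun s => ∏ j, heatKernel (lam j) s (x j) (y j)) t : ℝ)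

/-- The kernel `K^φ(x,y) = ∫₀^∞ φ(t) ∂/∂t ∏ⱼ W_t^{λⱼ}(xⱼ,yⱼ) dt`. -/
noncomputable def kernelK {n : ℕ} (lam : Fin n → ℝ) (φ : ℝ → ℂ)
    (x y : EuclideanSpace ℝ (Fin n)) : ℂ :=
  ∫ t in Ioi (0 : ℝ), kernelIntegrand lam φ x y t

/-- The truncated integral `∫_{|y-x|>ε} f(y) K^φ(x,y) ∏ⱼ yⱼ^(2λⱼ) dy`. -/
noncomputable def truncatedIntegral {n : ℕ} (lam : Fin n → ℝ) (φ : ℝ → ℂ)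
    (f : EuclideanSpace ℝ (Fin n) → ℂ) (ε : ℝ) (x : EuclideanSpace ℝ (Fin n)) : ℂ :=
  ∫ y in {y | ε < ‖y - x‖}, f y * kernelK lam φ x y ∂(mu lam)

end HankelMult

open HankelMult

/-!
The heat kernel of the Bessel operator, times the density of the measure, factors as
`ratio x y * gauss t (y - x) * profileProd x y t`: a power factor that is `1` on the diagonal, the
Euclidean heat kernel, and a product of the functions `E_λ(s) = 2 √π s^λ e^(-2s) Φ_{λ+1/2}(s²)`
(`profile`) at `s = xⱼyⱼ/(4t)`, where `Φ_a` (`besselSeries`) is the entire function behind `J` and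
`I`. Everything about Bessel functions that the theorem needs comes from this.

The function `E_λ` solves `E'' + 4E' = λ(λ-1) s⁻² E`. Hence it has a limit at infinity, with rates
(`exists_limit_of_ode`); the limit is invariant under `λ ↦ λ + 1` by the recurrence, and it is `1`
because the heat kernel has mass one (`integral_profile`, `tendsto_profile_of_pos`). So for small
times the time derivative of the heat kernel differs from the Euclidean one by at most a multiple
of a Gaussian, and for large times it decays at an integrable rate, uniformly for `x` and `y` in a
compact subset of the orthant (`exists_heatDensityDeriv_bounds`). The bound for small times is
integrable on the set `{|y - x| > ε}`, which is the absolute convergence.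

Weber's integral (`integral_besselSeries_mul_besselSeries`), proved by expanding both factors in
power series, gives
`∫ e^(-t|y|²) h(F) h(G) dμ = ∬ W_t F G` (`integral_exp_mul_hankel_mul_hankel`). With Schur's test
and Fatou's lemma as `t → 0` this shows that `h` is a contraction, so that its continuous extension
exists, agrees with the integral on compactly supported functions, and is symmetric
(`integral_hankelL2_mul`). Differentiating the same identity in `t` and integrating against `φ`
gives, for `f` smooth and `G` bounded with compact support,
`∫ T(f) G dμ = -∫ S G dμ`, where `S(x) = ∫ φ(t) ∂ₜ(W_t f)(x) dt` (`principalValue`); so `T(f) = -S`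
almost everywhere (`hankelMultiplier_ae_eq`).

It remains to compute `S` by truncation. Let `θ_ε(t)` be the time derivative of the mass that the
Euclidean heat kernel has in the ball of radius `ε` (`ballMassDeriv`). Comparison with the Euclidean
kernel shows that the part of `∂ₜ(W_t f)(x)` coming from `|y - x| ≤ ε`, minus `θ_ε(t) f(x)`, tends to
zero and is dominated by an integrable function of `t`. Therefore `S(x)` is the limit of the
truncated integrals plus `α(ε) f(x)`, where `α(ε) = ∫ φ θ_ε` (`jumpCoefficient`,
`tendsto_jumpCoefficient_mul_add_truncatedIntegral`). Since `θ_ε(t) = ε⁻² θ₁(t/ε²)` and `θ₁` is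
integrable on `(0,∞)` with integral `-1`, the function `α` is bounded, and it tends to `-φ(0⁺)` if
this limit exists (`tendsto_jumpCoefficient`). So the constant of the second representation is `1`.
-/

open MeasureTheory Filter Topology TopologicalSpace Set
open scoped ENNReal

namespace HankelMult

/-! ### The entire function behind the Bessel functions -/

/-- The entire function `Φ_a(w) = ∑ₖ w^k / (k! Γ(k+a))`, which satisfies
`J_ν(z) = (z/2)^ν Φ_{ν+1}(-(z/2)²)` and `I_ν(z) = (z/2)^ν Φ_{ν+1}((z/2)²)`. -/
noncomputable def besselSeries (a w : ℝ) : ℝ :=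
  ∑' k : ℕ, w ^ k / ((k.factorial : ℝ) * Real.Gamma (k + a))

lemma summable_besselSeries {a : ℝ} (ha : 0 < a) (w : ℝ) :
    Summable fun k : ℕ => w ^ k / ((k.factorial : ℝ) * Real.Gamma (k + a)) := by
  refine Summable.of_norm_bounded_eventually_nat (g := fun k : ℕ => |w| ^ k / k.factorial)
    (Real.summable_pow_div_factorial _) ?_
  filter_upwards [eventually_ge_atTop 2] with k hk
  have hk' : (2 : ℝ) ≤ k := by exact_mod_cast hk
  have h1 : (1 : ℝ) ≤ Real.Gamma (k + a) := by
    rw [← Real.Gamma_two]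
    exact Real.Gamma_strictMonoOn_Ici.monotoneOn (by simp) (by simp; linarith) (by linarith)
  have h2 : (0 : ℝ) < k.factorial := by positivity
  rw [norm_div, norm_pow, Real.norm_eq_abs, Real.norm_of_nonneg (by positivity)]
  gcongr
  nlinarith

lemma hasSum_besselSeries {a : ℝ} (ha : 0 < a) (w : ℝ) :
    HasSum (fun k : ℕ => w ^ k / ((k.factorial : ℝ) * Real.Gamma (k + a))) (besselSeries a w) :=
  (summable_besselSeries ha w).hasSum

lemma besselSeries_pos {a : ℝ} (ha : 0 < a) {w : ℝ} (hw : 0 ≤ w) : 0 < besselSeries a w := by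
  refine (summable_besselSeries ha w).tsum_pos (fun k => ?_) 0 ?_
  · have := Real.Gamma_pos_of_pos (show 0 < (k : ℝ) + a by positivity)
    positivity
  · have := Real.Gamma_pos_of_pos ha
    simpa using this

lemma abs_besselSeries_neg_le {a : ℝ} (ha : 0 < a) {w : ℝ} (hw : 0 ≤ w) :
    |besselSeries a (-w)| ≤ besselSeries a w := by
  have := tsum_of_norm_bounded (hasSum_besselSeries ha w)
    (f := fun k : ℕ => (-w) ^ k / ((k.factorial : ℝ) * Real.Gamma (k + a))) fun k => by
    have := Real.Gamma_pos_of_pos (show 0 < (k : ℝ) + a by positivity)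
    rw [norm_div, norm_pow, norm_neg, Real.norm_of_nonneg hw, Real.norm_of_nonneg (by positivity)]
  exact this

lemma hasDerivAt_besselSeries {a : ℝ} (ha : 0 < a) (w : ℝ) :
    HasDerivAt (besselSeries a) (besselSeries (a + 1) w) w := by
  set R := |w| + 1 with hR
  have hR0 : 0 ≤ R := by positivity
  have hΓ : ∀ k : ℕ, 0 < Real.Gamma (k + a) := fun k =>
    Real.Gamma_pos_of_pos (by positivity)
  have hterm : ∀ (k : ℕ) (v : ℝ), ((k + 1 : ℕ) : ℝ) * v ^ k /
      (((k + 1).factorial : ℝ) * Real.Gamma ((k + 1 : ℕ) + a)) =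
      v ^ k / ((k.factorial : ℝ) * Real.Gamma (k + (a + 1))) := by
    intro k v
    have : ((k + 1 : ℕ) : ℝ) + a = k + (a + 1) := by push_cast; ring
    rw [this, Nat.factorial_succ]
    have h2 := hΓ (k + 1)
    rw [this] at h2
    have h3 : (0 : ℝ) < k.factorial := by positivity
    push_cast
    field_simp
  have hsum : Summable fun k : ℕ => (k : ℝ) * R ^ (k - 1) /
      ((k.factorial : ℝ) * Real.Gamma (k + a)) := by
    rw [← summable_nat_add_iff 1]
    refine (summable_besselSeries (a := a + 1) (by linarith) R).congr fun k => ?_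
    rw [← hterm k R]; simp
  have key := hasDerivAt_tsum_of_isPreconnected (t := Metric.ball (0 : ℝ) R)
    (g := fun (k : ℕ) v => v ^ k / ((k.factorial : ℝ) * Real.Gamma (k + a)))
    (g' := fun (k : ℕ) v => (k : ℝ) * v ^ (k - 1) / ((k.factorial : ℝ) * Real.Gamma (k + a)))
    (y₀ := 0) (y := w) hsum Metric.isOpen_ball (convex_ball _ _).isPreconnected
    (fun k v _ => (hasDerivAt_pow k v).div_const _) ?_ (by simp; linarith [abs_nonneg w])
    (summable_besselSeries ha 0) (by simp [hR])
  · have hs : Summable fun k : ℕ => (k : ℝ) * w ^ (k - 1) /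
        ((k.factorial : ℝ) * Real.Gamma (k + a)) := by
      rw [← summable_nat_add_iff 1]
      refine (summable_besselSeries (a := a + 1) (by linarith) w).congr fun k => ?_
      rw [← hterm k w]; simp
    rw [hs.tsum_eq_zero_add] at key
    simp only [CharP.cast_eq_zero, zero_mul, zero_div, zero_add, Nat.add_sub_cancel] at key
    rwa [tsum_congr fun k => hterm k w] at key
  · intro k v hv
    have hv' : |v| ≤ R := by simpa using (mem_ball_zero_iff.1 hv).le
    have := hΓ k
    rw [norm_div, norm_mul, norm_pow, Real.norm_eq_abs v,
      Real.norm_of_nonneg (show (0 : ℝ) ≤ k by positivity), Real.norm_of_nonneg (by positivity)]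
    gcongr

lemma continuous_besselSeries {a : ℝ} (ha : 0 < a) : Continuous (besselSeries a) :=
  continuous_iff_continuousAt.2 fun w => (hasDerivAt_besselSeries ha w).continuousAt

/-- The recurrence `w Φ_{a+2}(w) + a Φ_{a+1}(w) = Φ_a(w)`; with `Φ_a' = Φ_{a+1}` it is the
Bessel equation `w Φ_a'' + a Φ_a' = Φ_a`. -/
lemma besselSeries_recurrence {a : ℝ} (ha : 0 < a) (w : ℝ) :
    w * besselSeries (a + 1 + 1) w + a * besselSeries (a + 1) w = besselSeries a w := by
  have h1 := (hasSum_besselSeries (a := a + 1 + 1) (by linarith) w).mul_left w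
  have h2 := (hasSum_besselSeries (a := a + 1) (by linarith) w).mul_left a
  have h1' : HasSum (fun k : ℕ => (k : ℝ) * (w ^ k / ((k.factorial : ℝ) *
      Real.Gamma (k + (a + 1))))) (w * besselSeries (a + 1 + 1) w) := by
    rw [← hasSum_nat_add_iff' 1]
    simp only [Finset.range_one, Finset.sum_singleton, CharP.cast_eq_zero, zero_mul, sub_zero]
    refine h1.congr_fun ?_
    intro k
    have h3 : (0 : ℝ) < k.factorial := by positivity
    have h4 : ((k + 1 : ℕ) : ℝ) + (a + 1) = k + (a + 1 + 1) := by push_cast; ring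
    have h5 := Real.Gamma_pos_of_pos (show 0 < (k : ℝ) + (a + 1 + 1) by positivity)
    rw [h4, Nat.factorial_succ, pow_succ']
    push_cast
    field_simp
  refine (h1'.add h2).unique ?_
  refine (hasSum_besselSeries ha w).congr_fun ?_
  intro k
  have h3 : (0 : ℝ) < k.factorial := by positivity
  have h0 : 0 < (k : ℝ) + a := by positivity
  have h5 := Real.Gamma_pos_of_pos h0
  rw [← add_assoc, Real.Gamma_add_one h0.ne']
  field_simp

/-! ### Weber's integral -/

/-- A form of the Chu–Vandermonde identity. -/
lemma sum_choose_mul_choose_div_Gamma (k : ℕ) : ∀ (l : ℕ) {a : ℝ}, 0 < a →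
    ∑ m ∈ Finset.range (k + 1), (k.choose m : ℝ) * (l.choose m) * m.factorial /
      Real.Gamma (m + a) =
    Real.Gamma (k + l + a) / (Real.Gamma (k + a) * Real.Gamma (l + a)) := by
  induction k with
  | zero =>
    intro l a ha
    have h1 := Real.Gamma_pos_of_pos (show 0 < (l : ℝ) + a by positivity)
    have h2 := Real.Gamma_pos_of_pos ha
    simp
    field_simp
  | succ k ih =>
    intro l a ha
    have hs : ∑ m ∈ Finset.range (k + 1 + 1), ((k + 1).choose m : ℝ) * (l.choose m) *
        m.factorial / Real.Gamma (m + a) =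
        ∑ m ∈ Finset.range (k + 1), (k.choose m : ℝ) * (l.choose m) * m.factorial /
          Real.Gamma (m + a) +
        ∑ m ∈ Finset.range (k + 1), (k.choose m : ℝ) * (l.choose (m + 1)) *
          (m + 1).factorial / Real.Gamma (m + (a + 1)) := by
      have e1 : ∑ m ∈ Finset.range (k + 1), (k.choose m : ℝ) * (l.choose m) * m.factorial /
          Real.Gamma (m + a) = ∑ m ∈ Finset.range (k + 1 + 1), (k.choose m : ℝ) * (l.choose m) *
          m.factorial / Real.Gamma (m + a) := by
        rw [Finset.sum_range_succ _ (k + 1)]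
        simp
      rw [e1, Finset.sum_range_succ' _ (k + 1), Finset.sum_range_succ' _ (k + 1),
        add_right_comm, ← Finset.sum_add_distrib]
      congr 1
      · refine Finset.sum_congr rfl fun m _ => ?_
        rw [Nat.choose_succ_succ]
        push_cast
        rw [show (m : ℝ) + 1 + a = m + (a + 1) by ring]
        ring
      · simp
    rw [hs, ih l ha]
    cases l with
    | zero =>
      have h1 := Real.Gamma_pos_of_pos (show 0 < (k : ℝ) + a by positivity)
      have h3 := Real.Gamma_pos_of_pos (show 0 < (k : ℝ) + 1 + a by positivity)
      have h2 := Real.Gamma_pos_of_pos ha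
      simp
      field_simp
    | succ l =>
      have e2 : ∑ m ∈ Finset.range (k + 1), (k.choose m : ℝ) * ((l + 1).choose (m + 1)) *
          (m + 1).factorial / Real.Gamma (m + (a + 1)) = (l + 1) *
          ∑ m ∈ Finset.range (k + 1), (k.choose m : ℝ) * (l.choose m) *
          m.factorial / Real.Gamma (m + (a + 1)) := by
        rw [Finset.mul_sum]
        refine Finset.sum_congr rfl fun m _ => ?_
        have := Nat.add_one_mul_choose_eq l m
        have h' : ((l : ℝ) + 1) * l.choose m = (l + 1).choose (m + 1) * (m + 1) := by
          exact_mod_cast this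
        rw [Nat.factorial_succ]
        push_cast
        rw [← mul_div_assoc]
        congr 1
        linear_combination (-(k.choose m : ℝ) * m.factorial) * h'
      rw [e2, ih l (show 0 < a + 1 by linarith)]
      push_cast
      have hk : 0 < (k : ℝ) + a := by positivity
      have hkl : 0 < (k : ℝ) + l + (a + 1) := by positivity
      have h1 := Real.Gamma_pos_of_pos hk
      have h2 := Real.Gamma_pos_of_pos (show 0 < (l : ℝ) + (a + 1) by positivity)
      have h3 := Real.Gamma_pos_of_pos hkl
      rw [show (k : ℝ) + (l + 1) + a = k + l + (a + 1) by ring,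
        show (k : ℝ) + 1 + (l + 1) + a = k + l + (a + 1) + 1 by ring,
        show (k : ℝ) + (a + 1) = k + a + 1 by ring, show (k : ℝ) + 1 + a = k + a + 1 by ring,
        show (l : ℝ) + 1 + a = l + (a + 1) by ring,
        Real.Gamma_add_one hk.ne', Real.Gamma_add_one hkl.ne']
      field_simp
      ring

lemma hasSum_mul_of_summable {ι κ : Type*} {f : ι → ℝ} {g : κ → ℝ} {s t : ℝ} (hf : HasSum f s)
    (hg : HasSum g t) : HasSum (fun p : ι × κ => f p.1 * g p.2) (s * t) := by
  have h := summable_mul_of_summable_norm (f := f) (g := g) hf.summable.norm hg.summable.norm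
  exact hf.mul hg h

/-- The double series of Weber's integral. Writing `Γ(k+l+a)/(Γ(k+a)Γ(l+a))` by Chu–Vandermonde as
a sum over `m` turns it into a sum over `(m, p, q) = (m, k-m, l-m)`, which factors. -/
lemma hasSum_weber {a : ℝ} (ha : 0 < a) (X Z : ℝ) :
    HasSum (fun p : ℕ × ℕ => X ^ p.1 * Z ^ p.2 * Real.Gamma (p.1 + p.2 + a) /
      (p.1.factorial * p.2.factorial * (Real.Gamma (p.1 + a) * Real.Gamma (p.2 + a))))
      (Real.exp X * Real.exp Z * besselSeries a (X * Z)) := by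
  have hexp : ∀ x : ℝ, HasSum (fun k : ℕ => x ^ k / k.factorial) (Real.exp x) := fun x => by
    rw [Real.exp_eq_exp_ℝ]; exact NormedSpace.expSeries_div_hasSum_exp x
  have h3 := hasSum_mul_of_summable (hasSum_besselSeries ha (X * Z))
    (hasSum_mul_of_summable (hexp X) (hexp Z))
  set F : (ℕ × ℕ) × ℕ → ℝ := fun r => X ^ r.1.1 * Z ^ r.1.2 *
    ((r.1.1.choose r.2 : ℝ) * (r.1.2.choose r.2) * r.2.factorial / Real.Gamma (r.2 + a)) /
    (r.1.1.factorial * r.1.2.factorial) with hF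
  obtain ⟨g, hgdef⟩ : ∃ g : ℕ × ℕ × ℕ → (ℕ × ℕ) × ℕ,
      ∀ m p q, g (m, p, q) = ((p + m, q + m), m) :=
    ⟨fun r => ((r.2.1 + r.1, r.2.2 + r.1), r.1), fun _ _ _ => rfl⟩
  have hg : Function.Injective g := by
    rintro ⟨m, p, q⟩ ⟨m', p', q'⟩ h
    simp only [hgdef, Prod.mk.injEq] at h
    obtain ⟨⟨h1, h2⟩, h3⟩ := h
    subst h3
    simp at h1 h2
    simp [h1, h2]
  have hFg : ∀ r, F (g r) = (X * Z) ^ r.1 / (r.1.factorial * Real.Gamma (r.1 + a)) *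
      (X ^ r.2.1 / r.2.1.factorial * (Z ^ r.2.2 / r.2.2.factorial)) := by
    rintro ⟨m, p, q⟩
    have hm : (0 : ℝ) < m.factorial := by positivity
    have hp : (0 : ℝ) < p.factorial := by positivity
    have hq : (0 : ℝ) < q.factorial := by positivity
    have hG := Real.Gamma_pos_of_pos (show 0 < (m : ℝ) + a by positivity)
    simp only [hF, hgdef]
    have e : ∀ p : ℕ, ((p + m).choose m : ℝ) = (p + m).factorial / (p.factorial * m.factorial) := by
      intro p
      rw [Nat.add_choose]
      exact Nat.cast_div (Nat.factorial_mul_factorial_dvd_factorial_add p m) (by positivity)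
        |>.trans (by push_cast; rfl)
    have hpm : (0 : ℝ) < (p + m).factorial := by positivity
    have hqm : (0 : ℝ) < (q + m).factorial := by positivity
    rw [e p, e q, mul_pow, pow_add, pow_add]
    field_simp
  have hF3 : HasSum F (Real.exp X * Real.exp Z * besselSeries a (X * Z)) := by
    rw [← hg.hasSum_iff, mul_comm]
    · exact h3.congr_fun fun r => hFg r
    · rintro ⟨⟨k, l⟩, m⟩ hr
      simp only [hF]
      by_cases hk : m ≤ k
      · by_cases hl : m ≤ l
        · exact absurd ⟨(m, k - m, l - m), by simp [hgdef, hk, hl]⟩ hr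
        · rw [Nat.choose_eq_zero_of_lt (not_le.1 hl)]; simp
      · rw [Nat.choose_eq_zero_of_lt (not_le.1 hk)]; simp
  refine hF3.prod_fiberwise fun ⟨k, l⟩ => ?_
  have : X ^ k * Z ^ l * Real.Gamma (k + l + a) /
      (k.factorial * l.factorial * (Real.Gamma (k + a) * Real.Gamma (l + a))) =
      ∑ m ∈ Finset.range (k + 1), F ((k, l), m) := by
    simp only [hF]
    rw [← Finset.sum_div, ← Finset.mul_sum, sum_choose_mul_choose_div_Gamma k l ha]
    have hG := Real.Gamma_pos_of_pos (show 0 < (k : ℝ) + a by positivity)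
    have hG := Real.Gamma_pos_of_pos (show 0 < (l : ℝ) + a by positivity)
    field_simp
  simp only [this]
  refine hasSum_sum_of_ne_finset_zero fun m hm => ?_
  have : k < m := by simpa using hm
  simp [hF, Nat.choose_eq_zero_of_lt this]

/-- Weber's second exponential integral. -/
lemma integral_besselSeries_mul_besselSeries {a : ℝ} (ha : 0 < a) {t : ℝ} (ht : 0 < t) (x z : ℝ) :
    ∫ y in Ioi (0 : ℝ), besselSeries a (-(x * y / 2) ^ 2) * besselSeries a (-(z * y / 2) ^ 2) *
      Real.exp (-t * y ^ 2) * y ^ (2 * a - 1) =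
    t ^ (-a) / 2 * (Real.exp (-(x ^ 2 + z ^ 2) / (4 * t)) *
      besselSeries a ((x * z / (4 * t)) ^ 2)) := by
  set c : ℝ → ℕ × ℕ → ℝ := fun σ p => (σ * (x / 2) ^ 2) ^ p.1 * (σ * (z / 2) ^ 2) ^ p.2 /
    (p.1.factorial * p.2.factorial * (Real.Gamma (p.1 + a) * Real.Gamma (p.2 + a))) with hc
  set F : ℕ × ℕ → ℝ → ℝ := fun p y => c (-1) p *
    (y ^ (2 * ((p.1 + p.2 : ℕ) + a) - 1) * Real.exp (-t * y ^ 2)) with hF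
  have hint : ∀ p : ℕ × ℕ, IntegrableOn (fun y : ℝ =>
      y ^ (2 * (((p.1 + p.2 : ℕ) : ℝ) + a) - 1) * Real.exp (-t * y ^ 2)) (Ioi 0) := fun p =>
    integrableOn_rpow_mul_exp_neg_mul_sq ht (by
      have : (0 : ℝ) ≤ ((p.1 + p.2 : ℕ) : ℝ) := by positivity
      linarith)
  have hval : ∀ p : ℕ × ℕ, ∫ y in Ioi (0 : ℝ),
      y ^ (2 * (((p.1 + p.2 : ℕ) : ℝ) + a) - 1) * Real.exp (-t * y ^ 2) =
      t ^ (-a) / 2 * (t⁻¹ ^ p.1 * t⁻¹ ^ p.2 * Real.Gamma (p.1 + p.2 + a)) := by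
    intro p
    have h0 : (0 : ℝ) ≤ ((p.1 + p.2 : ℕ) : ℝ) := by positivity
    have := integral_rpow_mul_exp_neg_mul_rpow (p := 2) (q := 2 * (((p.1 + p.2 : ℕ) : ℝ) + a) - 1)
      two_pos (by linarith) ht
    simp only [Real.rpow_two] at this
    rw [this, show -(2 * (((p.1 + p.2 : ℕ) : ℝ) + a) - 1 + 1) / 2 = -a - ((p.1 + p.2 : ℕ) : ℝ) by
      ring, show (2 * (((p.1 + p.2 : ℕ) : ℝ) + a) - 1 + 1) / 2 = p.1 + p.2 + a by push_cast; ring,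
      Real.rpow_sub ht, Real.rpow_natCast, ← pow_add, inv_pow]
    field_simp
  have hcF : ∀ σ p, c σ p * (t ^ (-a) / 2 * (t⁻¹ ^ p.1 * t⁻¹ ^ p.2 * Real.Gamma (p.1 + p.2 + a))) =
      t ^ (-a) / 2 * ((σ * (x / 2) ^ 2 * t⁻¹) ^ p.1 * (σ * (z / 2) ^ 2 * t⁻¹) ^ p.2 *
        Real.Gamma (p.1 + p.2 + a) /
      (p.1.factorial * p.2.factorial * (Real.Gamma (p.1 + a) * Real.Gamma (p.2 + a)))) := by
    intro σ p
    simp only [hc, mul_pow _ t⁻¹]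
    ring
  have hcabs : ∀ p, |c (-1) p| = c 1 p := by
    intro p
    have h1 := Real.Gamma_pos_of_pos (show 0 < (p.1 : ℝ) + a by positivity)
    have h2 := Real.Gamma_pos_of_pos (show 0 < (p.2 : ℝ) + a by positivity)
    simp only [hc]
    rw [abs_div, abs_mul, abs_pow, abs_pow, abs_mul, abs_mul, abs_neg, abs_one,
      abs_of_nonneg (sq_nonneg (x / 2)), abs_of_nonneg (sq_nonneg (z / 2)),
      abs_of_pos (show 0 < (p.1.factorial : ℝ) * p.2.factorial *
        (Real.Gamma (p.1 + a) * Real.Gamma (p.2 + a)) by positivity)]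
  have hsum : Summable fun p => ∫ y in Ioi (0 : ℝ), ‖F p y‖ := by
    refine ((hasSum_weber ha (1 * (x / 2) ^ 2 * t⁻¹) (1 * (z / 2) ^ 2 * t⁻¹)).summable.mul_left
      (t ^ (-a) / 2)).congr fun p => ?_
    rw [← hcF, ← hval, ← hcabs, ← integral_const_mul]
    refine setIntegral_congr_fun measurableSet_Ioi fun y hy => ?_
    have hy : 0 < y := hy
    simp only [hF, norm_mul, Real.norm_eq_abs]
    rw [abs_of_pos (Real.exp_pos _), abs_of_pos (Real.rpow_pos_of_pos hy _)]
  have key := hasSum_integral_of_summable_integral_norm (fun p => (hint p).const_mul (c (-1) p)) hsum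
  have key2 : HasSum (fun p => ∫ y in Ioi (0 : ℝ), F p y) (t ^ (-a) / 2 *
      (Real.exp (-(x ^ 2 + z ^ 2) / (4 * t)) * besselSeries a ((x * z / (4 * t)) ^ 2))) := by
    convert! (hasSum_weber ha (-1 * (x / 2) ^ 2 * t⁻¹) (-1 * (z / 2) ^ 2 * t⁻¹)).mul_left
      (t ^ (-a) / 2) using 1
    · funext p
      rw [← hcF, ← hval, ← integral_const_mul]
    · rw [← Real.exp_add]
      congr 3
      · field_simp; ring
      · field_simp; ring
  rw [← key.unique key2]
  refine setIntegral_congr_fun measurableSet_Ioi fun y hy => ?_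
  have hy : 0 < y := hy
  have h1 := hasSum_mul_of_summable (hasSum_besselSeries ha (-(x * y / 2) ^ 2))
    (hasSum_besselSeries ha (-(z * y / 2) ^ 2))
  have h2 := h1.mul_right (Real.exp (-t * y ^ 2) * y ^ (2 * a - 1))
  rw [mul_assoc (_ * _), ← h2.tsum_eq]
  refine tsum_congr fun p => ?_
  simp only [hc]
  rw [show 2 * (((p.1 + p.2 : ℕ) : ℝ) + a) - 1 = (2 * a - 1) + ((2 * (p.1 + p.2) : ℕ) : ℝ) by
    push_cast; ring, Real.rpow_add hy, Real.rpow_natCast, mul_add, pow_add, pow_mul, pow_mul,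
    show -(x * y / 2) ^ 2 = -1 * (x / 2) ^ 2 * y ^ 2 by ring,
    show -(z * y / 2) ^ 2 = -1 * (z / 2) ^ 2 * y ^ 2 by ring, mul_pow _ (y ^ 2), mul_pow _ (y ^ 2)]
  ring

/-- The total mass of the one-dimensional heat kernel. -/
lemma integral_besselSeries_mul_exp {a : ℝ} (ha : 0 < a) {t : ℝ} (ht : 0 < t) (u : ℝ) :
    IntegrableOn (fun v : ℝ => besselSeries a ((u * v / (4 * t)) ^ 2) *
      Real.exp (-(u ^ 2 + v ^ 2) / (4 * t)) * v ^ (2 * a - 1)) (Ioi 0) ∧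
    ∫ v in Ioi (0 : ℝ), besselSeries a ((u * v / (4 * t)) ^ 2) *
      Real.exp (-(u ^ 2 + v ^ 2) / (4 * t)) * v ^ (2 * a - 1) = (4 * t) ^ a / 2 := by
  set b : ℝ := (4 * t)⁻¹ with hb
  have hb0 : 0 < b := by positivity
  set c : ℕ → ℝ := fun k => (u * b) ^ (2 * k) / (k.factorial * Real.Gamma (k + a)) *
    Real.exp (-(b * u ^ 2)) with hc
  have hc0 : ∀ k, 0 ≤ c k := fun k => by
    have := Real.Gamma_pos_of_pos (show 0 < (k : ℝ) + a by positivity)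
    have := (even_two_mul k).pow_nonneg (u * b)
    positivity
  set F : ℕ → ℝ → ℝ := fun k v => c k * (v ^ (2 * ((k : ℝ) + a) - 1) * Real.exp (-b * v ^ 2))
    with hF
  have hF0 : ∀ k, ∀ v ∈ Ioi (0 : ℝ), 0 ≤ F k v := fun k v hv =>
    mul_nonneg (hc0 k) (mul_nonneg (Real.rpow_nonneg (le_of_lt hv) _) (Real.exp_pos _).le)
  have hint : ∀ k : ℕ, IntegrableOn (F k) (Ioi 0) := fun k =>
    (integrableOn_rpow_mul_exp_neg_mul_sq hb0 (by
      have : (0 : ℝ) ≤ k := by positivity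
      linarith)).const_mul _
  have hval : ∀ k : ℕ, ∫ v in Ioi (0 : ℝ), F k v =
      b ^ (-a) / 2 * Real.exp (-(b * u ^ 2)) * ((b * u ^ 2) ^ k / k.factorial) := by
    intro k
    have h0 : (0 : ℝ) ≤ (k : ℝ) := by positivity
    have := integral_rpow_mul_exp_neg_mul_rpow (p := 2) (q := 2 * ((k : ℝ) + a) - 1)
      two_pos (by linarith) hb0
    simp only [Real.rpow_two] at this
    simp only [hF]
    have hG := Real.Gamma_pos_of_pos (show 0 < (k : ℝ) + a by positivity)
    rw [integral_const_mul, this, show -(2 * ((k : ℝ) + a) - 1 + 1) / 2 = -a - k by ring,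
      show (2 * ((k : ℝ) + a) - 1 + 1) / 2 = k + a by ring, Real.rpow_sub hb0, Real.rpow_natCast]
    simp only [hc]
    rw [pow_mul, mul_pow, mul_pow (u ^ 2), mul_pow b, ← pow_mul b, mul_comm 2 k, pow_mul b k, sq]
    field_simp
  have hsum : HasSum (fun k => ∫ v in Ioi (0 : ℝ), F k v) ((4 * t) ^ a / 2) := by
    simp only [hval]
    convert! (NormedSpace.expSeries_div_hasSum_exp (b * u ^ 2)).mul_left
      (b ^ (-a) / 2 * Real.exp (-(b * u ^ 2))) using 1
    rw [← Real.exp_eq_exp_ℝ, mul_assoc, ← Real.exp_add]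
    rw [hb, Real.inv_rpow (by positivity), Real.rpow_neg (by positivity)]
    simp
  have hnorm : ∀ k, ∫ v in Ioi (0 : ℝ), ‖F k v‖ = ∫ v in Ioi (0 : ℝ), F k v := fun k =>
    setIntegral_congr_fun measurableSet_Ioi fun v hv => Real.norm_of_nonneg (hF0 k v hv)
  have hsum' : Summable fun k => ∫ v in Ioi (0 : ℝ), ‖F k v‖ := by
    simp only [hnorm]; exact hsum.summable
  have hpt : ∀ v ∈ Ioi (0 : ℝ), besselSeries a ((u * v / (4 * t)) ^ 2) *
      Real.exp (-(u ^ 2 + v ^ 2) / (4 * t)) * v ^ (2 * a - 1) = ∑' k, F k v := by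
    intro v hv
    have hv : 0 < v := hv
    have h1 := (hasSum_besselSeries ha ((u * v / (4 * t)) ^ 2)).mul_right
      (Real.exp (-(u ^ 2 + v ^ 2) / (4 * t)) * v ^ (2 * a - 1))
    rw [mul_assoc, ← h1.tsum_eq]
    refine tsum_congr fun k => ?_
    simp only [hF, hc]
    rw [show -(u ^ 2 + v ^ 2) / (4 * t) = -(b * u ^ 2) + -b * v ^ 2 by rw [hb]; field_simp; ring,
      Real.exp_add, show u * v / (4 * t) = u * b * v by rw [hb]; field_simp, ← pow_mul,
      mul_pow (u * b) v,
      show 2 * ((k : ℝ) + a) - 1 = (2 * a - 1) + ((2 * k : ℕ) : ℝ) by push_cast; ring,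
      Real.rpow_add hv, Real.rpow_natCast]
    ring
  have hs := hasSum_integral_of_summable_integral_norm hint hsum'
  have hI : ∫ v in Ioi (0 : ℝ), besselSeries a ((u * v / (4 * t)) ^ 2) *
      Real.exp (-(u ^ 2 + v ^ 2) / (4 * t)) * v ^ (2 * a - 1) = (4 * t) ^ a / 2 := by
    rw [← hs.unique hsum]
    exact setIntegral_congr_fun measurableSet_Ioi hpt
  refine ⟨?_, hI⟩
  -- a function that is not integrable would have integral zero
  by_contra hni
  rw [integral_undef hni] at hI
  have : 0 < (4 * t) ^ a / 2 := by positivity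
  linarith

/-! ### Asymptotics of the modified Bessel function -/

/-- Solutions of `E'' + 4E' = c s⁻² E` converge at infinity, with rates for the function and its
derivative. -/
lemma exists_limit_of_ode {c : ℝ} {E D : ℝ → ℝ} (hE : ∀ s, 0 < s → HasDerivAt E (D s) s)
    (hD : ∀ s, 0 < s → HasDerivAt D (c / s ^ 2 * E s - 4 * D s) s) :
    ∃ K l : ℝ, 0 ≤ K ∧ ∀ s, 1 ≤ s → |D s| ≤ K / s ^ 2 ∧ |E s - l| ≤ K / s := by
  have hint : interior (Ici (1 : ℝ)) = Ioi 1 := interior_Ici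
  -- `B = D + 4E` and `D` are the neutral and the decaying mode of the system; the energy
  -- `D² + B²` grows at most by the factor `exp (|c| / 2)` on `[1, ∞)`.
  obtain ⟨M, hM0, hM⟩ : ∃ M, 0 ≤ M ∧ ∀ s, 1 ≤ s → |E s| ≤ M := by
    set V : ℝ → ℝ := fun s => (D s ^ 2 + (D s + 4 * E s) ^ 2) * Real.exp (|c| * s⁻¹) with hV
    have hVd : ∀ s, 0 < s → HasDerivAt V
        ((2 * D s * (c / s ^ 2 * E s - 4 * D s) + 2 * (D s + 4 * E s) *
          ((c / s ^ 2 * E s - 4 * D s) + 4 * D s)) * Real.exp (|c| * s⁻¹) +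
          (D s ^ 2 + (D s + 4 * E s) ^ 2) *
            (Real.exp (|c| * s⁻¹) * (|c| * (-(s ^ 2)⁻¹)))) s := by
      intro s hs
      have h1 := (hD s hs).pow 2
      have h2 := ((hD s hs).add ((hE s hs).const_mul 4)).pow 2
      have h3 := ((hasDerivAt_inv hs.ne').const_mul |c|).exp
      convert! (h1.add h2).mul h3 using 1
      simp
    have hanti : AntitoneOn V (Ici 1) := by
      refine antitoneOn_of_deriv_nonpos (convex_Ici 1)
        (fun s hs => (hVd s (by linarith [show (1 : ℝ) ≤ s from hs])).continuousAt.continuousWithinAt)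
        (fun s hs => ?_) fun s hs => ?_ <;> rw [hint] at hs <;>
        have hs0 : (0 : ℝ) < s := by linarith [show (1 : ℝ) < s from hs]
      · exact (hVd s hs0).differentiableAt.differentiableWithinAt
      · rw [(hVd s hs0).deriv]
        have e : (2 * D s * (c / s ^ 2 * E s - 4 * D s) + 2 * (D s + 4 * E s) *
          ((c / s ^ 2 * E s - 4 * D s) + 4 * D s)) * Real.exp (|c| * s⁻¹) +
          (D s ^ 2 + (D s + 4 * E s) ^ 2) *
            (Real.exp (|c| * s⁻¹) * (|c| * (-(s ^ 2)⁻¹))) =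
          -(Real.exp (|c| * s⁻¹) * (8 * D s ^ 2 + (s ^ 2)⁻¹ * (|c| * D s ^ 2 +
            |c| * (D s + 4 * E s) ^ 2 - c / 2 * ((D s + 4 * E s) ^ 2 - D s ^ 2)))) := by
          field_simp
          ring
        rw [e, neg_nonpos]
        have h1 : c * ((D s + 4 * E s) ^ 2 - D s ^ 2) ≤
            |c| * ((D s + 4 * E s) ^ 2 + D s ^ 2) := by
          have a1 := mul_le_mul_of_nonneg_right (le_abs_self c) (sq_nonneg (D s + 4 * E s))
          have a2 := mul_le_mul_of_nonneg_right (neg_abs_le c) (sq_nonneg (D s))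
          nlinarith
        have h2 : 0 ≤ |c| * ((D s + 4 * E s) ^ 2 + D s ^ 2) := by positivity
        have h3 : 0 ≤ |c| * D s ^ 2 + |c| * (D s + 4 * E s) ^ 2 -
            c / 2 * ((D s + 4 * E s) ^ 2 - D s ^ 2) := by linarith
        positivity
    refine ⟨1 + V 1, by positivity, fun s hs => ?_⟩
    have h1 : V s ≤ V 1 := hanti self_mem_Ici hs hs
    have h2 : D s ^ 2 + (D s + 4 * E s) ^ 2 ≤ V s := by
      refine le_mul_of_one_le_right (by positivity) (Real.one_le_exp ?_)
      have : 0 < s := by linarith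
      positivity
    have h3 : E s ^ 2 ≤ V 1 := by nlinarith [sq_nonneg (2 * D s + 4 * E s)]
    have h4 : |E s| ^ 2 ≤ V 1 := by rwa [sq_abs]
    nlinarith [abs_nonneg (E s), sq_nonneg (|E s| - 1)]
  -- `e^{4s} (K s⁻² ∓ D)` is increasing on `[1, ∞)` and nonnegative at `1`.
  set K := |c| * M + |D 1| with hK
  have hK0 : 0 ≤ K := by positivity
  have hDb : ∀ σ : ℝ, |σ| = 1 → ∀ s, 1 ≤ s → σ * D s ≤ K / s ^ 2 := by
    intro σ hσ s hs
    set U : ℝ → ℝ := fun s => Real.exp (4 * s) * (K * (s ^ 2)⁻¹ - σ * D s) with hU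
    have hUd : ∀ s, 0 < s → HasDerivAt U
        (Real.exp (4 * s) * 4 * (K * (s ^ 2)⁻¹ - σ * D s) + Real.exp (4 * s) *
          (K * (-(2 * s) / (s ^ 2) ^ 2) - σ * (c / s ^ 2 * E s - 4 * D s))) s := by
      intro s hs
      have h1 := ((hasDerivAt_id s).const_mul 4).exp
      have h2 := ((hasDerivAt_pow 2 s).inv (by positivity)).const_mul K
      have h3 := (hD s hs).const_mul σ
      convert! h1.mul (h2.sub h3) using 1
      simp
    have hmono : MonotoneOn U (Ici 1) := by
      refine monotoneOn_of_deriv_nonneg (convex_Ici 1)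
        (fun s hs => (hUd s (by linarith [show (1 : ℝ) ≤ s from hs])).continuousAt.continuousWithinAt)
        (fun s hs => ?_) fun s hs => ?_ <;> rw [hint] at hs <;>
        have hs0 : (0 : ℝ) < s := by linarith [show (1 : ℝ) < s from hs]
      · exact (hUd s hs0).differentiableAt.differentiableWithinAt
      · rw [(hUd s hs0).deriv]
        have hs1 : (1 : ℝ) ≤ s := (show (1 : ℝ) < s from hs).le
        have e : Real.exp (4 * s) * 4 * (K * (s ^ 2)⁻¹ - σ * D s) + Real.exp (4 * s) *
          (K * (-(2 * s) / (s ^ 2) ^ 2) - σ * (c / s ^ 2 * E s - 4 * D s)) =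
          Real.exp (4 * s) * (s ^ 2)⁻¹ * (K * (4 - 2 * s⁻¹) - σ * c * E s) := by
          field_simp
          ring
        rw [e]
        have h1 : s⁻¹ ≤ 1 := inv_le_one_of_one_le₀ hs1
        have h2 : σ * c * E s ≤ |c| * M := by
          refine (le_abs_self _).trans ?_
          rw [abs_mul, abs_mul, hσ, one_mul]
          exact mul_le_mul_of_nonneg_left (hM s hs1) (abs_nonneg c)
        have h3 : |c| * M ≤ K := by linarith [abs_nonneg (D 1)]
        have h4 : 0 ≤ K * (4 - 2 * s⁻¹) - σ * c * E s := by nlinarith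
        positivity
    have h1 : U 1 ≤ U s := hmono self_mem_Ici hs hs
    have h2 : 0 ≤ U 1 := by
      refine mul_nonneg (Real.exp_pos _).le ?_
      have : σ * D 1 ≤ |D 1| := (le_abs_self _).trans (by rw [abs_mul, hσ, one_mul])
      have h3 : 0 ≤ |c| * M := by positivity
      simp only [one_pow, inv_one, mul_one]
      linarith
    have h3 : 0 ≤ K * (s ^ 2)⁻¹ - σ * D s :=
      nonneg_of_mul_nonneg_right (h2.trans h1) (Real.exp_pos _)
    rw [div_eq_mul_inv]
    linarith
  have hDb' : ∀ s, 1 ≤ s → |D s| ≤ K / s ^ 2 := fun s hs => abs_le.2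
    ⟨by linarith [hDb (-1) (by simp) s hs], by linarith [hDb 1 (by simp) s hs]⟩
  -- hence `σE - K/s` is increasing for `σ = ±1`, so that `E` converges at the rate `K/s`.
  have hmono : ∀ σ : ℝ, |σ| = 1 → MonotoneOn (fun s => σ * E s - K * s⁻¹) (Ici 1) := by
    intro σ hσ
    have hd : ∀ s, 0 < s → HasDerivAt (fun s => σ * E s - K * s⁻¹)
        (σ * D s - K * (-(s ^ 2)⁻¹)) s := fun s hs =>
      ((hE s hs).const_mul σ).sub ((hasDerivAt_inv hs.ne').const_mul K)
    refine monotoneOn_of_deriv_nonneg (convex_Ici 1)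
      (fun s hs => (hd s (by linarith [show (1 : ℝ) ≤ s from hs])).continuousAt.continuousWithinAt)
      (fun s hs => ?_) fun s hs => ?_ <;> rw [hint] at hs <;>
      have hs0 : (0 : ℝ) < s := by linarith [show (1 : ℝ) < s from hs]
    · exact (hd s hs0).differentiableAt.differentiableWithinAt
    · rw [(hd s hs0).deriv]
      have := hDb (-σ) (by rwa [abs_neg]) s (show (1 : ℝ) < s from hs).le
      rw [div_eq_mul_inv] at this
      linarith
  have hlim : ∃ l, Tendsto E atTop (𝓝 l) := by
    set G : ℝ → ℝ := fun s => 1 * E (max s 1) - K * (max s 1)⁻¹ with hG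
    have hGm : Monotone G := fun s s' h =>
      
      hmono 1 (by simp) (mem_Ici.2 (le_max_right s 1)) (mem_Ici.2 (le_max_right s' 1))
        (max_le_max_right 1 h)
    have hGb : BddAbove (range G) := by
      refine ⟨M, ?_⟩
      rintro _ ⟨s, rfl⟩
      have h1 := (abs_le.1 (hM (max s 1) (le_max_right _ _))).2
      have h2 : 0 ≤ K * (max s 1)⁻¹ := mul_nonneg hK0 (inv_nonneg.2 (by positivity))
      simp only [hG]
      linarith
    have h1 := tendsto_atTop_ciSup hGm hGb
    have h2 : Tendsto (fun s : ℝ => K * s⁻¹) atTop (𝓝 (K * 0)) :=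
      tendsto_inv_atTop_zero.const_mul K
    refine ⟨_, (h1.add h2).congr' ?_⟩
    filter_upwards [eventually_ge_atTop 1] with s hs
    simp [hG, max_eq_left hs]
  obtain ⟨l, hl⟩ := hlim
  refine ⟨K, l, hK0, fun s hs => ⟨hDb' s hs, ?_⟩⟩
  have h2 : Tendsto (fun s : ℝ => K * s⁻¹) atTop (𝓝 (K * 0)) :=
    tendsto_inv_atTop_zero.const_mul K
  have hle : ∀ σ : ℝ, |σ| = 1 → σ * E s - K * s⁻¹ ≤ σ * l - K * 0 := fun σ hσ => by
    refine ge_of_tendsto ((hl.const_mul σ).sub h2) ?_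
    filter_upwards [eventually_ge_atTop s] with r hr
    exact hmono σ hσ hs (hs.trans hr) hr
  have h3 := hle 1 (by simp)
  have h4 := hle (-1) (by simp)
  rw [div_eq_mul_inv, abs_le]
  constructor <;> linarith

/-- The profile `E_λ(s) = 2√π s^λ e^{-2s} Φ_{λ+1/2}(s²) = √(4πs) e^{-2s} I_{λ-1/2}(2s)`, by which
the heat kernel of the Bessel operator differs from the Euclidean one. -/
noncomputable def profile (lam s : ℝ) : ℝ :=
  2 * √Real.pi * s ^ lam * Real.exp (-2 * s) * besselSeries (lam + 1 / 2) (s ^ 2)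

/-- The derivative of `profile lam`. -/
noncomputable def profileDeriv (lam s : ℝ) : ℝ :=
  lam / s * profile lam s - 2 * profile lam s + 2 * profile (lam + 1) s

lemma hasDerivAt_profile {lam : ℝ} (hlam : -1 / 2 < lam) {s : ℝ} (hs : 0 < s) :
    HasDerivAt (profile lam) (profileDeriv lam s) s := by
  have h1 := Real.hasDerivAt_rpow_const (p := lam) (Or.inl hs.ne')
  have h2 := ((hasDerivAt_id s).const_mul (-2)).exp
  have h3 := (hasDerivAt_besselSeries (a := lam + 1 / 2) (by linarith) (s ^ 2)).comp s
    (hasDerivAt_pow 2 s)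
  convert! ((h1.const_mul (2 * √Real.pi)).mul h2).mul h3 using 1
  simp only [profileDeriv, profile, id, Function.comp, Pi.mul_apply]
  rw [show lam + 1 + 1 / 2 = lam + 1 / 2 + 1 by ring, Real.rpow_add_one hs.ne',
    Real.rpow_sub_one hs.ne']
  push_cast
  field_simp
  ring

lemma profile_recurrence {lam : ℝ} (hlam : -1 / 2 < lam) {s : ℝ} (hs : 0 < s) :
    profile (lam + 1 + 1) s + (lam + 1 / 2) / s * profile (lam + 1) s = profile lam s := by
  simp only [profile]
  rw [show lam + 1 + 1 + 1 / 2 = lam + 1 / 2 + 1 + 1 by ring,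
    show lam + 1 + 1 / 2 = lam + 1 / 2 + 1 by ring,
    ← besselSeries_recurrence (a := lam + 1 / 2) (by linarith) (s ^ 2),
    Real.rpow_add_one hs.ne', Real.rpow_add_one hs.ne']
  field_simp

/-- The profile solves `E'' + 4E' = λ(λ-1) s⁻² E`, which is the modified Bessel equation. -/
lemma hasDerivAt_profileDeriv {lam : ℝ} (hlam : -1 / 2 < lam) {s : ℝ} (hs : 0 < s) :
    HasDerivAt (profileDeriv lam)
      (lam * (lam - 1) / s ^ 2 * profile lam s - 4 * profileDeriv lam s) s := by
  have h1 := hasDerivAt_profile hlam hs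
  have h2 := hasDerivAt_profile (lam := lam + 1) (by linarith) hs
  have h3 := (hasDerivAt_inv hs.ne').const_mul lam
  convert! ((h3.mul h1).sub (h1.const_mul 2)).add (h2.const_mul 2) using 1
  have h4 := profile_recurrence hlam hs
  simp only [profileDeriv]
  rw [← h4]
  field_simp
  ring

lemma continuousOn_profile {lam : ℝ} (hlam : -1 / 2 < lam) : ContinuousOn (profile lam) (Ioi 0) :=
  fun _ hs => (hasDerivAt_profile hlam hs).continuousAt.continuousWithinAt

lemma continuousOn_profileDeriv {lam : ℝ} (hlam : -1 / 2 < lam) :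
    ContinuousOn (profileDeriv lam) (Ioi 0) :=
  fun _ hs => (hasDerivAt_profileDeriv hlam hs).continuousAt.continuousWithinAt

@[fun_prop]
lemma measurable_profile {lam : ℝ} (hlam : -1 / 2 < lam) : Measurable (profile lam) := by
  have := (continuous_besselSeries (a := lam + 1 / 2) (by linarith)).measurable
  unfold profile
  fun_prop

lemma measurable_profileDeriv {lam : ℝ} (hlam : -1 / 2 < lam) : Measurable (profileDeriv lam) := by
  have h1 := measurable_profile hlam
  have h2 := measurable_profile (lam := lam + 1) (by linarith)
  unfold profileDeriv
  fun_prop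

lemma exists_profile_le_of_le {lam : ℝ} (hlam : -1 / 2 < lam) (R : ℝ) :
    ∃ C, 0 ≤ C ∧ ∀ s, 0 < s → s ≤ R →
      |profile lam s| ≤ C * s ^ lam ∧ |profileDeriv lam s| ≤ C * s ^ (lam - 1) := by
  set ψ : ℝ → ℝ → ℝ := fun lam s => 2 * √Real.pi * Real.exp (-2 * s) *
    besselSeries (lam + 1 / 2) (s ^ 2) with hψ
  have hc0 := continuous_besselSeries (a := lam + 1 / 2) (by linarith)
  have hc1 := continuous_besselSeries (a := lam + 1 + 1 / 2) (by linarith)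
  obtain ⟨C₁, hC₁⟩ := isCompact_Icc (a := (0 : ℝ)) (b := R) |>.exists_bound_of_continuousOn
    (f := ψ lam) (by simp only [hψ]; fun_prop)
  obtain ⟨C₂, hC₂⟩ := isCompact_Icc (a := (0 : ℝ)) (b := R) |>.exists_bound_of_continuousOn
    (f := fun s => lam * ψ lam s - 2 * s * ψ lam s + 2 * s ^ 2 * ψ (lam + 1) s)
    (by simp only [hψ]; fun_prop)
  refine ⟨max (max C₁ C₂) 0, le_max_right _ _, fun s hs hsR => ⟨?_, ?_⟩⟩
  · have h1 : profile lam s = ψ lam s * s ^ lam := by simp only [profile, hψ]; ring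
    rw [h1, abs_mul, abs_of_pos (Real.rpow_pos_of_pos hs _)]
    gcongr
    exact (hC₁ s ⟨hs.le, hsR⟩).trans ((le_max_left _ _).trans (le_max_left _ _))
  · have h1 : profileDeriv lam s = (lam * ψ lam s - 2 * s * ψ lam s + 2 * s ^ 2 * ψ (lam + 1) s) *
        s ^ (lam - 1) := by
      simp only [profileDeriv, profile, hψ]
      rw [Real.rpow_add_one hs.ne', Real.rpow_sub_one hs.ne']
      field_simp
    rw [h1, abs_mul, abs_of_pos (Real.rpow_pos_of_pos hs _)]
    gcongr
    exact (hC₂ s ⟨hs.le, hsR⟩).trans ((le_max_right _ _).trans (le_max_left _ _))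

/-- The limit exists; that it is `1` is shown in `exists_profile_sub_one_le`. -/
lemma exists_limit_profile {lam : ℝ} (hlam : -1 / 2 < lam) :
    ∃ K l : ℝ, 0 ≤ K ∧ ∀ s, 1 ≤ s → |profileDeriv lam s| ≤ K / s ^ 2 ∧ |profile lam s - l| ≤ K / s :=
  exists_limit_of_ode (fun _ hs => hasDerivAt_profile hlam hs)
    fun _ hs => hasDerivAt_profileDeriv hlam hs

/-- The mass of the heat kernel at time `1/4`, written with the profile. -/
lemma integral_profile {lam : ℝ} (hlam : -1 / 2 < lam) {u : ℝ} (hu : 0 < u) :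
    ∫ v in Ioi (0 : ℝ), (v / u) ^ lam * Real.exp (-(v - u) ^ 2) * profile lam (u * v) =
      √Real.pi := by
  have h := (integral_besselSeries_mul_exp (a := lam + 1 / 2) (by linarith)
    (t := 1 / 4) (by norm_num) u).2
  have h1 : ∫ v in Ioi (0 : ℝ), (v / u) ^ lam * Real.exp (-(v - u) ^ 2) * profile lam (u * v) =
      ∫ v in Ioi (0 : ℝ), (2 * √Real.pi) * (besselSeries (lam + 1 / 2)
        ((u * v / (4 * (1 / 4))) ^ 2) * Real.exp (-(u ^ 2 + v ^ 2) / (4 * (1 / 4))) *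
          v ^ (2 * (lam + 1 / 2) - 1)) := by
    refine setIntegral_congr_fun measurableSet_Ioi fun v hv => ?_
    have hv : 0 < v := hv
    simp only [profile]
    rw [Real.div_rpow hv.le hu.le, Real.mul_rpow hu.le hv.le,
      show 2 * (lam + 1 / 2) - 1 = lam + lam by ring, Real.rpow_add hv,
      show 4 * (1 / 4 : ℝ) = 1 by norm_num, div_one, div_one,
      show -(u ^ 2 + v ^ 2) = -(v - u) ^ 2 + -2 * (u * v) by ring, Real.exp_add]
    have := Real.rpow_pos_of_pos hu lam
    field_simp
  rw [h1, integral_const_mul, h]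
  simp
  ring

/-- The limit of the profile is found by letting `u → ∞` in `integral_profile`, where the mass
concentrates at `v - u = O(1)`. For `λ > 0` the profile is bounded, so that the convergence is
dominated. -/
lemma tendsto_profile_of_pos {lam : ℝ} (hlam : 0 < lam) :
    Tendsto (profile lam) atTop (𝓝 1) := by
  have hlam' : -1 / 2 < lam := by linarith
  obtain ⟨K, l, hK0, hK⟩ := exists_limit_profile hlam'
  obtain ⟨C, hC0, hC⟩ := exists_profile_le_of_le hlam' 1
  have hl : Tendsto (profile lam) atTop (𝓝 l) := by
    rw [tendsto_iff_norm_sub_tendsto_zero]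
    refine squeeze_zero' (Eventually.of_forall fun _ => norm_nonneg _)
      (g := fun s => K / s) ?_ (tendsto_const_nhds.div_atTop tendsto_id)
    filter_upwards [eventually_ge_atTop 1] with s hs
    exact (hK s hs).2
  have hbdd : ∀ s, 0 < s → |profile lam s| ≤ C + (|l| + K) := by
    intro s hs
    rcases le_total s 1 with h | h
    · have h1 := (hC s hs h).1
      have h2 : s ^ lam ≤ 1 := Real.rpow_le_one hs.le h hlam.le
      have h3 : C * s ^ lam ≤ C := mul_le_of_le_one_right hC0 h2
      linarith [abs_nonneg l]
    · have h1 := (hK s h).2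
      have h2 : K / s ≤ K := div_le_self hK0 h
      have h3 : |profile lam s| ≤ |profile lam s - l| + |l| := by
        simpa using abs_add_le (profile lam s - l) l
      linarith
  set F : ℝ → ℝ → ℝ := fun u ξ => (Ioi (0 : ℝ)).indicator
    (fun v => (v / u) ^ lam * Real.exp (-(v - u) ^ 2) * profile lam (u * v)) (u + ξ) with hF
  have hFint : ∀ u, 0 < u → ∫ ξ, F u ξ = √Real.pi := by
    intro u hu
    simp only [hF]
    rw [integral_add_left_eq_self
      (f := (Ioi (0 : ℝ)).indicator
        (fun v => (v / u) ^ lam * Real.exp (-(v - u) ^ 2) * profile lam (u * v))) u,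
      integral_indicator measurableSet_Ioi, integral_profile hlam' hu]
  have hlimF : Tendsto (fun u => ∫ ξ, F u ξ) atTop (𝓝 (∫ ξ, Real.exp (-1 * ξ ^ 2) * l)) := by
    refine tendsto_integral_filter_of_dominated_convergence
      (fun ξ => (C + (|l| + K)) * Real.exp (lam ^ 2 / 2) * Real.exp (-(1 / 2) * ξ ^ 2)) ?_ ?_ ?_ ?_
    · refine Eventually.of_forall fun u => Measurable.aestronglyMeasurable ?_
      have := measurable_profile hlam'
      exact (Measurable.indicator (by fun_prop) measurableSet_Ioi).comp (measurable_const_add u)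
    · filter_upwards [eventually_ge_atTop 1] with u hu
      refine Eventually.of_forall fun ξ => ?_
      have hu0 : 0 < u := by linarith
      simp only [hF, indicator_apply]
      split_ifs with h
      · have h : 0 < u + ξ := h
        rw [norm_mul, norm_mul, Real.norm_of_nonneg (Real.exp_pos _).le,
          Real.norm_of_nonneg (by positivity), Real.norm_eq_abs]
        have e1 : (u + ξ) / u ≤ Real.exp |ξ| := by
          rw [div_le_iff₀ hu0]
          have h1 := Real.add_one_le_exp |ξ|
          have h2 := le_abs_self ξ
          nlinarith [abs_nonneg ξ]
        have e2 : ((u + ξ) / u) ^ lam ≤ Real.exp (lam * |ξ|) := by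
          rw [mul_comm, Real.exp_mul]
          exact Real.rpow_le_rpow (by positivity) e1 hlam.le
        have e3 := hbdd (u * (u + ξ)) (by positivity)
        calc _ ≤ Real.exp (lam * |ξ|) * Real.exp (-(u + ξ - u) ^ 2) * (C + (|l| + K)) := by
              gcongr
          _ = (C + (|l| + K)) * Real.exp (lam * |ξ| - |ξ| ^ 2) := by
              rw [Real.exp_sub, sq_abs, show (u + ξ - u) = ξ by ring, Real.exp_neg]
              ring
          _ ≤ (C + (|l| + K)) * Real.exp (lam ^ 2 / 2 + -(1 / 2) * ξ ^ 2) := by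
              gcongr
              rw [← sq_abs ξ]
              nlinarith [sq_nonneg (lam - |ξ|)]
          _ = _ := by rw [Real.exp_add]; ring
      · simp only [norm_zero]; positivity
    · exact (integrable_exp_neg_mul_sq (by norm_num)).const_mul _
    · refine Eventually.of_forall fun ξ => ?_
      have h1 : Tendsto (fun u : ℝ => ((u + ξ) / u) ^ lam) atTop (𝓝 1) := by
        have : Tendsto (fun u : ℝ => (u + ξ) / u) atTop (𝓝 (1 + 0)) := by
          refine (tendsto_const_nhds.add (tendsto_const_nhds (x := ξ).div_atTop tendsto_id)).congr' ?_
          filter_upwards [eventually_gt_atTop 0] with u hu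
          simp only [id]
          field_simp
        simpa using this.rpow_const (p := lam) (by simp)
      have h2 : Tendsto (fun u : ℝ => profile lam (u * (u + ξ))) atTop (𝓝 l) :=
        hl.comp (tendsto_id.atTop_mul_atTop₀ (tendsto_atTop_add_const_right _ _ tendsto_id))
      have h3 := (h1.mul_const (Real.exp (-1 * ξ ^ 2))).mul h2
      rw [one_mul] at h3
      refine h3.congr' ?_
      filter_upwards [eventually_gt_atTop (-ξ)] with u hu
      have : u + ξ ∈ Ioi (0 : ℝ) := by simp; linarith
      simp only [hF]
      rw [indicator_of_mem this, show u + ξ - u = ξ by ring]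
      simp
  have h1 : Tendsto (fun u => ∫ ξ, F u ξ) atTop (𝓝 √Real.pi) :=
    tendsto_const_nhds.congr' (by
      filter_upwards [eventually_gt_atTop 0] with u hu
      exact (hFint u hu).symm)
  have h2 := tendsto_nhds_unique hlimF h1
  rw [integral_mul_const, integral_gaussian] at h2
  have h3 : 0 < √Real.pi := by positivity
  have h4 : l = 1 := by
    rw [div_one] at h2
    exact mul_left_cancel₀ h3.ne' (by rw [h2, mul_one])
  rwa [h4] at hl

/-- The asymptotics `I_ν(z) ~ e^z/√(2πz)`, with a rate for the function and its derivative. -/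
lemma exists_profile_sub_one_le {lam : ℝ} (hlam : -1 / 2 < lam) {δ : ℝ} (hδ : 0 < δ) :
    ∃ C, 0 ≤ C ∧ ∀ s, δ ≤ s → |profile lam s - 1| ≤ C / s ∧ |profileDeriv lam s| ≤ C / s ^ 2 := by
  obtain ⟨K, l, hK0, hK⟩ := exists_limit_profile hlam
  have hl : l = 1 := by
    have hE : Tendsto (profile lam) atTop (𝓝 l) := by
      rw [tendsto_iff_norm_sub_tendsto_zero]
      refine squeeze_zero' (Eventually.of_forall fun _ => norm_nonneg _)
        (g := fun s => K / s) ?_ (tendsto_const_nhds.div_atTop tendsto_id)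
      filter_upwards [eventually_ge_atTop 1] with s hs
      exact (hK s hs).2
    have hD : Tendsto (profileDeriv lam) atTop (𝓝 0) := by
      refine squeeze_zero_norm' (a := fun s => K / s ^ 2) ?_
        (tendsto_const_nhds.div_atTop (tendsto_pow_atTop two_ne_zero))
      filter_upwards [eventually_ge_atTop 1] with s hs
      exact (hK s hs).1
    -- `λ + 1` is positive, and the recurrence `E_λ' = (λ/s) E_λ - 2E_λ + 2E_{λ+1}` shows in the limit
    -- that `E_λ` and `E_{λ+1}` have the same limit.
    have h1 := tendsto_profile_of_pos (lam := lam + 1) (by linarith)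
    have h2 : Tendsto (fun s : ℝ => lam / s * profile lam s - 2 * profile lam s +
        2 * profile (lam + 1) s) atTop (𝓝 (0 * l - 2 * l + 2 * 1)) :=
      (((tendsto_const_nhds.div_atTop tendsto_id).mul hE).sub (hE.const_mul 2)).add (h1.const_mul 2)
    have := tendsto_nhds_unique hD h2
    linarith
  subst hl
  have hcE : ContinuousOn (fun s => s * (profile lam s - 1)) (Icc δ 1) :=
    continuousOn_id.mul (((continuousOn_profile hlam).mono fun s hs => hδ.trans_le hs.1).sub
      continuousOn_const)
  have hcD : ContinuousOn (fun s => s ^ 2 * profileDeriv lam s) (Icc δ 1) :=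
    (continuousOn_id.pow 2).mul ((continuousOn_profileDeriv hlam).mono fun s hs => hδ.trans_le hs.1)
  obtain ⟨C₁, hC₁⟩ := isCompact_Icc.exists_bound_of_continuousOn hcE
  obtain ⟨C₂, hC₂⟩ := isCompact_Icc.exists_bound_of_continuousOn hcD
  refine ⟨max K (max C₁ C₂), hK0.trans (le_max_left _ _), fun s hs => ?_⟩
  have hs0 : 0 < s := hδ.trans_le hs
  rcases le_total s 1 with h | h
  · have h1 := hC₁ s ⟨hs, h⟩
    have h2 := hC₂ s ⟨hs, h⟩
    rw [norm_mul, Real.norm_of_nonneg (by positivity), Real.norm_eq_abs] at h1 h2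
    rw [le_div_iff₀ hs0, le_div_iff₀ (by positivity), mul_comm, mul_comm |profileDeriv lam s|]
    exact ⟨h1.trans ((le_max_left _ _).trans (le_max_right _ _)),
      h2.trans ((le_max_right _ _).trans (le_max_right _ _))⟩
  · obtain ⟨h1, h2⟩ := hK s h
    exact ⟨h2.trans (by gcongr; exact le_max_left _ _), h1.trans (by gcongr; exact le_max_left _ _)⟩

/-! ### The Euclidean heat kernel -/

/-- The Euclidean heat kernel `(4πt)^(-n/2) exp(-|z|²/(4t))` on `ℝⁿ`. -/
noncomputable def gauss (n : ℕ) (t : ℝ) (z : EuclideanSpace ℝ (Fin n)) : ℝ :=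
  (4 * Real.pi * t) ^ (-(n : ℝ) / 2) * Real.exp (-‖z‖ ^ 2 / (4 * t))

/-- The time derivative of the Euclidean heat kernel. -/
noncomputable def gaussDeriv (n : ℕ) (t : ℝ) (z : EuclideanSpace ℝ (Fin n)) : ℝ :=
  (‖z‖ ^ 2 / (4 * t ^ 2) - n / (2 * t)) * gauss n t z

variable {n : ℕ}

lemma gauss_nonneg {t : ℝ} (ht : 0 < t) (z : EuclideanSpace ℝ (Fin n)) : 0 ≤ gauss n t z := by
  unfold gauss; positivity

lemma hasDerivAt_gauss {t : ℝ} (ht : 0 < t) (z : EuclideanSpace ℝ (Fin n)) :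
    HasDerivAt (fun s => gauss n s z) (gaussDeriv n t z) t := by
  have hp : 0 < 4 * Real.pi * t := by positivity
  have h1 := ((hasDerivAt_id t).const_mul (4 * Real.pi)).rpow_const (p := -(n : ℝ) / 2)
    (Or.inl hp.ne')
  have h2 := ((((hasDerivAt_id t).const_mul 4).inv (by simp; exact ht.ne')).const_mul
    (-‖z‖ ^ 2)).exp
  simp only [id] at h1 h2
  convert! h1.mul h2 using 1
  unfold gaussDeriv gauss
  simp only [Pi.inv_apply, ← div_eq_mul_inv]
  rw [Real.rpow_sub_one hp.ne']
  field_simp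
  ring

@[fun_prop]
lemma measurable_gauss : Measurable fun p : ℝ × EuclideanSpace ℝ (Fin n) => gauss n p.1 p.2 := by
  unfold gauss; fun_prop

@[fun_prop]
lemma measurable_gaussDeriv :
    Measurable fun p : ℝ × EuclideanSpace ℝ (Fin n) => gaussDeriv n p.1 p.2 := by
  unfold gaussDeriv gauss; fun_prop

lemma integrable_gauss {t : ℝ} (ht : 0 < t) : Integrable (gauss n t) := by
  have h : ∫ z : EuclideanSpace ℝ (Fin n), Real.exp (-(4 * t)⁻¹ * ‖z‖ ^ 2) ≠ 0 := by
    rw [GaussianFourier.integral_rexp_neg_mul_sq_norm (by positivity)]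
    positivity
  have h2 := (not_imp_comm.1 integral_undef h).const_mul ((4 * Real.pi * t) ^ (-(n : ℝ) / 2))
  refine h2.congr (Eventually.of_forall fun z => ?_)
  unfold gauss
  dsimp only
  congr 2
  field_simp

lemma integral_gauss {t : ℝ} (ht : 0 < t) : ∫ z, gauss n t z = 1 := by
  have h : ∀ z : EuclideanSpace ℝ (Fin n), gauss n t z =
      (4 * Real.pi * t) ^ (-(n : ℝ) / 2) * Real.exp (-(4 * t)⁻¹ * ‖z‖ ^ 2) := by
    intro z
    unfold gauss
    congr 2
    field_simp
  simp only [h]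
  rw [integral_const_mul, GaussianFourier.integral_rexp_neg_mul_sq_norm (by positivity),
    finrank_euclideanSpace_fin, show Real.pi / (4 * t)⁻¹ = 4 * Real.pi * t by field_simp,
    ← Real.rpow_add (by positivity)]
  rw [show -(n : ℝ) / 2 + n / 2 = 0 by ring, Real.rpow_zero]

lemma gauss_eq {t : ℝ} (ht : 0 < t) (z : EuclideanSpace ℝ (Fin n)) :
    gauss n t z = 2 ^ ((n : ℝ) / 2) * gauss n (2 * t) z * Real.exp (-(‖z‖ ^ 2 / (8 * t))) := by
  have h1 : (4 * Real.pi * t) ^ (-(n : ℝ) / 2) =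
      2 ^ ((n : ℝ) / 2) * (4 * Real.pi * (2 * t)) ^ (-(n : ℝ) / 2) := by
    rw [show 4 * Real.pi * (2 * t) = 2 * (4 * Real.pi * t) by ring,
      Real.mul_rpow two_pos.le (by positivity), ← mul_assoc, ← Real.rpow_add two_pos,
      show (n : ℝ) / 2 + -(n : ℝ) / 2 = 0 by ring, Real.rpow_zero, one_mul]
  have h2 : -‖z‖ ^ 2 / (4 * t) = -‖z‖ ^ 2 / (4 * (2 * t)) + -(‖z‖ ^ 2 / (8 * t)) := by
    field_simp
    ring
  unfold gauss
  rw [h1, h2, Real.exp_add]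
  ring

/-- The constant `2^(n/2)` that is lost when the time of a heat kernel is doubled. -/
noncomputable def doublingConst (n : ℕ) : ℝ := 2 ^ ((n : ℝ) / 2)

lemma doublingConst_pos (n : ℕ) : 0 < doublingConst n := by unfold doublingConst; positivity

lemma gauss_le_gauss {s t : ℝ} (hs : 0 < s) (h1 : s ≤ t) (h2 : t ≤ 4 * s)
    (z : EuclideanSpace ℝ (Fin n)) :
    gauss n s z ≤ doublingConst n ^ 2 * gauss n t z := by
  have ht : 0 < t := hs.trans_le h1
  have h3 : (4 * Real.pi * s) ^ (-(n : ℝ) / 2) ≤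
      doublingConst n ^ 2 * (4 * Real.pi * t) ^ (-(n : ℝ) / 2) := by
    have : doublingConst n ^ 2 = (1 / 4 : ℝ) ^ (-(n : ℝ) / 2) := by
      unfold doublingConst
      rw [← Real.rpow_mul_natCast two_pos.le, show (1 / 4 : ℝ) = 2 ^ (-2 : ℝ) by
        rw [Real.rpow_neg two_pos.le]; norm_num, ← Real.rpow_mul two_pos.le]
      congr 1
      push_cast; ring
    rw [this, ← Real.mul_rpow (by norm_num) (by positivity)]
    refine Real.rpow_le_rpow_of_nonpos (by positivity) ?_ ?_
    · nlinarith [Real.pi_pos]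
    · have : (0 : ℝ) ≤ n := by positivity
      linarith
  unfold gauss
  rw [← mul_assoc]
  gcongr ?_ * Real.exp ?_
  rw [neg_div, neg_div, neg_le_neg_iff]
  gcongr

lemma gauss_le {t : ℝ} (ht : 0 < t) (z : EuclideanSpace ℝ (Fin n)) :
    gauss n t z ≤ t ^ (-(n : ℝ) / 2) := by
  have hn : -(n : ℝ) / 2 ≤ 0 := by
    have : (0 : ℝ) ≤ n := by positivity
    linarith
  unfold gauss
  have h1 : Real.exp (-‖z‖ ^ 2 / (4 * t)) ≤ 1 := Real.exp_le_one_iff.2 (by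
    rw [neg_div, neg_nonpos]; positivity)
  have h2 : (4 * Real.pi * t) ^ (-(n : ℝ) / 2) ≤ t ^ (-(n : ℝ) / 2) :=
    Real.rpow_le_rpow_of_nonpos ht (by nlinarith [Real.pi_gt_three]) hn
  calc _ ≤ t ^ (-(n : ℝ) / 2) * 1 := by gcongr
    _ = _ := mul_one _

lemma mul_exp_neg_le_one (r : ℝ) : r * Real.exp (-r) ≤ 1 := by
  have h := Real.add_one_le_exp r
  rw [Real.exp_neg, ← div_eq_mul_inv, div_le_one (Real.exp_pos r)]
  linarith

lemma norm_sq_mul_gauss_le {t : ℝ} (ht : 0 < t) (z : EuclideanSpace ℝ (Fin n)) :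
    ‖z‖ ^ 2 * gauss n t z ≤ 8 * doublingConst n * t * gauss n (2 * t) z := by
  rw [gauss_eq ht]
  have h1 := mul_exp_neg_le_one (‖z‖ ^ 2 / (8 * t))
  have h2 : ‖z‖ ^ 2 = 8 * t * (‖z‖ ^ 2 / (8 * t)) := by field_simp
  have h3 := gauss_nonneg (show 0 < 2 * t by positivity) z
  have h4 := doublingConst_pos n
  change _ * (doublingConst n * _ * _) ≤ _
  calc _ = 8 * doublingConst n * t * gauss n (2 * t) z *
        (‖z‖ ^ 2 / (8 * t) * Real.exp (-(‖z‖ ^ 2 / (8 * t)))) := by field_simp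
    _ ≤ 8 * doublingConst n * t * gauss n (2 * t) z * 1 := by gcongr
    _ = _ := mul_one _

lemma gauss_le_gauss_two_mul {t : ℝ} (ht : 0 < t) (z : EuclideanSpace ℝ (Fin n)) :
    gauss n t z ≤ doublingConst n * gauss n (2 * t) z := by
  rw [gauss_eq ht]
  have h3 := gauss_nonneg (show 0 < 2 * t by positivity) z
  have h4 := doublingConst_pos n
  refine mul_le_of_le_one_right (by positivity) (Real.exp_le_one_iff.2 ?_)
  rw [neg_nonpos]; positivity

lemma norm_mul_gauss_le {t : ℝ} (ht : 0 < t) (z : EuclideanSpace ℝ (Fin n)) :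
    ‖z‖ * gauss n t z ≤ 9 * doublingConst n * √t * gauss n (2 * t) z := by
  have h1 := norm_sq_mul_gauss_le ht z
  have h2 := gauss_le_gauss_two_mul ht z
  have h3 : 0 < √t := Real.sqrt_pos.2 ht
  have h4 : √t * √t = t := Real.mul_self_sqrt ht.le
  have h5 := gauss_nonneg ht z
  have h6 : ‖z‖ * √t ≤ ‖z‖ ^ 2 + t := by nlinarith [sq_nonneg (‖z‖ - √t), norm_nonneg z]
  have h7 : (‖z‖ * √t) * gauss n t z ≤ (‖z‖ ^ 2 + t) * gauss n t z := by gcongr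
  have h8 : t * gauss n t z ≤ t * (doublingConst n * gauss n (2 * t) z) := by gcongr
  refine le_of_mul_le_mul_right ?_ h3
  calc _ = (‖z‖ * √t) * gauss n t z := by ring
    _ ≤ 9 * doublingConst n * t * gauss n (2 * t) z := by linarith
    _ = 9 * doublingConst n * (√t * √t) * gauss n (2 * t) z := by rw [h4]
    _ = _ := by ring

/-- A constant for the bounds of the time derivative of the heat kernel. -/
noncomputable def derivConst (n : ℕ) : ℝ := (n + 2) * doublingConst n

lemma derivConst_pos (n : ℕ) : 0 < derivConst n := by
  have := doublingConst_pos n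
  unfold derivConst; positivity

lemma abs_gaussDeriv_le {t : ℝ} (ht : 0 < t) (z : EuclideanSpace ℝ (Fin n)) :
    |gaussDeriv n t z| ≤ derivConst n * t⁻¹ * gauss n (2 * t) z := by
  have h1 := norm_sq_mul_gauss_le ht z
  have h2 := gauss_le_gauss_two_mul ht z
  have h5 := gauss_nonneg ht z
  have h6 := gauss_nonneg (show 0 < 2 * t by positivity) z
  have h7 : |‖z‖ ^ 2 / (4 * t ^ 2) - n / (2 * t)| ≤ ‖z‖ ^ 2 / (4 * t ^ 2) + n / (2 * t) := by
    have a1 : 0 ≤ ‖z‖ ^ 2 / (4 * t ^ 2) := by positivity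
    have a2 : 0 ≤ n / (2 * t) := by positivity
    rw [abs_le]; constructor <;> linarith
  have h8 := doublingConst_pos n
  unfold gaussDeriv derivConst
  rw [abs_mul, abs_of_nonneg h5]
  calc _ ≤ (‖z‖ ^ 2 / (4 * t ^ 2) + n / (2 * t)) * gauss n t z := by gcongr
    _ = ‖z‖ ^ 2 * gauss n t z / (4 * t ^ 2) + n / (2 * t) * gauss n t z := by ring
    _ ≤ 8 * doublingConst n * t * gauss n (2 * t) z / (4 * t ^ 2) +
        n / (2 * t) * (doublingConst n * gauss n (2 * t) z) := by gcongr
    _ = (n / 2 + 2) * doublingConst n * t⁻¹ * gauss n (2 * t) z := by field_simp; ring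
    _ ≤ _ := by
      gcongr
      have : (0 : ℝ) ≤ n := by positivity
      linarith

lemma norm_mul_abs_gaussDeriv_le {t : ℝ} (ht : 0 < t) (z : EuclideanSpace ℝ (Fin n)) :
    ‖z‖ * |gaussDeriv n t z| ≤
      (derivConst n * (9 * doublingConst n) * 2) * (√t)⁻¹ * gauss n (4 * t) z := by
  have h1 := abs_gaussDeriv_le ht z
  have h2 := norm_mul_gauss_le (show 0 < 2 * t by positivity) z
  have h3 := derivConst_pos n
  have h4 := doublingConst_pos n
  have h5 : √(2 * t) ≤ 2 * √t := by
    rw [Real.sqrt_le_left (by positivity), mul_pow, Real.sq_sqrt ht.le]; linarith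
  have h6 := gauss_nonneg (show 0 < 4 * t by positivity) z
  rw [show 2 * (2 * t) = 4 * t by ring] at h2
  have h7 : t⁻¹ = (√t)⁻¹ * (√t)⁻¹ := by rw [← mul_inv, Real.mul_self_sqrt ht.le]
  have h8 : 0 < √t := Real.sqrt_pos.2 ht
  calc _ ≤ ‖z‖ * (derivConst n * t⁻¹ * gauss n (2 * t) z) := by gcongr
    _ = derivConst n * t⁻¹ * (‖z‖ * gauss n (2 * t) z) := by ring
    _ ≤ derivConst n * t⁻¹ * (9 * doublingConst n * √(2 * t) * gauss n (4 * t) z) := by gcongr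
    _ ≤ derivConst n * t⁻¹ * (9 * doublingConst n * (2 * √t) * gauss n (4 * t) z) := by gcongr
    _ = _ := by rw [h7]; field_simp

lemma norm_sq_mul_abs_gaussDeriv_le {t : ℝ} (ht : 0 < t) (z : EuclideanSpace ℝ (Fin n)) :
    ‖z‖ ^ 2 * |gaussDeriv n t z| ≤
      (derivConst n * (8 * doublingConst n) * 2) * gauss n (4 * t) z := by
  have h1 := abs_gaussDeriv_le ht z
  have h2 := norm_sq_mul_gauss_le (show 0 < 2 * t by positivity) z
  have h3 := derivConst_pos n
  have h4 := doublingConst_pos n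
  rw [show 2 * (2 * t) = 4 * t by ring] at h2
  calc _ ≤ ‖z‖ ^ 2 * (derivConst n * t⁻¹ * gauss n (2 * t) z) := by gcongr
    _ = derivConst n * t⁻¹ * (‖z‖ ^ 2 * gauss n (2 * t) z) := by ring
    _ ≤ derivConst n * t⁻¹ * (8 * doublingConst n * (2 * t) * gauss n (4 * t) z) := by gcongr
    _ = _ := by field_simp

lemma abs_gaussDeriv_le_rpow {t : ℝ} (ht : 0 < t) (z : EuclideanSpace ℝ (Fin n)) :
    |gaussDeriv n t z| ≤ derivConst n * t ^ (-1 - (n : ℝ) / 2) := by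
  have h1 := abs_gaussDeriv_le ht z
  have h2 := gauss_le (show 0 < 2 * t by positivity) z
  have h3 := derivConst_pos n
  have h4 : (2 * t) ^ (-(n : ℝ) / 2) ≤ t ^ (-(n : ℝ) / 2) :=
    Real.rpow_le_rpow_of_nonpos ht (by linarith) (by
      have : (0 : ℝ) ≤ n := by positivity
      linarith)
  calc _ ≤ derivConst n * t⁻¹ * t ^ (-(n : ℝ) / 2) := h1.trans (by gcongr; exact h2.trans h4)
    _ = _ := by
      rw [mul_assoc, ← Real.rpow_neg_one, ← Real.rpow_add ht]
      congr 2; ring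

lemma integrable_gaussDeriv {t : ℝ} (ht : 0 < t) : Integrable (gaussDeriv n t) := by
  refine ((integrable_gauss (show 0 < 2 * t by positivity)).const_mul (derivConst n * t⁻¹)).mono'
    (measurable_gaussDeriv.comp measurable_prodMk_left).aestronglyMeasurable
    (Eventually.of_forall fun z => abs_gaussDeriv_le ht z)

/-- Away from the diagonal the derivative of the heat kernel is bounded for small times. -/
lemma exists_inv_mul_gauss_le (n : ℕ) {ε : ℝ} (hε : 0 < ε) :
    ∃ C, 0 ≤ C ∧ ∀ t, 0 < t → t ≤ 1 → ∀ z : EuclideanSpace ℝ (Fin n), ε ≤ ‖z‖ →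
      t⁻¹ * gauss n (2 * t) z ≤ C := by
  refine ⟨(n + 1).factorial / (ε ^ 2 / 8) ^ (n + 1), by positivity, fun t ht ht1 z hz => ?_⟩
  set b := ε ^ 2 / 8 with hb
  have hb0 : 0 < b := by positivity
  have h1 : (b / t) ^ (n + 1) / (n + 1).factorial ≤ Real.exp (b / t) :=
    Real.pow_div_factorial_le_exp _ (by positivity) _
  have h2 : Real.exp (-‖z‖ ^ 2 / (4 * (2 * t))) ≤ Real.exp (-(b / t)) := by
    rw [Real.exp_le_exp, neg_div, neg_le_neg_iff, hb, div_div,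
      show 4 * (2 * t) = 8 * t by ring]
    gcongr
  have h3 : (4 * Real.pi * (2 * t)) ^ (-(n : ℝ) / 2) ≤ (t ^ n)⁻¹ := by
    calc _ ≤ t ^ (-(n : ℝ) / 2) := Real.rpow_le_rpow_of_nonpos ht
          (by nlinarith [Real.pi_gt_three]) (by
            have : (0 : ℝ) ≤ n := by positivity
            linarith)
      _ ≤ t ^ (-(n : ℝ)) := Real.rpow_le_rpow_of_exponent_ge ht ht1 (by
            have : (0 : ℝ) ≤ n := by positivity
            linarith)
      _ = _ := by rw [Real.rpow_neg ht.le, Real.rpow_natCast]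
  have h4 : Real.exp (-(b / t)) ≤ (n + 1).factorial / (b / t) ^ (n + 1) := by
    rw [Real.exp_neg, ← inv_div ((b / t) ^ (n + 1))]
    exact inv_anti₀ (by positivity) h1
  unfold gauss
  calc _ ≤ t⁻¹ * ((t ^ n)⁻¹ * ((n + 1).factorial / (b / t) ^ (n + 1))) := by
        gcongr
        exact h2.trans h4
    _ = _ := by
        rw [div_pow, pow_succ t n]
        field_simp

lemma hasDerivAt_setIntegral_gauss {t : ℝ} (ht : 0 < t) (s : Set (EuclideanSpace ℝ (Fin n))) :
    HasDerivAt (fun t => ∫ z in s, gauss n t z) (∫ z in s, gaussDeriv n t z) t := by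
  refine (hasDerivAt_integral_of_dominated_loc_of_deriv_le (s := Ioo (t / 2) (2 * t))
    (F := fun t z => gauss n t z) (F' := fun t z => gaussDeriv n t z)
    (bound := fun z => derivConst n * (2 / t) * (doublingConst n ^ 2 * gauss n (4 * t) z))
    (Ioo_mem_nhds (by linarith) (by linarith)) ?_ (integrable_gauss ht).integrableOn ?_ ?_ ?_ ?_).2
  · exact Eventually.of_forall fun t =>
      (measurable_gauss.comp measurable_prodMk_left).aestronglyMeasurable
  · exact (measurable_gaussDeriv.comp measurable_prodMk_left).aestronglyMeasurable
  · refine Eventually.of_forall fun z r hr => ?_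
    have hr0 : 0 < r := by linarith [hr.1]
    refine (abs_gaussDeriv_le hr0 z).trans ?_
    have h3 := derivConst_pos n
    have h4 := gauss_nonneg (show 0 < 2 * r by positivity) z
    gcongr ?_ * ?_ * ?_
    · rw [← inv_div]
      exact inv_anti₀ (by positivity) hr.1.le
    · exact gauss_le_gauss (by positivity) (by linarith [hr.2]) (by linarith [hr.1]) z
  · exact (((integrable_gauss (by positivity)).const_mul _).const_mul _).integrableOn
  · exact Eventually.of_forall fun z r hr => hasDerivAt_gauss (by linarith [hr.1]) z

lemma integral_gaussDeriv {t : ℝ} (ht : 0 < t) : ∫ z, gaussDeriv n t z = 0 := by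
  have h1 := hasDerivAt_setIntegral_gauss ht (univ : Set (EuclideanSpace ℝ (Fin n)))
  simp only [Measure.restrict_univ] at h1
  have h2 : HasDerivAt (fun t => ∫ z, gauss n t z) 0 t :=
    (hasDerivAt_const t (1 : ℝ)).congr_of_eventuallyEq (by
      filter_upwards [eventually_gt_nhds ht] with s hs using integral_gauss hs)
  exact h1.unique h2

/-- The time derivative of the mass that the heat kernel has in the ball of radius `ε`. -/
noncomputable def ballMassDeriv (n : ℕ) (ε t : ℝ) : ℝ :=
  ∫ z in Metric.closedBall (0 : EuclideanSpace ℝ (Fin n)) ε, gaussDeriv n t z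

@[fun_prop]
lemma measurable_ballMassDeriv (n : ℕ) (ε : ℝ) : Measurable (ballMassDeriv n ε) :=
  (measurable_gaussDeriv.stronglyMeasurable.integral_prod_right').measurable

lemma gaussDeriv_smul {ε : ℝ} (hε : 0 < ε) {t : ℝ} (ht : 0 < t)
    (z : EuclideanSpace ℝ (Fin n)) :
    gaussDeriv n t (ε • z) = (ε ^ n)⁻¹ * (ε ^ 2)⁻¹ * gaussDeriv n (t / ε ^ 2) z := by
  have h : (4 * Real.pi * t) ^ (-(n : ℝ) / 2) =
      (ε ^ n)⁻¹ * (4 * Real.pi * (t / ε ^ 2)) ^ (-(n : ℝ) / 2) := by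
    have h1 : 4 * Real.pi * t = ε ^ (2 : ℝ) * (4 * Real.pi * (t / ε ^ 2)) := by
      rw [Real.rpow_two]; field_simp
    rw [h1, Real.mul_rpow (by positivity) (by positivity), ← Real.rpow_mul hε.le,
      show 2 * (-(n : ℝ) / 2) = -n by ring, Real.rpow_neg hε.le, Real.rpow_natCast]
  unfold gaussDeriv gauss
  rw [norm_smul, Real.norm_of_nonneg hε.le, h]
  have : -(ε * ‖z‖) ^ 2 / (4 * t) = -‖z‖ ^ 2 / (4 * (t / ε ^ 2)) := by field_simp
  rw [this]
  field_simp

/-- Parabolic scaling. -/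
lemma ballMassDeriv_eq {ε : ℝ} (hε : 0 < ε) {t : ℝ} (ht : 0 < t) :
    ballMassDeriv n ε t = (ε ^ 2)⁻¹ * ballMassDeriv n 1 (t / ε ^ 2) := by
  unfold ballMassDeriv
  have h := Measure.setIntegral_comp_smul_of_pos (volume : Measure (EuclideanSpace ℝ (Fin n)))
    (gaussDeriv n t) (Metric.closedBall 0 1) hε
  rw [smul_unitClosedBall_of_nonneg hε.le, finrank_euclideanSpace_fin] at h
  simp only [gaussDeriv_smul hε ht] at h
  rw [integral_const_mul, smul_eq_mul] at h
  have h2 : (ε ^ n) ≠ 0 := by positivity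
  rw [mul_assoc] at h
  exact (mul_left_cancel₀ (inv_ne_zero h2) h).symm

lemma exists_abs_ballMassDeriv_le (n : ℕ) : ∃ C, 0 ≤ C ∧
    (∀ t, 0 < t → t ≤ 1 → |ballMassDeriv n 1 t| ≤ C) ∧
    ∀ t, 1 ≤ t → |ballMassDeriv n 1 t| ≤ C * t ^ (-1 - (n : ℝ) / 2) := by
  have hC := derivConst_pos n
  have hD := doublingConst_pos n
  set S := Metric.closedBall (0 : EuclideanSpace ℝ (Fin n)) 1 with hS
  have hSm : MeasurableSet S := Metric.isClosed_closedBall.measurableSet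
  refine ⟨max (derivConst n * (8 * doublingConst n) * 2) (derivConst n * volume.real S),
    le_max_of_le_left (by positivity), fun t ht ht1 => ?_, fun t ht => ?_⟩
  · -- the total derivative is zero, and on the complement of the ball `1 ≤ |z|²`
    have h1 : ballMassDeriv n 1 t = -∫ z in Sᶜ, gaussDeriv n t z := by
      have := integral_add_compl hSm (integrable_gaussDeriv (n := n) ht)
      rw [integral_gaussDeriv ht] at this
      unfold ballMassDeriv
      linarith
    rw [h1, abs_neg]
    refine le_trans ?_ (le_max_left _ _)
    have h2 : |∫ z in Sᶜ, gaussDeriv n t z| ≤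
        ∫ z in Sᶜ, (derivConst n * (8 * doublingConst n) * 2) * gauss n (4 * t) z := by
      rw [← Real.norm_eq_abs]
      refine norm_integral_le_of_norm_le
        ((integrable_gauss (by positivity)).const_mul _).integrableOn ?_
      filter_upwards [ae_restrict_mem hSm.compl] with z hz
      have hz : 1 < ‖z‖ := by simpa [hS] using hz
      refine le_trans ?_ (norm_sq_mul_abs_gaussDeriv_le ht z)
      rw [Real.norm_eq_abs]
      exact le_mul_of_one_le_left (abs_nonneg _) (by nlinarith)
    refine h2.trans ((setIntegral_le_integral
      ((integrable_gauss (by positivity)).const_mul _) (Eventually.of_forall fun z =>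
        mul_nonneg (by positivity) (gauss_nonneg (by positivity) z))).trans ?_)
    rw [integral_const_mul, integral_gauss (by positivity), mul_one]
  · have ht0 : 0 < t := by linarith
    have h1 := norm_setIntegral_le_of_norm_le_const (s := S) (f := gaussDeriv n t)
      (μ := volume) (isCompact_closedBall (0 : EuclideanSpace ℝ (Fin n)) 1).measure_lt_top
      fun z _ => abs_gaussDeriv_le_rpow ht0 z
    refine h1.trans ?_
    rw [mul_right_comm]
    gcongr
    exact le_max_right _ _

lemma integrableOn_of_abs_le_rpow {g : ℝ → ℝ} (hg : AEStronglyMeasurable g (volume.restrict (Ioi 0)))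
    {C κ : ℝ} (hκ : 0 < κ) (h0 : ∀ t, 0 < t → t ≤ 1 → |g t| ≤ C * t ^ (-(1 : ℝ) / 2))
    (h1 : ∀ t, 1 ≤ t → |g t| ≤ C * t ^ (-1 - κ)) : IntegrableOn g (Ioi 0) := by
  rw [← Ioc_union_Ioi_eq_Ioi zero_le_one, integrableOn_union]
  constructor
  · have h := (intervalIntegral.intervalIntegrable_rpow' (a := 0) (b := 1) (r := -(1 : ℝ) / 2)
      (by norm_num)).1.const_mul C
    refine Integrable.mono' h (hg.mono_set Ioc_subset_Ioi_self) ?_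
    filter_upwards [ae_restrict_mem measurableSet_Ioc] with t ht using h0 t ht.1 ht.2
  · have h := (integrableOn_Ioi_rpow_of_lt (a := -1 - κ) (by linarith) zero_lt_one).const_mul C
    refine Integrable.mono' h (hg.mono_set (Ioi_subset_Ioi zero_le_one)) ?_
    filter_upwards [ae_restrict_mem measurableSet_Ioi] with t ht using h1 t (le_of_lt ht)

lemma integrableOn_ballMassDeriv (hn : 1 ≤ n) : IntegrableOn (ballMassDeriv n 1) (Ioi 0) := by
  obtain ⟨C, hC0, h0, h1⟩ := exists_abs_ballMassDeriv_le n
  have hn' : (1 : ℝ) ≤ n := by exact_mod_cast hn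
  refine integrableOn_of_abs_le_rpow (measurable_ballMassDeriv n 1).aestronglyMeasurable
    (C := C) (κ := n / 2) (by positivity) (fun t ht ht1 => (h0 t ht ht1).trans ?_) h1
  refine le_mul_of_one_le_right hC0 ?_
  exact Real.one_le_rpow_of_pos_of_le_one_of_nonpos ht ht1 (by norm_num)

/-- The mass in the unit ball decreases from `1` to `0`. -/
lemma integral_ballMassDeriv (hn : 1 ≤ n) : ∫ t in Ioi (0 : ℝ), ballMassDeriv n 1 t = -1 := by
  set S := Metric.closedBall (0 : EuclideanSpace ℝ (Fin n)) 1 with hS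
  have hSm : MeasurableSet S := Metric.isClosed_closedBall.measurableSet
  -- the mass in the ball, with its limit `1` as the value at `t = 0`
  set Θ : ℝ → ℝ := fun t => if t ≤ 0 then 1 else ∫ z in S, gauss n t z with hΘ
  have hΘd : ∀ t ∈ Ioi (0 : ℝ), HasDerivAt Θ (ballMassDeriv n 1 t) t := by
    intro t ht
    refine (hasDerivAt_setIntegral_gauss ht S).congr_of_eventuallyEq ?_
    filter_upwards [eventually_gt_nhds (show 0 < t from ht)] with s hs
    simp [hΘ, hs.not_ge]
  have hD := doublingConst_pos n
  have hcont : ContinuousWithinAt Θ (Ici 0) 0 := by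
    have h1 : ∀ t, 0 ≤ t → |Θ t - 1| ≤ 8 * doublingConst n * t := by
      intro t ht
      rcases ht.eq_or_lt with rfl | ht
      · simp [hΘ]
      have h2 : Θ t - 1 = -∫ z in Sᶜ, gauss n t z := by
        have := integral_add_compl hSm (integrable_gauss (n := n) ht)
        rw [integral_gauss ht] at this
        simp only [hΘ, ht.not_ge, if_false]
        linarith
      rw [h2, abs_neg]
      have h3 : |∫ z in Sᶜ, gauss n t z| ≤
          ∫ z in Sᶜ, (8 * doublingConst n * t) * gauss n (2 * t) z := by
        rw [← Real.norm_eq_abs]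
        refine norm_integral_le_of_norm_le
          ((integrable_gauss (by positivity)).const_mul _).integrableOn ?_
        filter_upwards [ae_restrict_mem hSm.compl] with z hz
        have hz : 1 < ‖z‖ := by simpa [hS] using hz
        refine le_trans ?_ (norm_sq_mul_gauss_le ht z)
        rw [Real.norm_of_nonneg (gauss_nonneg ht z)]
        exact le_mul_of_one_le_left (gauss_nonneg ht z) (by nlinarith)
      refine h3.trans ((setIntegral_le_integral
        ((integrable_gauss (by positivity)).const_mul _) (Eventually.of_forall fun z =>
          mul_nonneg (by positivity) (gauss_nonneg (by positivity) z))).trans ?_)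
      rw [integral_const_mul, integral_gauss (by positivity), mul_one]
    have h0 : Θ 0 = 1 := by simp [hΘ]
    rw [ContinuousWithinAt, h0, tendsto_iff_norm_sub_tendsto_zero]
    refine squeeze_zero' (Eventually.of_forall fun _ => norm_nonneg _)
      (g := fun t => 8 * doublingConst n * t) ?_ ?_
    · filter_upwards [self_mem_nhdsWithin] with t ht using h1 t ht
    · have : Tendsto (fun t : ℝ => 8 * doublingConst n * t) (𝓝 0)
          (𝓝 (8 * doublingConst n * 0)) := tendsto_id.const_mul _
      rw [mul_zero] at this
      exact this.mono_left nhdsWithin_le_nhds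
  have hlim : Tendsto Θ atTop (𝓝 0) := by
    have hn' : (1 : ℝ) ≤ n := by exact_mod_cast hn
    have h1 : Tendsto (fun t : ℝ => t ^ (-((n : ℝ) / 2)) * volume.real S) atTop
        (𝓝 (0 * volume.real S)) :=
      (tendsto_rpow_neg_atTop (by positivity)).mul_const _
    rw [zero_mul] at h1
    refine squeeze_zero_norm' ?_ h1
    filter_upwards [eventually_gt_atTop 0] with t ht
    simp only [hΘ, ht.not_ge, if_false]
    refine norm_setIntegral_le_of_norm_le_const (isCompact_closedBall (0 : EuclideanSpace ℝ (Fin n)) 1).measure_lt_top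
      fun z _ => ?_
    rw [Real.norm_of_nonneg (gauss_nonneg ht z), ← neg_div]
    exact gauss_le ht z
  have := integral_Ioi_of_hasDerivAt_of_tendsto hcont hΘd (integrableOn_ballMassDeriv hn) hlim
  rw [this]
  simp [hΘ]

/-! ### The heat kernel of the Bessel operator -/

lemma besselI_eq {ν z : ℝ} (hz : 0 < z) :
    besselI ν z = (z / 2) ^ ν * besselSeries (ν + 1) ((z / 2) ^ 2) := by
  unfold besselI besselSeries
  rw [← tsum_mul_left]
  refine tsum_congr fun k => ?_
  rw [Real.rpow_add (by positivity), ← pow_mul, ← add_assoc,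
    show (2 * (k : ℝ)) = ((2 * k : ℕ) : ℝ) by push_cast; ring, Real.rpow_natCast]
  ring

lemma besselJ_eq {ν z : ℝ} (hz : 0 < z) :
    besselJ ν z = (z / 2) ^ ν * besselSeries (ν + 1) (-(z / 2) ^ 2) := by
  unfold besselJ besselSeries
  rw [← tsum_mul_left]
  refine tsum_congr fun k => ?_
  rw [Real.rpow_add (by positivity), ← add_assoc, neg_pow ((z / 2) ^ 2), ← pow_mul,
    show (2 * (k : ℝ)) = ((2 * k : ℕ) : ℝ) by push_cast; ring, Real.rpow_natCast]
  ring

lemma heatKernel_eq {lam t u v : ℝ} (ht : 0 < t) (hu : 0 < u) (hv : 0 < v) :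
    heatKernel lam t u v = 2 * (4 * t) ^ (-(lam + 1 / 2)) *
      besselSeries (lam + 1 / 2) ((u * v / (4 * t)) ^ 2) * Real.exp (-(u ^ 2 + v ^ 2) / (4 * t)) := by
  unfold heatKernel
  rw [besselI_eq (by positivity), show u * v / (2 * t) / 2 = u * v / (4 * t) by field_simp; ring,
    show lam - 1 / 2 + 1 = lam + 1 / 2 by ring, Real.div_rpow (by positivity) (by positivity),
    show -lam + 1 / 2 = -(lam - 1 / 2) by ring, Real.rpow_neg (by positivity),
    show -(lam + 1 / 2) = -(lam - 1 / 2) - 1 by ring, Real.rpow_sub_one (by positivity),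
    Real.rpow_neg (by positivity)]
  have h1 : 0 < (u * v) ^ (lam - 1 / 2) := by positivity
  field_simp
  ring

lemma rpow_mul_heatKernel {lam t u v : ℝ} (ht : 0 < t) (hu : 0 < u) (hv : 0 < v) :
    v ^ (2 * lam) * heatKernel lam t u v =
      (v / u) ^ lam * ((4 * Real.pi * t) ^ (-(1 : ℝ) / 2) * Real.exp (-(v - u) ^ 2 / (4 * t))) *
        profile lam (u * v / (4 * t)) := by
  rw [heatKernel_eq ht hu hv]
  unfold profile
  have h1 : -(u ^ 2 + v ^ 2) / (4 * t) = -(v - u) ^ 2 / (4 * t) + -2 * (u * v / (4 * t)) := by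
    field_simp; ring
  have h2 : (4 * Real.pi * t) ^ (-(1 : ℝ) / 2) = (√Real.pi)⁻¹ * (4 * t) ^ (-(1 : ℝ) / 2) := by
    rw [show 4 * Real.pi * t = Real.pi * (4 * t) by ring, Real.mul_rpow Real.pi_pos.le (by positivity),
      Real.sqrt_eq_rpow, ← Real.rpow_neg Real.pi_pos.le, neg_div]
  rw [h1, h2, Real.exp_add, two_mul, Real.rpow_add hv, Real.div_rpow hv.le hu.le,
    Real.div_rpow (by positivity) (by positivity), Real.mul_rpow hu.le hv.le,
    show -(lam + 1 / 2) = -lam + -1 / 2 by ring, Real.rpow_add (by positivity),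
    Real.rpow_neg (by positivity)]
  have h3 : 0 < u ^ lam := by positivity
  have h4 : 0 < √Real.pi := by positivity
  field_simp

/-- The factor `∏ⱼ (yⱼ/xⱼ)^λⱼ`. -/
noncomputable def ratio (lam : Fin n → ℝ) (x y : EuclideanSpace ℝ (Fin n)) : ℝ :=
  ∏ j, (y j / x j) ^ lam j

/-- The factor `∏ⱼ E_{λⱼ}(xⱼyⱼ/(4t))` by which the heat kernel differs from the Euclidean one. -/
noncomputable def profileProd (lam : Fin n → ℝ) (x y : EuclideanSpace ℝ (Fin n)) (t : ℝ) : ℝ :=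
  ∏ j, profile (lam j) (x j * y j / 4 / t)

/-- The time derivative of `profileProd`. -/
noncomputable def profileProdDeriv (lam : Fin n → ℝ) (x y : EuclideanSpace ℝ (Fin n)) (t : ℝ) : ℝ :=
  ∑ i, (∏ j ∈ Finset.univ.erase i, profile (lam j) (x j * y j / 4 / t)) *
    (profileDeriv (lam i) (x i * y i / 4 / t) * (-(x i * y i / 4) / t ^ 2))

/-- The product of the Euclidean heat kernel with `profileProd`. Multiplied by `ratio` it is the
heat kernel of the Bessel operator times the density of the measure. -/
noncomputable def heatDensity (lam : Fin n → ℝ) (x y : EuclideanSpace ℝ (Fin n)) (t : ℝ) : ℝ :=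
  gauss n t (y - x) * profileProd lam x y t

/-- The time derivative of `heatDensity`. -/
noncomputable def heatDensityDeriv (lam : Fin n → ℝ) (x y : EuclideanSpace ℝ (Fin n)) (t : ℝ) : ℝ :=
  gaussDeriv n t (y - x) * profileProd lam x y t + gauss n t (y - x) * profileProdDeriv lam x y t

lemma hasDerivAt_profile_div {lam p : ℝ} (hlam : -1 / 2 < lam) (hp : 0 < p) {t : ℝ} (ht : 0 < t) :
    HasDerivAt (fun t => profile lam (p / t)) (profileDeriv lam (p / t) * (-p / t ^ 2)) t := by
  have h1 : HasDerivAt (fun t : ℝ => p / t) (-p / t ^ 2) t := by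
    have := (hasDerivAt_inv ht.ne').const_mul p
    convert! this using 1
    field_simp
  exact (hasDerivAt_profile hlam (by positivity)).comp t h1

lemma hasDerivAt_profileProd {lam : Fin n → ℝ} (hlam : ∀ j, -1 / 2 < lam j)
    {x y : EuclideanSpace ℝ (Fin n)} (hx : x ∈ orthant n) (hy : y ∈ orthant n) {t : ℝ} (ht : 0 < t) :
    HasDerivAt (profileProd lam x y) (profileProdDeriv lam x y t) t := by
  have := HasDerivAt.fun_finsetProd (u := Finset.univ)
    (f := fun j t => profile (lam j) (x j * y j / 4 / t))
    (f' := fun j => profileDeriv (lam j) (x j * y j / 4 / t) * (-(x j * y j / 4) / t ^ 2))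
    fun j _ => hasDerivAt_profile_div (hlam j)
      (by have := hx j; have := hy j; positivity) ht
  simp only [smul_eq_mul] at this
  exact this

lemma hasDerivAt_heatDensity {lam : Fin n → ℝ} (hlam : ∀ j, -1 / 2 < lam j)
    {x y : EuclideanSpace ℝ (Fin n)} (hx : x ∈ orthant n) (hy : y ∈ orthant n) {t : ℝ} (ht : 0 < t) :
    HasDerivAt (heatDensity lam x y) (heatDensityDeriv lam x y t) t :=
  (hasDerivAt_gauss ht (y - x)).mul (hasDerivAt_profileProd hlam hx hy ht)

lemma weight_mul_prod_heatKernel (lam : Fin n → ℝ)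
    {x y : EuclideanSpace ℝ (Fin n)} (hx : x ∈ orthant n) (hy : y ∈ orthant n) {t : ℝ} (ht : 0 < t) :
    weight lam y * ∏ j, heatKernel (lam j) t (x j) (y j) = ratio lam x y * heatDensity lam x y t := by
  have hg : gauss n t (y - x) = ∏ j, ((4 * Real.pi * t) ^ (-(1 : ℝ) / 2) *
      Real.exp (-(y j - x j) ^ 2 / (4 * t))) := by
    unfold gauss
    rw [Finset.prod_mul_distrib, Finset.prod_const, Finset.card_univ, Fintype.card_fin,
      ← Real.exp_sum, ← Real.rpow_mul_natCast (by positivity), EuclideanSpace.norm_sq_eq]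
    congr 2
    · ring
    · rw [← Finset.sum_div, Finset.sum_neg_distrib]
      simp
  unfold weight heatDensity ratio profileProd
  rw [hg, ← Finset.prod_mul_distrib, ← Finset.prod_mul_distrib, ← Finset.prod_mul_distrib]
  refine Finset.prod_congr rfl fun j _ => ?_
  rw [rpow_mul_heatKernel ht (hx j) (hy j), div_div]
  ring

lemma weight_pos (lam : Fin n → ℝ) {y : EuclideanSpace ℝ (Fin n)} (hy : y ∈ orthant n) :
    0 < weight lam y :=
  Finset.prod_pos fun j _ => Real.rpow_pos_of_pos (hy j) _

lemma hasDerivAt_prod_heatKernel {lam : Fin n → ℝ} (hlam : ∀ j, -1 / 2 < lam j)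
    {x y : EuclideanSpace ℝ (Fin n)} (hx : x ∈ orthant n) (hy : y ∈ orthant n) {t : ℝ} (ht : 0 < t) :
    HasDerivAt (fun s => ∏ j, heatKernel (lam j) s (x j) (y j))
      ((weight lam y)⁻¹ * ratio lam x y * heatDensityDeriv lam x y t) t := by
  refine ((hasDerivAt_heatDensity hlam hx hy ht).const_mul
    ((weight lam y)⁻¹ * ratio lam x y)).congr_of_eventuallyEq ?_
  filter_upwards [eventually_gt_nhds ht] with s hs
  rw [mul_assoc, ← weight_mul_prod_heatKernel lam hx hy hs,
    inv_mul_cancel_left₀ (weight_pos lam hy).ne']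

lemma kernelIntegrand_eq {lam : Fin n → ℝ} (hlam : ∀ j, -1 / 2 < lam j) (φ : ℝ → ℂ)
    {x y : EuclideanSpace ℝ (Fin n)} (hx : x ∈ orthant n) (hy : y ∈ orthant n) {t : ℝ} (ht : 0 < t) :
    kernelIntegrand lam φ x y t =
      φ t * ((weight lam y)⁻¹ * ratio lam x y * heatDensityDeriv lam x y t : ℝ) := by
  unfold kernelIntegrand
  rw [(hasDerivAt_prod_heatKernel hlam hx hy ht).deriv]

lemma measurable_profileProd {lam : Fin n → ℝ} (hlam : ∀ j, -1 / 2 < lam j) :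
    Measurable fun p : EuclideanSpace ℝ (Fin n) × EuclideanSpace ℝ (Fin n) × ℝ =>
      profileProd lam p.1 p.2.1 p.2.2 := by
  unfold profileProd
  refine Finset.measurable_fun_prod _ fun j _ => (measurable_profile (hlam j)).comp ?_
  fun_prop

lemma measurable_profileProdDeriv {lam : Fin n → ℝ} (hlam : ∀ j, -1 / 2 < lam j) :
    Measurable fun p : EuclideanSpace ℝ (Fin n) × EuclideanSpace ℝ (Fin n) × ℝ =>
      profileProdDeriv lam p.1 p.2.1 p.2.2 := by
  unfold profileProdDeriv
  refine Finset.measurable_fun_sum _ fun i _ => Measurable.mul ?_ (Measurable.mul ?_ ?_)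
  · refine Finset.measurable_fun_prod _ fun j _ => (measurable_profile (hlam j)).comp ?_
    fun_prop
  · refine (measurable_profileDeriv (hlam i)).comp ?_
    fun_prop
  · fun_prop

lemma measurable_heatDensityDeriv {lam : Fin n → ℝ} (hlam : ∀ j, -1 / 2 < lam j) :
    Measurable fun p : EuclideanSpace ℝ (Fin n) × EuclideanSpace ℝ (Fin n) × ℝ =>
      heatDensityDeriv lam p.1 p.2.1 p.2.2 :=
  ((measurable_gaussDeriv.comp
    (f := fun p : EuclideanSpace ℝ (Fin n) × EuclideanSpace ℝ (Fin n) × ℝ =>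
    (p.2.2, p.2.1 - p.1)) (by fun_prop)).mul (measurable_profileProd hlam)).add
  ((measurable_gauss.comp (f := fun p : EuclideanSpace ℝ (Fin n) × EuclideanSpace ℝ (Fin n) × ℝ =>
    (p.2.2, p.2.1 - p.1)) (by fun_prop)).mul (measurable_profileProdDeriv hlam))

lemma measurable_ratio (lam : Fin n → ℝ) :
    Measurable fun p : EuclideanSpace ℝ (Fin n) × EuclideanSpace ℝ (Fin n) =>
      ratio lam p.1 p.2 := by
  unfold ratio; fun_prop

/-! ### Uniform bounds on compact sets -/

/-- The factors of `profileProd`, with `p = xⱼyⱼ/4`: for small times they are close to `1`, because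
the argument of the profile is large, and for large times they behave like `t^(-λ)`. -/
lemma exists_profile_div_bounds {lam : ℝ} (hlam : -1 / 2 < lam) {p₀ p₁ : ℝ} (hp₀ : 0 < p₀) :
    ∃ C, 0 ≤ C ∧ ∀ p ∈ Icc p₀ p₁,
      (∀ t, 0 < t → t ≤ 1 → |profile lam (p / t) - 1| ≤ C * t ∧
        |profileDeriv lam (p / t) * (-p / t ^ 2)| ≤ C) ∧
      (∀ t, 1 ≤ t → |profile lam (p / t)| ≤ C * t ^ (-lam) ∧
        |profileDeriv lam (p / t) * (-p / t ^ 2)| ≤ C * t ^ (-lam - 1)) := by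
  obtain ⟨C₁, hC₁0, hC₁⟩ := exists_profile_sub_one_le hlam hp₀
  obtain ⟨C₂, hC₂0, hC₂⟩ := exists_profile_le_of_le hlam p₁
  obtain ⟨M, hM⟩ := isCompact_Icc (a := p₀) (b := p₁) |>.exists_bound_of_continuousOn
    (f := fun p : ℝ => p ^ lam) fun p hp =>
      (Real.continuousAt_rpow_const _ _ (Or.inl (hp₀.trans_le hp.1).ne')).continuousWithinAt
  refine ⟨C₁ / p₀ + C₂ * |M|, by positivity, fun p hp => ⟨fun t ht ht1 => ?_, fun t ht => ?_⟩⟩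
  · have hp0 : 0 < p := hp₀.trans_le hp.1
    obtain ⟨h1, h2⟩ := hC₁ (p / t) (hp.1.trans (le_div_self hp0.le ht ht1))
    have h3 : C₁ / p ≤ C₁ / p₀ + C₂ * |M| := by
      have : C₁ / p ≤ C₁ / p₀ := by gcongr; exact hp.1
      have : 0 ≤ C₂ * |M| := by positivity
      linarith
    constructor
    · calc _ ≤ C₁ / (p / t) := h1
        _ = C₁ / p * t := by field_simp
        _ ≤ _ := by gcongr
    · rw [abs_mul, abs_div, abs_neg, abs_of_pos hp0, abs_of_pos (by positivity : 0 < t ^ 2)]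
      calc _ ≤ C₁ / (p / t) ^ 2 * (p / t ^ 2) := by gcongr
        _ = C₁ / p := by field_simp
        _ ≤ _ := h3
  · have hp0 : 0 < p := hp₀.trans_le hp.1
    have ht0 : 0 < t := by linarith
    obtain ⟨h1, h2⟩ := hC₂ (p / t) (by positivity) ((div_le_self hp0.le ht).trans hp.2)
    have h3 : C₂ * p ^ lam ≤ C₁ / p₀ + C₂ * |M| := by
      have a1 : p ^ lam ≤ |M| := (le_abs_self _).trans ((hM p hp).trans (le_abs_self M))
      have a2 : C₂ * p ^ lam ≤ C₂ * |M| := by gcongr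
      have : 0 ≤ C₁ / p₀ := by positivity
      linarith
    rw [Real.div_rpow hp0.le ht0.le] at h1 h2
    constructor
    · calc _ ≤ C₂ * (p ^ lam / t ^ lam) := h1
        _ = C₂ * p ^ lam * t ^ (-lam) := by rw [Real.rpow_neg ht0.le]; ring
        _ ≤ _ := by gcongr
    · rw [abs_mul, abs_div, abs_neg, abs_of_pos hp0, abs_of_pos (by positivity : 0 < t ^ 2)]
      calc _ ≤ C₂ * (p ^ (lam - 1) / t ^ (lam - 1)) * (p / t ^ 2) := by gcongr
        _ = C₂ * p ^ lam * t ^ (-lam - 1) := by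
          rw [Real.rpow_sub_one hp0.ne', Real.rpow_sub_one ht0.ne', Real.rpow_sub_one ht0.ne',
            Real.rpow_neg ht0.le]
          field_simp
        _ ≤ _ := by gcongr

lemma exists_prod_profile_bounds {lam : Fin n → ℝ} (hlam : ∀ j, -1 / 2 < lam j) (k : ℕ)
    (s : Finset (Fin n)) : ∃ C, 0 ≤ C ∧ ∀ x ∈ box n k, ∀ y ∈ box n k,
      (∀ t, 0 < t → t ≤ 1 → |∏ j ∈ s, profile (lam j) (x j * y j / 4 / t) - 1| ≤ C * t ∧
        |deriv (fun t => ∏ j ∈ s, profile (lam j) (x j * y j / 4 / t)) t| ≤ C) ∧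
      (∀ t, 1 ≤ t → |∏ j ∈ s, profile (lam j) (x j * y j / 4 / t)| ≤ C * t ^ (-∑ j ∈ s, lam j) ∧
        |deriv (fun t => ∏ j ∈ s, profile (lam j) (x j * y j / 4 / t)) t| ≤
          C * t ^ (-∑ j ∈ s, lam j - 1)) := by
  induction s using Finset.induction_on with
  | empty =>
    refine ⟨1, zero_le_one, fun x _ y _ => ⟨fun t ht ht1 => ?_, fun t ht => ?_⟩⟩
    · simp [ht.le]
    · have : 0 < t := by linarith
      simp
      positivity
  | insert i s hi ih =>
    obtain ⟨C, hC0, hC⟩ := ih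
    obtain ⟨K, hK0, hK⟩ := exists_profile_div_bounds (hlam i)
      (p₀ := 1 / ((k : ℝ) + 1) * (1 / ((k : ℝ) + 1)) / 4)
      (p₁ := ((k : ℝ) + 1) * ((k : ℝ) + 1) / 4) (by positivity)
    refine ⟨2 * (K * C + C + K), by positivity, fun x hx y hy => ?_⟩
    have hx0 : ∀ j, 0 < x j := box_subset n k hx
    have hy0 : ∀ j, 0 < y j := box_subset n k hy
    have hp : x i * y i / 4 ∈ Icc (1 / ((k : ℝ) + 1) * (1 / ((k : ℝ) + 1)) / 4)
        (((k : ℝ) + 1) * ((k : ℝ) + 1) / 4) := by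
      have a1 := hx i
      have a2 := hy i
      have := hx0 i
      have := hy0 i
      constructor
      · gcongr
        exacts [a1.1, a2.1]
      · gcongr
        exacts [a1.2, a2.2]
    have hp0 : 0 < x i * y i / 4 := by have := hx0 i; have := hy0 i; positivity
    obtain ⟨hC1, hC2⟩ := hC x hx y hy
    obtain ⟨hK1, hK2⟩ := hK _ hp
    set e : ℝ → ℝ := fun t => profile (lam i) (x i * y i / 4 / t) with he
    set P : ℝ → ℝ := fun t => ∏ j ∈ s, profile (lam j) (x j * y j / 4 / t) with hP
    have hd : ∀ t, 0 < t → deriv (fun t => ∏ j ∈ insert i s, profile (lam j) (x j * y j / 4 / t)) t =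
        profileDeriv (lam i) (x i * y i / 4 / t) * (-(x i * y i / 4) / t ^ 2) * P t +
          e t * deriv P t := by
      intro t ht
      have h1 := hasDerivAt_profile_div (hlam i) hp0 ht
      have h2 : DifferentiableAt ℝ P t := DifferentiableAt.fun_finsetProd fun j _ =>
        (hasDerivAt_profile_div (hlam j)
          (by have := hx0 j; have := hy0 j; positivity) ht).differentiableAt
      have h3 := (h1.mul h2.hasDerivAt).deriv
      simp only [Finset.prod_insert hi]
      exact h3
    refine ⟨fun t ht ht1 => ?_, fun t ht => ?_⟩
    · obtain ⟨a1, a2⟩ := hC1 t ht ht1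
      obtain ⟨b1, b2⟩ := hK1 t ht ht1
      rw [hd t ht, Finset.prod_insert hi]
      change |P t - 1| ≤ _ at a1
      change |deriv P t| ≤ _ at a2
      change |e t - 1| ≤ _ at b1
      change |e t * P t - 1| ≤ _ ∧ _
      have hCt : C * t ≤ C := mul_le_of_le_one_right hC0 ht1
      have hKt : K * t ≤ K := mul_le_of_le_one_right hK0 ht1
      have c1 : |P t| ≤ C + 1 := by
        have := abs_add_le (P t - 1) 1
        simp at this
        linarith
      have c2 : |e t| ≤ K + 1 := by
        have := abs_add_le (e t - 1) 1
        simp at this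
        linarith
      constructor
      · calc |e t * P t - 1| = |(e t - 1) * P t + (P t - 1)| := by ring_nf
          _ ≤ |e t - 1| * |P t| + |P t - 1| := by
            rw [← abs_mul]; exact abs_add_le _ _
          _ ≤ (K * t) * (C + 1) + C * t := by gcongr
          _ ≤ 2 * (K * C + C + K) * t := by
            have : 0 ≤ (K * C + C + K) * t := by positivity
            linarith
      · calc _ ≤ |profileDeriv (lam i) (x i * y i / 4 / t) * (-(x i * y i / 4) / t ^ 2)| * |P t| +
              |e t| * |deriv P t| := by
              rw [← abs_mul, ← abs_mul]; exact abs_add_le _ _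
          _ ≤ K * (C + 1) + (K + 1) * C := by gcongr
          _ ≤ _ := by linarith
    · have ht0 : 0 < t := by linarith
      obtain ⟨a1, a2⟩ := hC2 t ht
      obtain ⟨b1, b2⟩ := hK2 t ht
      rw [hd t ht0, Finset.prod_insert hi, Finset.sum_insert hi]
      change |P t| ≤ _ at a1
      change |deriv P t| ≤ _ at a2
      change |e t| ≤ _ at b1
      change |e t * P t| ≤ _ ∧ _
      have e1 : t ^ (-lam i) * t ^ (-∑ j ∈ s, lam j) = t ^ (-(lam i + ∑ j ∈ s, lam j)) := by
        rw [← Real.rpow_add ht0]; ring_nf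
      have e2 : t ^ (-lam i - 1) * t ^ (-∑ j ∈ s, lam j) =
          t ^ (-(lam i + ∑ j ∈ s, lam j) - 1) := by
        rw [← Real.rpow_add ht0]; ring_nf
      have e3 : t ^ (-lam i) * t ^ (-∑ j ∈ s, lam j - 1) =
          t ^ (-(lam i + ∑ j ∈ s, lam j) - 1) := by
        rw [← Real.rpow_add ht0]; ring_nf
      constructor
      · rw [abs_mul]
        calc _ ≤ (K * t ^ (-lam i)) * (C * t ^ (-∑ j ∈ s, lam j)) := by gcongr
          _ = K * C * t ^ (-(lam i + ∑ j ∈ s, lam j)) := by rw [← e1]; ring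
          _ ≤ _ := by
            refine mul_le_mul_of_nonneg_right ?_ (by positivity)
            have : 0 ≤ K * C := by positivity
            linarith
      · calc _ ≤ |profileDeriv (lam i) (x i * y i / 4 / t) * (-(x i * y i / 4) / t ^ 2)| * |P t| +
              |e t| * |deriv P t| := by
              rw [← abs_mul, ← abs_mul]; exact abs_add_le _ _
          _ ≤ (K * t ^ (-lam i - 1)) * (C * t ^ (-∑ j ∈ s, lam j)) +
              (K * t ^ (-lam i)) * (C * t ^ (-∑ j ∈ s, lam j - 1)) := by gcongr
          _ = K * C * (t ^ (-lam i - 1) * t ^ (-∑ j ∈ s, lam j)) +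
              K * C * (t ^ (-lam i) * t ^ (-∑ j ∈ s, lam j - 1)) := by ring
          _ = 2 * (K * C) * t ^ (-(lam i + ∑ j ∈ s, lam j) - 1) := by rw [e2, e3]; ring
          _ ≤ _ := mul_le_mul_of_nonneg_right (by linarith) (by positivity)

/-- The exponent of the decay of the heat kernel for large times. -/
noncomputable def decayExponent (lam : Fin n → ℝ) : ℝ := n / 2 + ∑ j, lam j

lemma decayExponent_pos (hn : 1 ≤ n) {lam : Fin n → ℝ} (hlam : ∀ j, -1 / 2 < lam j) :
    0 < decayExponent lam := by
  have hne : (Finset.univ : Finset (Fin n)).Nonempty := ⟨⟨0, hn⟩, Finset.mem_univ _⟩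
  have := Finset.sum_lt_sum_of_nonempty hne fun j _ => hlam j
  simp at this
  unfold decayExponent
  linarith

/-- The comparison of the heat kernel with the Euclidean one for small times, and its decay for
large times, uniformly on compact sets. -/
lemma exists_heatDensityDeriv_bounds {lam : Fin n → ℝ} (hlam : ∀ j, -1 / 2 < lam j) (k : ℕ) :
    ∃ C, 0 ≤ C ∧ ∀ x ∈ box n k, ∀ y ∈ box n k,
      (∀ t, 0 < t → t ≤ 1 →
        |heatDensityDeriv lam x y t - gaussDeriv n t (y - x)| ≤ C * gauss n (2 * t) (y - x) ∧
        |heatDensityDeriv lam x y t| ≤ C * (t⁻¹ * gauss n (2 * t) (y - x))) ∧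
      ∀ t, 1 ≤ t → |heatDensityDeriv lam x y t| ≤ C * t ^ (-1 - decayExponent lam) := by
  obtain ⟨C, hC0, hC⟩ := exists_prod_profile_bounds hlam k Finset.univ
  have hA := derivConst_pos n
  have hB := doublingConst_pos n
  set A := derivConst n
  set B := doublingConst n
  refine ⟨A * C + B * C + A + C, by positivity, fun x hx y hy => ?_⟩
  obtain ⟨h1, h2⟩ := hC x hx y hy
  have hd : ∀ t, 0 < t → deriv (fun t => ∏ j, profile (lam j) (x j * y j / 4 / t)) t =
      profileProdDeriv lam x y t := fun t ht =>
    (hasDerivAt_profileProd hlam (box_subset n k hx) (box_subset n k hy) ht).deriv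
  set z := y - x with hz
  refine ⟨fun t ht ht1 => ?_, fun t ht => ?_⟩
  · obtain ⟨a1, a2⟩ := h1 t ht ht1
    rw [hd t ht] at a2
    have b1 := abs_gaussDeriv_le ht z
    have b2 := gauss_le_gauss_two_mul ht z
    have b3 := gauss_nonneg ht z
    have b5 : |gauss n t z * profileProdDeriv lam x y t| =
        gauss n t z * |profileProdDeriv lam x y t| := by rw [abs_mul, abs_of_nonneg b3]
    have b4 := gauss_nonneg (show 0 < 2 * t by positivity) z
    have key : |heatDensityDeriv lam x y t - gaussDeriv n t z| ≤
        (A * C + B * C) * gauss n (2 * t) z := by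
      calc _ = |gaussDeriv n t z * (profileProd lam x y t - 1) +
            gauss n t z * profileProdDeriv lam x y t| := by
            rw [heatDensityDeriv, ← hz]; congr 1; ring
        _ ≤ |gaussDeriv n t z| * |profileProd lam x y t - 1| +
            gauss n t z * |profileProdDeriv lam x y t| := by
            rw [← abs_mul, ← b5]; exact abs_add_le _ _
        _ ≤ A * t⁻¹ * gauss n (2 * t) z * (C * t) + B * gauss n (2 * t) z * C := by
            gcongr
            exact a1
        _ = _ := by field_simp
    constructor
    · exact key.trans (mul_le_mul_of_nonneg_right (by linarith) b4)
    · have h3 : 1 ≤ t⁻¹ := (one_le_inv₀ ht).2 ht1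
      calc _ ≤ |heatDensityDeriv lam x y t - gaussDeriv n t z| + |gaussDeriv n t z| := by
            have := abs_add_le (heatDensityDeriv lam x y t - gaussDeriv n t z) (gaussDeriv n t z)
            simpa using this
        _ ≤ (A * C + B * C) * (t⁻¹ * gauss n (2 * t) z) + A * t⁻¹ * gauss n (2 * t) z := by
            refine add_le_add (key.trans ?_) b1
            exact mul_le_mul_of_nonneg_left (le_mul_of_one_le_left b4 h3) (by positivity)
        _ = (A * C + B * C + A) * (t⁻¹ * gauss n (2 * t) z) := by ring
        _ ≤ _ := mul_le_mul_of_nonneg_right (by linarith) (by positivity)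
  · have ht0 : 0 < t := by linarith
    obtain ⟨a1, a2⟩ := h2 t ht
    rw [hd t ht0] at a2
    have b1 := abs_gaussDeriv_le_rpow ht0 z
    have b2 := gauss_le ht0 z
    have b3 := gauss_nonneg ht0 z
    have b5 : |gauss n t z * profileProdDeriv lam x y t| =
        gauss n t z * |profileProdDeriv lam x y t| := by rw [abs_mul, abs_of_nonneg b3]
    have e1 : t ^ (-1 - (n : ℝ) / 2) * t ^ (-∑ j, lam j) = t ^ (-1 - decayExponent lam) := by
      rw [← Real.rpow_add ht0]; unfold decayExponent; ring_nf
    have e2 : t ^ (-(n : ℝ) / 2) * t ^ (-∑ j, lam j - 1) = t ^ (-1 - decayExponent lam) := by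
      rw [← Real.rpow_add ht0]; unfold decayExponent; ring_nf
    calc _ ≤ |gaussDeriv n t z| * |profileProd lam x y t| +
            gauss n t z * |profileProdDeriv lam x y t| := by
            rw [← abs_mul, ← b5]; exact abs_add_le _ _
      _ ≤ A * t ^ (-1 - (n : ℝ) / 2) * (C * t ^ (-∑ j, lam j)) +
          t ^ (-(n : ℝ) / 2) * (C * t ^ (-∑ j, lam j - 1)) := by
          gcongr
          exact a1
      _ = A * C * (t ^ (-1 - (n : ℝ) / 2) * t ^ (-∑ j, lam j)) +
          C * (t ^ (-(n : ℝ) / 2) * t ^ (-∑ j, lam j - 1)) := by ring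
      _ = (A * C + C) * t ^ (-1 - decayExponent lam) := by rw [e1, e2]; ring
      _ ≤ _ := by
          refine mul_le_mul_of_nonneg_right ?_ (by positivity)
          have : 0 ≤ B * C := by positivity
          linarith

lemma exists_subset_box {K : Set (EuclideanSpace ℝ (Fin n))} (hK : IsCompact K)
    (hKo : K ⊆ orthant n) : ∃ k, K ⊆ box n k := by
  set U : ℕ → Set (EuclideanSpace ℝ (Fin n)) := fun k =>
    {y | ∀ j, 1 / ((k : ℝ) + 1) < y j ∧ y j < k + 1} with hU
  have hUo : ∀ k, IsOpen (U k) := fun k => by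
    simp only [hU, ofPred_forall]
    refine isOpen_iInter_of_finite fun j => ?_
    have hc : Continuous fun y : EuclideanSpace ℝ (Fin n) => y j := by fun_prop
    exact (isOpen_lt continuous_const hc).inter (isOpen_lt hc continuous_const)
  have hmono : Monotone U := by
    intro k l hkl y hy j
    have hkl' : (k : ℝ) ≤ l := by exact_mod_cast hkl
    refine ⟨lt_of_le_of_lt ?_ (hy j).1, (hy j).2.trans_le (by linarith)⟩
    gcongr
  have hcov : K ⊆ ⋃ k, U k := by
    intro y hy
    have : ∀ j, ∀ᶠ k : ℕ in atTop, 1 / ((k : ℝ) + 1) < y j ∧ y j < k + 1 := by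
      intro j
      have h1 : ∀ᶠ k : ℕ in atTop, 1 / ((k : ℝ) + 1) < y j :=
        tendsto_one_div_add_atTop_nhds_zero_nat.eventually (gt_mem_nhds (hKo hy j))
      have h2 : ∀ᶠ k : ℕ in atTop, y j ≤ (k : ℝ) :=
        tendsto_natCast_atTop_atTop.eventually_ge_atTop _
      filter_upwards [h1, h2] with k a b
      exact ⟨a, by linarith⟩
    obtain ⟨k, hk⟩ := (eventually_all.2 this).exists
    exact mem_iUnion.2 ⟨k, hk⟩
  obtain ⟨k, hk⟩ := hK.elim_directed_cover U hUo hcov hmono.directed_le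
  exact ⟨k, fun y hy j => ⟨(hk hy j).1.le, (hk hy j).2.le⟩⟩

lemma box_mono (n : ℕ) {k l : ℕ} (h : k ≤ l) : box n k ⊆ box n l := by
  intro y hy j
  have hkl : (k : ℝ) ≤ l := by exact_mod_cast h
  refine ⟨le_trans ?_ (hy j).1, (hy j).2.trans (by linarith)⟩
  gcongr

/-! ### Integration against the weighted measure -/

lemma ae_mu_iff (lam : Fin n → ℝ) {p : EuclideanSpace ℝ (Fin n) → Prop} :
    (∀ᵐ y ∂(mu lam), p y) ↔
      ∀ᵐ y ∂(volume.restrict (orthant n : Set (EuclideanSpace ℝ (Fin n)))), p y := by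
  unfold mu
  rw [ae_withDensity_iff (measurable_weight lam).ennreal_ofReal]
  refine ⟨fun h => ?_, fun h => h.mono fun y hy _ => hy⟩
  filter_upwards [h, ae_restrict_mem (orthant n).isOpen.measurableSet] with y h1 h2
  exact h1 (by simpa using weight_pos lam h2)

lemma setIntegral_mu (lam : Fin n → ℝ) (f : EuclideanSpace ℝ (Fin n) → ℂ)
    {s : Set (EuclideanSpace ℝ (Fin n))} (hs : MeasurableSet s) :
    ∫ y in s, f y ∂(mu lam) = ∫ y in s ∩ orthant n, (weight lam y : ℂ) * f y := by
  unfold mu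
  rw [restrict_withDensity hs, Measure.restrict_restrict hs,
    integral_withDensity_eq_integral_toReal_smul (measurable_weight lam).ennreal_ofReal
      (Eventually.of_forall fun _ => ENNReal.ofReal_lt_top)]
  refine setIntegral_congr_fun (hs.inter (orthant n).isOpen.measurableSet) fun y hy => ?_
  rw [ENNReal.toReal_ofReal (weight_pos lam hy.2).le, Complex.real_smul]

lemma integrableOn_mu_iff (lam : Fin n → ℝ) (f : EuclideanSpace ℝ (Fin n) → ℂ)
    {s : Set (EuclideanSpace ℝ (Fin n))} (hs : MeasurableSet s) :
    IntegrableOn f s (mu lam) ↔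
      IntegrableOn (fun y => (weight lam y : ℂ) * f y) (s ∩ orthant n) := by
  unfold mu IntegrableOn
  rw [restrict_withDensity hs, Measure.restrict_restrict hs,
    integrable_withDensity_iff_integrable_smul' (measurable_weight lam).ennreal_ofReal
      (Eventually.of_forall fun _ => ENNReal.ofReal_lt_top)]
  refine integrable_congr ?_
  filter_upwards [ae_restrict_mem (hs.inter (orthant n).isOpen.measurableSet)] with y hy
  rw [ENNReal.toReal_ofReal (weight_pos lam hy.2).le, Complex.real_smul]

lemma prod_indicator_eq (lam : Fin n → ℝ) (F : Fin n → ℝ → ℝ) (y : Fin n → ℝ) :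
    ∏ j, (Ioi (0 : ℝ)).indicator (fun v => F j v * v ^ (2 * lam j)) (y j) =
      (orthant n : Set (EuclideanSpace ℝ (Fin n))).indicator
        (fun y => weight lam y * ∏ j, F j (y j)) (WithLp.toLp 2 y) := by
  by_cases hy : ∀ j, 0 < y j
  · rw [indicator_of_mem (show WithLp.toLp 2 y ∈ (orthant n : Set _) from hy), weight, mul_comm,
      ← Finset.prod_mul_distrib]
    exact Finset.prod_congr rfl fun j _ => by rw [indicator_of_mem (show y j ∈ Ioi 0 from hy j)]
  · rw [indicator_of_notMem (show WithLp.toLp 2 y ∉ (orthant n : Set _) from hy)]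
    obtain ⟨j, hj⟩ := not_forall.1 hy
    exact Finset.prod_eq_zero (Finset.mem_univ j) (indicator_of_notMem (by simpa using hj) _)

lemma integral_mu_eq (lam : Fin n → ℝ) (f : EuclideanSpace ℝ (Fin n) → ℝ) :
    ∫ y, f y ∂(mu lam) = ∫ y in (orthant n : Set (EuclideanSpace ℝ (Fin n))), weight lam y * f y := by
  unfold mu
  rw [integral_withDensity_eq_integral_toReal_smul (measurable_weight lam).ennreal_ofReal
      (Eventually.of_forall fun _ => ENNReal.ofReal_lt_top)]
  refine setIntegral_congr_fun (orthant n).isOpen.measurableSet fun y hy => ?_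
  rw [ENNReal.toReal_ofReal (weight_pos lam hy).le, smul_eq_mul]

lemma integrable_mu_iff (lam : Fin n → ℝ) (f : EuclideanSpace ℝ (Fin n) → ℝ) :
    Integrable f (mu lam) ↔ IntegrableOn (fun y => weight lam y * f y) (orthant n) := by
  unfold mu
  rw [integrable_withDensity_iff_integrable_smul' (measurable_weight lam).ennreal_ofReal
      (Eventually.of_forall fun _ => ENNReal.ofReal_lt_top)]
  refine integrable_congr ?_
  filter_upwards [ae_restrict_mem (orthant n).isOpen.measurableSet] with y hy
  rw [ENNReal.toReal_ofReal (weight_pos lam hy).le, smul_eq_mul]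

/-- The measure is a product measure. -/
lemma integral_mu_prod (lam : Fin n → ℝ) (F : Fin n → ℝ → ℝ) :
    ∫ y, ∏ j, F j (y j) ∂(mu lam) = ∏ j, ∫ v in Ioi (0 : ℝ), F j v * v ^ (2 * lam j) := by
  simp only [← integral_indicator measurableSet_Ioi]
  rw [← integral_fintype_prod_volume_eq_prod
    (fun j => (Ioi (0 : ℝ)).indicator fun v => F j v * v ^ (2 * lam j))]
  simp only [prod_indicator_eq]
  rw [(PiLp.volume_preserving_toLp (Fin n)).integral_comp
    (MeasurableEquiv.toLp 2 (Fin n → ℝ)).measurableEmbedding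
    ((orthant n : Set (EuclideanSpace ℝ (Fin n))).indicator
        (fun y => weight lam y * ∏ j, F j (y j))),
    integral_indicator (orthant n).isOpen.measurableSet, integral_mu_eq]

lemma integrable_mu_prod (lam : Fin n → ℝ) {F : Fin n → ℝ → ℝ}
    (hF : ∀ j, IntegrableOn (fun v => F j v * v ^ (2 * lam j)) (Ioi 0)) :
    Integrable (fun y : EuclideanSpace ℝ (Fin n) => ∏ j, F j (y j)) (mu lam) := by
  rw [integrable_mu_iff, ← integrable_indicator_iff (orthant n).isOpen.measurableSet,
    ← (PiLp.volume_preserving_toLp (Fin n)).integrable_comp_emb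
    (MeasurableEquiv.toLp 2 (Fin n → ℝ)).measurableEmbedding]
  have h := Integrable.fintype_prod (𝕜 := ℝ) (μ := fun _ : Fin n => (volume : Measure ℝ))
    (f := fun j => (Ioi (0 : ℝ)).indicator fun v => F j v * v ^ (2 * lam j))
    fun j => (integrable_indicator_iff measurableSet_Ioi).2 (hF j)
  simp only [prod_indicator_eq] at h
  exact h

/-! ### The Hankel transformation of compactly supported functions -/

/-- The kernel of the Hankel transformation on the orthant, extended to an entire function. -/
noncomputable def hankelSeries (lam : Fin n → ℝ) (x y : EuclideanSpace ℝ (Fin n)) : ℝ :=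
  ∏ j, 2 ^ (-(lam j - 1 / 2)) * besselSeries (lam j + 1 / 2) (-(x j * y j / 2) ^ 2)

/-- The heat kernel of the Bessel operator on the orthant, extended to a function that is smooth on
the whole space. -/
noncomputable def heatSeries (lam : Fin n → ℝ) (t : ℝ) (x z : EuclideanSpace ℝ (Fin n)) : ℝ :=
  ∏ j, 2 * (4 * t) ^ (-(lam j + 1 / 2)) *
    (besselSeries (lam j + 1 / 2) ((x j * z j / (4 * t)) ^ 2) *
      Real.exp (-(x j ^ 2 + z j ^ 2) / (4 * t)))

lemma hankelKernel_eq (lam : Fin n → ℝ) {x y : EuclideanSpace ℝ (Fin n)} (hx : x ∈ orthant n)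
    (hy : y ∈ orthant n) : hankelKernel lam x y = hankelSeries lam x y := by
  unfold hankelKernel hankelSeries
  refine Finset.prod_congr rfl fun j _ => ?_
  have h1 := hx j
  have h2 := hy j
  have h3 : 0 < x j * y j := by positivity
  rw [besselJ_eq h3, show lam j - 1 / 2 + 1 = lam j + 1 / 2 by ring,
    Real.div_rpow h3.le zero_le_two, show -lam j + 1 / 2 = -(lam j - 1 / 2) by ring,
    Real.rpow_neg h3.le, Real.rpow_neg zero_le_two]
  have h4 : 0 < (x j * y j) ^ (lam j - 1 / 2) := by positivity
  field_simp

lemma prod_heatKernel_eq (lam : Fin n → ℝ) {t : ℝ} (ht : 0 < t) {x z : EuclideanSpace ℝ (Fin n)}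
    (hx : x ∈ orthant n) (hz : z ∈ orthant n) :
    ∏ j, heatKernel (lam j) t (x j) (z j) = heatSeries lam t x z := by
  unfold heatSeries
  refine Finset.prod_congr rfl fun j _ => ?_
  rw [heatKernel_eq ht (hx j) (hz j)]
  ring

lemma hankelSeries_symm (lam : Fin n → ℝ) (x y : EuclideanSpace ℝ (Fin n)) :
    hankelSeries lam x y = hankelSeries lam y x := by
  unfold hankelSeries
  simp only [mul_comm (x _)]

lemma heatSeries_symm (lam : Fin n → ℝ) (t : ℝ) (x y : EuclideanSpace ℝ (Fin n)) :
    heatSeries lam t x y = heatSeries lam t y x := by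
  unfold heatSeries
  simp only [mul_comm (x _), add_comm (x _ ^ 2)]

lemma heatSeries_nonneg {lam : Fin n → ℝ} (hlam : ∀ j, -1 / 2 < lam j) {t : ℝ} (ht : 0 < t)
    (x y : EuclideanSpace ℝ (Fin n)) : 0 ≤ heatSeries lam t x y := by
  unfold heatSeries
  refine Finset.prod_nonneg fun j _ => ?_
  have := besselSeries_pos (a := lam j + 1 / 2) (by linarith [hlam j])
    (sq_nonneg (x j * y j / (4 * t)))
  positivity

lemma continuous_hankelSeries {lam : Fin n → ℝ} (hlam : ∀ j, -1 / 2 < lam j) :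
    Continuous fun p : EuclideanSpace ℝ (Fin n) × EuclideanSpace ℝ (Fin n) =>
      hankelSeries lam p.1 p.2 := by
  unfold hankelSeries
  refine continuous_finsetProd _ fun j _ => ?_
  have := continuous_besselSeries (a := lam j + 1 / 2) (by linarith [hlam j])
  fun_prop

lemma continuous_heatSeries {lam : Fin n → ℝ} (hlam : ∀ j, -1 / 2 < lam j) (t : ℝ) :
    Continuous fun p : EuclideanSpace ℝ (Fin n) × EuclideanSpace ℝ (Fin n) =>
      heatSeries lam t p.1 p.2 := by
  unfold heatSeries
  refine continuous_finsetProd _ fun j _ => ?_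
  have := continuous_besselSeries (a := lam j + 1 / 2) (by linarith [hlam j])
  fun_prop

lemma integral_heatSeries {lam : Fin n → ℝ} (hlam : ∀ j, -1 / 2 < lam j) {t : ℝ} (ht : 0 < t)
    (x : EuclideanSpace ℝ (Fin n)) :
    Integrable (heatSeries lam t x) (mu lam) ∧ ∫ z, heatSeries lam t x z ∂(mu lam) = 1 := by
  have h1 : ∀ j, IntegrableOn (fun v : ℝ => (2 * (4 * t) ^ (-(lam j + 1 / 2)) *
      (besselSeries (lam j + 1 / 2) ((x j * v / (4 * t)) ^ 2) *
        Real.exp (-(x j ^ 2 + v ^ 2) / (4 * t)))) * v ^ (2 * lam j)) (Ioi 0) ∧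
      ∫ v in Ioi (0 : ℝ), (2 * (4 * t) ^ (-(lam j + 1 / 2)) *
      (besselSeries (lam j + 1 / 2) ((x j * v / (4 * t)) ^ 2) *
        Real.exp (-(x j ^ 2 + v ^ 2) / (4 * t)))) * v ^ (2 * lam j) = 1 := by
    intro j
    obtain ⟨h2, h3⟩ := integral_besselSeries_mul_exp (a := lam j + 1 / 2)
      (by linarith [hlam j]) ht (x j)
    rw [show 2 * (lam j + 1 / 2) - 1 = 2 * lam j by ring] at h2 h3
    simp only [mul_assoc (2 * (4 * t) ^ (-(lam j + 1 / 2)))]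
    refine ⟨h2.const_mul _, ?_⟩
    rw [integral_const_mul, h3, Real.rpow_neg (by positivity)]
    have : 0 < (4 * t) ^ (lam j + 1 / 2) := by positivity
    field_simp
  refine ⟨integrable_mu_prod lam (F := fun j v => 2 * (4 * t) ^ (-(lam j + 1 / 2)) *
      (besselSeries (lam j + 1 / 2) ((x j * v / (4 * t)) ^ 2) *
        Real.exp (-(x j ^ 2 + v ^ 2) / (4 * t)))) fun j => (h1 j).1, ?_⟩
  unfold heatSeries
  rw [integral_mu_prod lam (fun j v => 2 * (4 * t) ^ (-(lam j + 1 / 2)) *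
      (besselSeries (lam j + 1 / 2) ((x j * v / (4 * t)) ^ 2) *
        Real.exp (-(x j ^ 2 + v ^ 2) / (4 * t))))]
  exact Finset.prod_eq_one fun j _ => (h1 j).2

lemma integral_hankelSeries_mul_hankelSeries {lam : Fin n → ℝ} (hlam : ∀ j, -1 / 2 < lam j) {t : ℝ}
    (ht : 0 < t) (x z : EuclideanSpace ℝ (Fin n)) :
    ∫ y, hankelSeries lam x y * hankelSeries lam z y * Real.exp (-t * ∑ j, y j ^ 2) ∂(mu lam) =
      heatSeries lam t x z := by
  have h1 : ∀ y : EuclideanSpace ℝ (Fin n), hankelSeries lam x y * hankelSeries lam z y *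
      Real.exp (-t * ∑ j, y j ^ 2) = ∏ j, (2 ^ (-(lam j - 1 / 2)) * 2 ^ (-(lam j - 1 / 2)) *
        (besselSeries (lam j + 1 / 2) (-(x j * y j / 2) ^ 2) *
        besselSeries (lam j + 1 / 2) (-(z j * y j / 2) ^ 2) * Real.exp (-t * y j ^ 2))) := by
    intro y
    unfold hankelSeries
    rw [Finset.mul_sum, Real.exp_sum, ← Finset.prod_mul_distrib, ← Finset.prod_mul_distrib]
    exact Finset.prod_congr rfl fun j _ => by ring
  simp only [h1]
  rw [integral_mu_prod lam (fun j v => 2 ^ (-(lam j - 1 / 2)) * 2 ^ (-(lam j - 1 / 2)) *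
        (besselSeries (lam j + 1 / 2) (-(x j * v / 2) ^ 2) *
        besselSeries (lam j + 1 / 2) (-(z j * v / 2) ^ 2) * Real.exp (-t * v ^ 2)))]
  unfold heatSeries
  refine Finset.prod_congr rfl fun j _ => ?_
  have h3 := integral_besselSeries_mul_besselSeries (a := lam j + 1 / 2)
      (by linarith [hlam j]) ht (x j) (z j)
  rw [show 2 * (lam j + 1 / 2) - 1 = 2 * lam j by ring] at h3
  simp only [mul_assoc (2 ^ (-(lam j - 1 / 2)) * 2 ^ (-(lam j - 1 / 2)) : ℝ)]
  rw [integral_const_mul, h3, Real.mul_rpow (by norm_num) ht.le,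
    show (4 : ℝ) = 2 * 2 by norm_num, Real.mul_rpow zero_le_two zero_le_two,
    show -(lam j - 1 / 2) = -(lam j + 1 / 2) + 1 by ring, Real.rpow_add_one two_ne_zero]
  ring

lemma exists_besselSeries_le_exp {a : ℝ} (ha : 0 < a) :
    ∃ C, 0 ≤ C ∧ ∀ r, 0 ≤ r → besselSeries a (r ^ 2) ≤ C * Real.exp (3 * r) := by
  have hlam : -1 / 2 < a - 1 / 2 := by linarith
  obtain ⟨C₁, hC₁0, hC₁⟩ := exists_profile_sub_one_le hlam one_pos
  obtain ⟨C₂, hC₂⟩ := isCompact_Icc (a := (0 : ℝ)) (b := 1) |>.exists_bound_of_continuousOn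
    (f := fun r => besselSeries a (r ^ 2))
    ((continuous_besselSeries ha).comp (continuous_pow 2)).continuousOn
  refine ⟨max (1 + C₁) |C₂|, le_max_of_le_left (by positivity), fun r hr => ?_⟩
  rcases le_total r 1 with h | h
  · have h1 := hC₂ r ⟨hr, h⟩
    have h2 : 1 ≤ Real.exp (3 * r) := Real.one_le_exp (by positivity)
    calc _ ≤ |C₂| * 1 := by
          rw [mul_one]; exact (le_abs_self _).trans (h1.trans (le_abs_self _))
      _ ≤ _ := by gcongr; exact le_max_right _ _
  · have hr0 : 0 < r := by linarith
    have h1 : profile (a - 1 / 2) r ≤ 1 + C₁ := by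
      have h2 := (abs_le.1 (hC₁ r h).1).2
      have h3 : C₁ / r ≤ C₁ := div_le_self hC₁0 h
      linarith
    unfold profile at h1
    rw [sub_add_cancel] at h1
    have h4 : Real.exp (-r) ≤ r ^ (a - 1 / 2) := by
      rw [Real.rpow_def_of_pos hr0, Real.exp_le_exp]
      have h5 := Real.log_nonneg h
      have h6 : Real.log r ≤ r - 1 := Real.log_le_sub_one_of_pos hr0
      nlinarith
    have hpi : 1 ≤ 2 * √Real.pi := by
      have : 1 ≤ √Real.pi := Real.one_le_sqrt.2 (by linarith [Real.pi_gt_three])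
      linarith
    have hB := besselSeries_pos ha (sq_nonneg r)
    have h7 : Real.exp (-r) * Real.exp (-2 * r) * besselSeries a (r ^ 2) ≤ 1 + C₁ := by
      refine le_trans ?_ h1
      gcongr
      calc Real.exp (-r) = 1 * Real.exp (-r) := (one_mul _).symm
        _ ≤ _ := by gcongr
    rw [← Real.exp_add, show -r + -2 * r = -(3 * r) by ring, Real.exp_neg,
      inv_mul_le_iff₀ (Real.exp_pos _)] at h7
    calc _ ≤ Real.exp (3 * r) * (1 + C₁) := h7
      _ = (1 + C₁) * Real.exp (3 * r) := mul_comm _ _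
      _ ≤ _ := by gcongr; exact le_max_left _ _

/-- On a compact set of `x` the kernel of the Hankel transformation grows at most exponentially
in `y`; this makes the Gaussian regularizations converge absolutely. -/
lemma exists_hankelSeries_bound {lam : Fin n → ℝ} (hlam : ∀ j, -1 / 2 < lam j) (k : ℕ) :
    ∃ b : EuclideanSpace ℝ (Fin n) → ℝ, Measurable b ∧ (∀ y, 0 ≤ b y) ∧
      (∀ x ∈ box n k, ∀ y ∈ orthant n, |hankelSeries lam x y| ≤ b y) ∧
      ∀ t, 0 < t → Integrable (fun y => Real.exp (-t * ∑ j, y j ^ 2) * (b y * b y)) (mu lam) := by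
  have hC' : ∀ j, ∃ C, 0 ≤ C ∧ ∀ r, 0 ≤ r →
      besselSeries (lam j + 1 / 2) (r ^ 2) ≤ C * Real.exp (3 * r) := fun j =>
    exists_besselSeries_le_exp (by linarith [hlam j])
  choose C hC0 hC using hC'
  set R : ℝ := 3 / 2 * (k + 1) with hR
  have hR0 : 0 ≤ R := by positivity
  refine ⟨fun y => ∏ j, 2 ^ (-(lam j - 1 / 2)) * (C j * Real.exp (R * y j)), by fun_prop,
    fun y => Finset.prod_nonneg fun j _ => by have := hC0 j; positivity, fun x hx y hy => ?_,
    fun t ht => ?_⟩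
  · unfold hankelSeries
    rw [Finset.abs_prod]
    refine Finset.prod_le_prod (fun j _ => abs_nonneg _) fun j _ => ?_
    have h1 := box_subset n k hx j
    have h2 := hy j
    rw [abs_mul, abs_of_nonneg (by positivity)]
    gcongr
    refine (abs_besselSeries_neg_le (by linarith [hlam j]) (sq_nonneg _)).trans
      ((hC j _ (by positivity)).trans ?_)
    have h3 : x j * y j ≤ (k + 1) * y j := by gcongr; exact (hx j).2
    refine mul_le_mul_of_nonneg_left (Real.exp_le_exp.2 ?_) (hC0 j)
    rw [hR]
    linarith
  · have h1 : ∀ y : EuclideanSpace ℝ (Fin n), Real.exp (-t * ∑ j, y j ^ 2) *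
        ((∏ j, 2 ^ (-(lam j - 1 / 2)) * (C j * Real.exp (R * y j))) *
          (∏ j, 2 ^ (-(lam j - 1 / 2)) * (C j * Real.exp (R * y j)))) =
        ∏ j, ((2 ^ (-(lam j - 1 / 2)) * C j) ^ 2 * (Real.exp (-t * y j ^ 2) *
          (Real.exp (R * y j)) ^ 2)) := by
      intro y
      rw [Finset.mul_sum, Real.exp_sum, ← Finset.prod_mul_distrib, ← Finset.prod_mul_distrib]
      exact Finset.prod_congr rfl fun j _ => by ring
    simp only [h1]
    refine integrable_mu_prod lam (F := fun j v => (2 ^ (-(lam j - 1 / 2)) * C j) ^ 2 *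
      (Real.exp (-t * v ^ 2) * (Real.exp (R * v)) ^ 2)) fun j => ?_
    simp only [mul_assoc]
    refine Integrable.const_mul ?_ _
    have h2 := (integrableOn_rpow_mul_exp_neg_mul_sq (b := t / 2) (by positivity)
      (s := 2 * lam j) (by linarith [hlam j])).const_mul (Real.exp (2 * R ^ 2 / t))
    refine Integrable.mono' h2 (Measurable.aestronglyMeasurable (by fun_prop)) ?_
    filter_upwards [ae_restrict_mem measurableSet_Ioi] with v hv
    have hv : 0 < v := hv
    rw [Real.norm_of_nonneg (by positivity), ← mul_assoc (Real.exp (-t * v ^ 2)), ← Real.exp_nat_mul,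
      ← Real.exp_add, mul_comm (v ^ (2 * lam j)),
      ← mul_assoc (Real.exp (2 * R ^ 2 / t)), ← Real.exp_add]
    refine mul_le_mul_of_nonneg_right (Real.exp_le_exp.2 ?_) (by positivity)
    have h3 : 0 ≤ (t * v - 2 * R) ^ 2 / (2 * t) := by positivity
    have h4 : (t * v - 2 * R) ^ 2 / (2 * t) = t / 2 * v ^ 2 - 2 * R * v + 2 * R ^ 2 / t := by
      field_simp; ring
    push_cast
    linarith

/-- Integrable functions that vanish outside one of the compact boxes exhausting the orthant. -/
def BoxIntegrable (lam : Fin n → ℝ) (k : ℕ) (F : EuclideanSpace ℝ (Fin n) → ℂ) : Prop :=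
  Integrable F (mu lam) ∧ ∀ᵐ y ∂(mu lam), y ∉ box n k → F y = 0

lemma hankel_eq (lam : Fin n → ℝ) (F : EuclideanSpace ℝ (Fin n) → ℂ)
    {y : EuclideanSpace ℝ (Fin n)} (hy : y ∈ orthant n) :
    hankel lam F y = ∫ x, (hankelSeries lam x y : ℂ) * F x ∂(mu lam) := by
  refine integral_congr_ae ?_
  filter_upwards [ae_mem_orthant lam] with x hx
  rw [hankelKernel_eq lam hy hx, hankelSeries_symm]

lemma hankel_congr_ae {lam : Fin n → ℝ} {F G : EuclideanSpace ℝ (Fin n) → ℂ} (h : F =ᵐ[mu lam] G) :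
    hankel lam F = hankel lam G := by
  funext y
  exact integral_congr_ae (h.mono fun x hx => by simp only [hx])

lemma measurable_hankelSeries {lam : Fin n → ℝ} (hlam : ∀ j, -1 / 2 < lam j) :
    Measurable fun p : EuclideanSpace ℝ (Fin n) × EuclideanSpace ℝ (Fin n) =>
      (hankelSeries lam p.1 p.2 : ℂ) :=
  Complex.continuous_ofReal.measurable.comp (continuous_hankelSeries hlam).measurable

lemma aestronglyMeasurable_hankelSeries {lam : Fin n → ℝ} (hlam : ∀ j, -1 / 2 < lam j)
    {X : Type*} [MeasurableSpace X] (ν : Measure X) {u v : X → EuclideanSpace ℝ (Fin n)}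
    (hu : Measurable u) (hv : Measurable v) :
    AEStronglyMeasurable (fun q => (hankelSeries lam (u q) (v q) : ℂ)) ν :=
  ((measurable_hankelSeries hlam).comp (hu.prodMk hv)).aestronglyMeasurable

lemma aestronglyMeasurable_hankel {lam : Fin n → ℝ} (hlam : ∀ j, -1 / 2 < lam j)
    {F : EuclideanSpace ℝ (Fin n) → ℂ} (hF : AEStronglyMeasurable F (mu lam)) :
    AEStronglyMeasurable (hankel lam F) (mu lam) := by
  have h1 : AEStronglyMeasurable (fun y => ∫ x, (hankelSeries lam x y : ℂ) * F x ∂(mu lam))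
      (mu lam) := by
    refine AEStronglyMeasurable.integral_prod_right'
      (f := fun p : EuclideanSpace ℝ (Fin n) × EuclideanSpace ℝ (Fin n) =>
        (hankelSeries lam p.2 p.1 : ℂ) * F p.2) ?_
    exact ((measurable_hankelSeries hlam).comp measurable_swap).aestronglyMeasurable.mul
      hF.comp_snd
  refine h1.congr ?_
  filter_upwards [ae_mem_orthant lam] with y hy using (hankel_eq lam F hy).symm

/-- The Gaussian regularization of the pairing of two Hankel transforms is given by the heat
kernel. -/
lemma integral_exp_mul_hankel_mul_hankel {lam : Fin n → ℝ} (hlam : ∀ j, -1 / 2 < lam j) {k : ℕ}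
    {F G : EuclideanSpace ℝ (Fin n) → ℂ} (hF : BoxIntegrable lam k F) (hG : BoxIntegrable lam k G)
    {t : ℝ} (ht : 0 < t) :
    Integrable (fun y => (Real.exp (-t * ∑ j, y j ^ 2) : ℂ) * (hankel lam F y * hankel lam G y))
      (mu lam) ∧
    ∫ y, (Real.exp (-t * ∑ j, y j ^ 2) : ℂ) * (hankel lam F y * hankel lam G y) ∂(mu lam) =
      ∫ p, (heatSeries lam t p.1 p.2 : ℂ) * (F p.1 * G p.2) ∂((mu lam).prod (mu lam)) := by
  obtain ⟨b, hbm, hb0, hb, hbi⟩ := exists_hankelSeries_bound hlam k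
  set T : EuclideanSpace ℝ (Fin n) × EuclideanSpace ℝ (Fin n) × EuclideanSpace ℝ (Fin n) → ℂ :=
    fun q => (Real.exp (-t * ∑ j, q.1 j ^ 2) : ℂ) * (((hankelSeries lam q.2.1 q.1 : ℂ) * F q.2.1) *
      ((hankelSeries lam q.2.2 q.1 : ℂ) * G q.2.2)) with hT
  have hae1 : ∀ᵐ q ∂((mu lam).prod ((mu lam).prod (mu lam))), q.1 ∈ orthant n :=
    Measure.quasiMeasurePreserving_fst.ae (ae_mem_orthant lam)
  have hae2 : ∀ᵐ q ∂((mu lam).prod ((mu lam).prod (mu lam))), q.2.1 ∉ box n k → F q.2.1 = 0 :=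
    (Measure.quasiMeasurePreserving_fst.comp Measure.quasiMeasurePreserving_snd).ae hF.2
  have hae3 : ∀ᵐ q ∂((mu lam).prod ((mu lam).prod (mu lam))), q.2.2 ∉ box n k → G q.2.2 = 0 :=
    (Measure.quasiMeasurePreserving_snd.comp Measure.quasiMeasurePreserving_snd).ae hG.2
  have hTm : AEStronglyMeasurable T ((mu lam).prod ((mu lam).prod (mu lam))) := by
    have m1 : AEStronglyMeasurable (fun q : EuclideanSpace ℝ (Fin n) × EuclideanSpace ℝ (Fin n) ×
        EuclideanSpace ℝ (Fin n) => (Real.exp (-t * ∑ j, q.1 j ^ 2) : ℂ))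
        ((mu lam).prod ((mu lam).prod (mu lam))) :=
      Continuous.aestronglyMeasurable (by fun_prop)
    have m2 : AEStronglyMeasurable (fun q : EuclideanSpace ℝ (Fin n) × EuclideanSpace ℝ (Fin n) ×
        EuclideanSpace ℝ (Fin n) => F q.2.1) ((mu lam).prod ((mu lam).prod (mu lam))) :=
      AEStronglyMeasurable.comp_snd (f := fun p : EuclideanSpace ℝ (Fin n) ×
        EuclideanSpace ℝ (Fin n) => F p.1) hF.1.1.comp_fst
    have m3 : AEStronglyMeasurable (fun q : EuclideanSpace ℝ (Fin n) × EuclideanSpace ℝ (Fin n) ×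
        EuclideanSpace ℝ (Fin n) => G q.2.2) ((mu lam).prod ((mu lam).prod (mu lam))) :=
      AEStronglyMeasurable.comp_snd (f := fun p : EuclideanSpace ℝ (Fin n) ×
        EuclideanSpace ℝ (Fin n) => G p.2) hG.1.1.comp_snd
    exact m1.mul (((aestronglyMeasurable_hankelSeries hlam _ measurable_snd.fst
      measurable_fst).mul m2).mul ((aestronglyMeasurable_hankelSeries hlam _ measurable_snd.snd
      measurable_fst).mul m3))
  have hTi : Integrable T ((mu lam).prod ((mu lam).prod (mu lam))) := by
    refine ((hbi t ht).mul_prod (hF.1.norm.mul_prod hG.1.norm)).mono' hTm ?_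
    filter_upwards [hae1, hae2, hae3] with q h1 h2 h3
    have key : ∀ (H : EuclideanSpace ℝ (Fin n) → ℂ) (x : EuclideanSpace ℝ (Fin n)),
        (x ∉ box n k → H x = 0) → ‖(hankelSeries lam x q.1 : ℂ) * H x‖ ≤ b q.1 * ‖H x‖ := by
      intro H x hx
      by_cases h : x ∈ box n k
      · rw [norm_mul, Complex.norm_real]
        gcongr
        exact hb x h q.1 h1
      · simp [hx h]
    simp only [hT, norm_mul _ (_ * _ : ℂ), Complex.norm_real]
    rw [Real.norm_of_nonneg (Real.exp_pos _).le]
    calc _ ≤ Real.exp (-t * ∑ j, q.1 j ^ 2) * ((b q.1 * ‖F q.2.1‖) * (b q.1 * ‖G q.2.2‖)) := by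
          gcongr
          · exact mul_nonneg (hb0 _) (norm_nonneg _)
          · exact key F _ h2
          · exact key G _ h3
      _ = _ := by ring
  have hinner : ∀ y ∈ orthant n, ∫ p, T (y, p) ∂((mu lam).prod (mu lam)) =
      (Real.exp (-t * ∑ j, y j ^ 2) : ℂ) * (hankel lam F y * hankel lam G y) := by
    intro y hy
    rw [hankel_eq lam F hy, hankel_eq lam G hy]
    simp only [hT]
    rw [integral_const_mul, integral_prod_mul (fun x => (hankelSeries lam x y : ℂ) * F x)
      (fun x => (hankelSeries lam x y : ℂ) * G x)]
  have hinner' : (fun y => ∫ p, T (y, p) ∂((mu lam).prod (mu lam))) =ᵐ[mu lam]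
      fun y => (Real.exp (-t * ∑ j, y j ^ 2) : ℂ) * (hankel lam F y * hankel lam G y) := by
    filter_upwards [ae_mem_orthant lam] with y hy using hinner y hy
  refine ⟨hTi.integral_prod_left.congr hinner', ?_⟩
  rw [← integral_congr_ae hinner', integral_integral_swap (f := fun y p => T (y, p)) hTi]
  refine integral_congr_ae (Eventually.of_forall fun p => ?_)
  have h1 : ∀ y, T (y, p) = ((hankelSeries lam p.1 y * hankelSeries lam p.2 y *
      Real.exp (-t * ∑ j, y j ^ 2) : ℝ) : ℂ) * (F p.1 * G p.2) := by
    intro y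
    simp only [hT]
    push_cast
    ring
  simp only [h1]
  rw [integral_mul_const, integral_complex_ofReal, integral_hankelSeries_mul_hankelSeries hlam ht]

lemma hankel_conj (lam : Fin n → ℝ) (F : EuclideanSpace ℝ (Fin n) → ℂ)
    (y : EuclideanSpace ℝ (Fin n)) :
    hankel lam (fun x => (starRingEnd ℂ) (F x)) y = (starRingEnd ℂ) (hankel lam F y) := by
  unfold hankel
  rw [← integral_conj]
  simp

/-- Schur's test: the heat kernel is symmetric with mass one, so the quadratic form it defines is
at most the squared norm. -/
lemma norm_integral_heatSeries_le {lam : Fin n → ℝ} (hlam : ∀ j, -1 / 2 < lam j) {t : ℝ}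
    (ht : 0 < t) {F : EuclideanSpace ℝ (Fin n) → ℂ} (hF : MemLp F 2 (mu lam)) :
    ‖∫ p, (heatSeries lam t p.1 p.2 : ℂ) * (F p.1 * (starRingEnd ℂ) (F p.2))
      ∂((mu lam).prod (mu lam))‖ ≤ ∫ x, ‖F x‖ ^ 2 ∂(mu lam) := by
  have hF2 : Integrable (fun x => ‖F x‖ ^ 2) (mu lam) := hF.integrable_norm_pow two_ne_zero
  have hWm := (continuous_heatSeries hlam t).measurable
  have hI : Integrable (fun p : EuclideanSpace ℝ (Fin n) × EuclideanSpace ℝ (Fin n) =>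
      ‖F p.1‖ ^ 2 * heatSeries lam t p.1 p.2) ((mu lam).prod (mu lam)) := by
    have hm : AEStronglyMeasurable (fun p : EuclideanSpace ℝ (Fin n) × EuclideanSpace ℝ (Fin n) =>
        ‖F p.1‖ ^ 2 * heatSeries lam t p.1 p.2) ((mu lam).prod (mu lam)) :=
      hF2.1.comp_fst.mul hWm.aestronglyMeasurable
    rw [integrable_prod_iff hm]
    refine ⟨Eventually.of_forall fun x =>
      (integral_heatSeries hlam ht x).1.const_mul (‖F x‖ ^ 2), ?_⟩
    refine hF2.congr (Eventually.of_forall fun x => ?_)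
    have : ∀ y, ‖‖F x‖ ^ 2 * heatSeries lam t x y‖ = ‖F x‖ ^ 2 * heatSeries lam t x y := fun y =>
      Real.norm_of_nonneg (mul_nonneg (sq_nonneg _) (heatSeries_nonneg hlam ht x y))
    simp only [this]
    rw [integral_const_mul, (integral_heatSeries hlam ht x).2, mul_one]
  have hIv : ∫ p, ‖F p.1‖ ^ 2 * heatSeries lam t p.1 p.2 ∂((mu lam).prod (mu lam)) =
      ∫ x, ‖F x‖ ^ 2 ∂(mu lam) := by
    rw [integral_prod _ hI]
    refine integral_congr_ae (Eventually.of_forall fun x => ?_)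
    dsimp only
    rw [integral_const_mul, (integral_heatSeries hlam ht x).2, mul_one]
  have hI' := hI.swap
  have hIv' : ∫ p, ‖F p.2‖ ^ 2 * heatSeries lam t p.2 p.1 ∂((mu lam).prod (mu lam)) =
      ∫ x, ‖F x‖ ^ 2 ∂(mu lam) := by
    rw [← hIv, ← integral_prod_swap]
    rfl
  have hbd := (hI.add hI').const_mul (1 / 2)
  refine (norm_integral_le_of_norm_le hbd (Eventually.of_forall fun p => ?_)).trans ?_
  · have h1 := heatSeries_nonneg hlam ht p.1 p.2
    have h2 : ‖F p.1‖ * ‖F p.2‖ ≤ 1 / 2 * (‖F p.1‖ ^ 2 + ‖F p.2‖ ^ 2) := by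
      nlinarith [sq_nonneg (‖F p.1‖ - ‖F p.2‖)]
    simp only [norm_mul, Complex.norm_real, RCLike.norm_conj, Pi.add_apply, Function.comp, Prod.swap]
    rw [Real.norm_of_nonneg h1, heatSeries_symm lam t p.2 p.1]
    calc _ ≤ heatSeries lam t p.1 p.2 * (1 / 2 * (‖F p.1‖ ^ 2 + ‖F p.2‖ ^ 2)) := by gcongr
      _ = _ := by ring
  · rw [integral_const_mul, integral_add' hI hI', hIv]
    change 1 / 2 * (_ + ∫ p, ‖F p.2‖ ^ 2 * heatSeries lam t p.2 p.1 ∂((mu lam).prod (mu lam))) ≤ _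
    rw [hIv']
    linarith

/-- The Hankel transformation does not increase the `L²` norm. -/
lemma eLpNorm_hankel_le {lam : Fin n → ℝ} (hlam : ∀ j, -1 / 2 < lam j) {k : ℕ}
    {F : EuclideanSpace ℝ (Fin n) → ℂ} (hF : BoxIntegrable lam k F) (hF2 : MemLp F 2 (mu lam)) :
    eLpNorm (hankel lam F) 2 (mu lam) ≤ eLpNorm F 2 (mu lam) := by
  have hFc : BoxIntegrable lam k (fun x => (starRingEnd ℂ) (F x)) :=
    ⟨(LinearIsometryEquiv.integrable_comp_iff Complex.conjLIE).2 hF.1,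
      hF.2.mono fun y hy h => by simp [hy h]⟩
  have hsq : Integrable (fun x => ‖F x‖ ^ 2) (mu lam) := hF2.integrable_norm_pow two_ne_zero
  have hm := aestronglyMeasurable_hankel hlam hF.1.1
  set g : ℝ → EuclideanSpace ℝ (Fin n) → ℝ := fun t y =>
    Real.exp (-t * ∑ j, y j ^ 2) * ‖hankel lam F y‖ ^ 2 with hg
  have hreg : ∀ t, 0 < t → ∫⁻ y, ENNReal.ofReal (g t y) ∂(mu lam) ≤
      ENNReal.ofReal (∫ x, ‖F x‖ ^ 2 ∂(mu lam)) := by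
    intro t ht
    obtain ⟨h1, h2⟩ := integral_exp_mul_hankel_mul_hankel hlam hF hFc ht
    have e : ∀ y, (Real.exp (-t * ∑ j, y j ^ 2) : ℂ) *
        (hankel lam F y * hankel lam (fun x => (starRingEnd ℂ) (F x)) y) = (g t y : ℂ) := by
      intro y
      rw [hankel_conj, Complex.mul_conj, Complex.normSq_eq_norm_sq]
      simp [hg]
    simp only [e] at h1 h2
    have h3 : Integrable (g t) (mu lam) := by simpa using h1.re
    have h0 : ∀ y, 0 ≤ g t y := fun y => by simp only [hg]; positivity
    rw [← ofReal_integral_eq_lintegral_ofReal h3 (Eventually.of_forall h0)]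
    refine ENNReal.ofReal_le_ofReal ?_
    have h4 := norm_integral_heatSeries_le hlam ht hF2
    rw [← h2, integral_complex_ofReal, Complex.norm_real] at h4
    exact (le_abs_self _).trans h4
  have hlim : ∀ y, Tendsto (fun m : ℕ => ENNReal.ofReal (g (1 / ((m : ℝ) + 1)) y)) atTop
      (𝓝 (ENNReal.ofReal (‖hankel lam F y‖ ^ 2))) := by
    intro y
    refine ENNReal.tendsto_ofReal ?_
    have h1 : Tendsto (fun m : ℕ => Real.exp (-(1 / ((m : ℝ) + 1)) * ∑ j, y j ^ 2) *
        ‖hankel lam F y‖ ^ 2) atTop (𝓝 (Real.exp (-0 * ∑ j, y j ^ 2) * ‖hankel lam F y‖ ^ 2)) :=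
      ((Real.continuous_exp.tendsto _).comp
        (tendsto_one_div_add_atTop_nhds_zero_nat.neg.mul_const _)).mul_const _
    simpa only [hg, neg_zero, zero_mul, Real.exp_zero, one_mul] using h1
  -- the regularized norms are bounded uniformly in the regularization
  have hfatou : ∫⁻ y, ENNReal.ofReal (‖hankel lam F y‖ ^ 2) ∂(mu lam) ≤
      ENNReal.ofReal (∫ x, ‖F x‖ ^ 2 ∂(mu lam)) := by
    calc _ = ∫⁻ y, liminf (fun m : ℕ => ENNReal.ofReal (g (1 / ((m : ℝ) + 1)) y)) atTop ∂(mu lam) :=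
          lintegral_congr fun y => (hlim y).liminf_eq.symm
      _ ≤ liminf (fun m : ℕ => ∫⁻ y, ENNReal.ofReal (g (1 / ((m : ℝ) + 1)) y) ∂(mu lam)) atTop := by
          refine lintegral_liminf_le' fun m => ?_
          refine (AEMeasurable.mul (Measurable.aemeasurable (by fun_prop)) ?_).ennreal_ofReal
          exact (hm.norm.aemeasurable).pow_const 2
      _ ≤ _ := by
          refine (liminf_le_liminf (v := fun _ => ENNReal.ofReal (∫ x, ‖F x‖ ^ 2 ∂(mu lam)))
            (Eventually.of_forall fun m => hreg _ (by positivity))).trans ?_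
          simp
  rw [ofReal_integral_eq_lintegral_ofReal hsq (Eventually.of_forall fun _ => sq_nonneg _)] at hfatou
  rw [eLpNorm_eq_lintegral_rpow_enorm_toReal two_ne_zero ENNReal.ofNat_ne_top,
    eLpNorm_eq_lintegral_rpow_enorm_toReal two_ne_zero ENNReal.ofNat_ne_top]
  refine ENNReal.rpow_le_rpow ?_ (by simp)
  have e : ∀ z : ℂ, ‖z‖ₑ ^ (2 : ℝ≥0∞).toReal = ENNReal.ofReal (‖z‖ ^ 2) := by
    intro z
    rw [ENNReal.toReal_ofNat, ENNReal.rpow_two, ENNReal.ofReal_pow (norm_nonneg _), ofReal_norm]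
  simp only [e]
  exact hfatou

/-! ### The Hankel transformation on `L²` -/

lemma boxIntegrable_of_memLp {lam : Fin n → ℝ} {k : ℕ} {F : EuclideanSpace ℝ (Fin n) → ℂ}
    (hF : MemLp F 2 (mu lam)) (h0 : ∀ᵐ y ∂(mu lam), y ∉ box n k → F y = 0) :
    BoxIntegrable lam k F := by
  have hK := isCompact_box n k
  refine ⟨?_, h0⟩
  have : IsFiniteMeasure ((mu lam).restrict (box n k)) :=
    ⟨by simpa using mu_lt_top lam hK (box_subset n k)⟩
  have h1 : IntegrableOn F (box n k) (mu lam) := (hF.restrict (box n k)).integrable one_le_two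
  refine ((integrable_indicator_iff hK.measurableSet).2 h1).congr ?_
  filter_upwards [h0] with y hy
  by_cases h : y ∈ box n k
  · rw [indicator_of_mem h]
  · rw [indicator_of_notMem h, hy h]

lemma exists_boxIntegrable {lam : Fin n → ℝ} {F : Lp ℂ 2 (mu lam)} (hF : F ∈ compactL2 lam) :
    ∃ k, BoxIntegrable lam k F := by
  obtain ⟨K, hK, hKo, hF0⟩ := hF
  obtain ⟨k, hk⟩ := exists_subset_box hK hKo
  exact ⟨k, boxIntegrable_of_memLp (Lp.memLp F) (hF0.mono fun y hy h => hy fun h' => h (hk h'))⟩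

lemma BoxIntegrable.mono {lam : Fin n → ℝ} {k l : ℕ} (hkl : k ≤ l)
    {F : EuclideanSpace ℝ (Fin n) → ℂ} (hF : BoxIntegrable lam k F) : BoxIntegrable lam l F :=
  ⟨hF.1, hF.2.mono fun _ hy h => hy fun h' => h (box_mono n hkl h')⟩

lemma memLp_hankel_of_boxIntegrable {lam : Fin n → ℝ} (hlam : ∀ j, -1 / 2 < lam j) {k : ℕ}
    {F : EuclideanSpace ℝ (Fin n) → ℂ} (hF : BoxIntegrable lam k F) (hF2 : MemLp F 2 (mu lam)) :
    MemLp (hankel lam F) 2 (mu lam) :=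
  ⟨aestronglyMeasurable_hankel hlam hF.1.1, (eLpNorm_hankel_le hlam hF hF2).trans_lt hF2.2⟩

lemma memLp_hankel {lam : Fin n → ℝ} (hlam : ∀ j, -1 / 2 < lam j) {F : Lp ℂ 2 (mu lam)}
    (hF : F ∈ compactL2 lam) : MemLp (hankel lam F) 2 (mu lam) := by
  obtain ⟨k, hk⟩ := exists_boxIntegrable hF
  exact memLp_hankel_of_boxIntegrable hlam hk (Lp.memLp F)

lemma coeFn_hankelCore {lam : Fin n → ℝ} (hlam : ∀ j, -1 / 2 < lam j) (F : compactL2 lam) :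
    hankelCore lam F =ᵐ[mu lam] hankel lam (F : Lp ℂ 2 (mu lam)) := by
  unfold hankelCore
  rw [dif_pos (memLp_hankel hlam F.2)]
  exact MemLp.coeFn_toLp _

lemma sub_mem_compactL2 {lam : Fin n → ℝ} {F G : Lp ℂ 2 (mu lam)} (hF : F ∈ compactL2 lam)
    (hG : G ∈ compactL2 lam) : F - G ∈ compactL2 lam := by
  obtain ⟨K, hK, hKo, hF0⟩ := hF
  obtain ⟨K', hK', hKo', hG0⟩ := hG
  refine ⟨K ∪ K', hK.union hK', union_subset hKo hKo', ?_⟩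
  filter_upwards [hF0, hG0, Lp.coeFn_sub F G] with y h1 h2 h3 hy
  rw [h3, Pi.sub_apply, h1 fun h => hy (Or.inl h), h2 fun h => hy (Or.inr h), sub_zero]

lemma integrable_hankelSeries_mul {lam : Fin n → ℝ} (hlam : ∀ j, -1 / 2 < lam j) {k : ℕ}
    {F : EuclideanSpace ℝ (Fin n) → ℂ} (hF : BoxIntegrable lam k F)
    {y : EuclideanSpace ℝ (Fin n)} (hy : y ∈ orthant n) :
    Integrable (fun x => (hankelSeries lam x y : ℂ) * F x) (mu lam) := by
  obtain ⟨b, hbm, hb0, hb, hbi⟩ := exists_hankelSeries_bound hlam k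
  refine (hF.1.norm.const_mul (b y)).mono' ((aestronglyMeasurable_hankelSeries hlam _
    measurable_id measurable_const).mul hF.1.1) ?_
  filter_upwards [hF.2] with x hx
  by_cases h : x ∈ box n k
  · rw [norm_mul, Complex.norm_real]
    gcongr
    exact hb x h y hy
  · simp [hx h]

lemma lipschitzWith_hankelCore {lam : Fin n → ℝ} (hlam : ∀ j, -1 / 2 < lam j) :
    LipschitzWith 1 (hankelCore lam) := by
  refine LipschitzWith.of_dist_le_mul fun F G => ?_
  rw [NNReal.coe_one, one_mul, dist_eq_norm, Subtype.dist_eq, dist_eq_norm]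
  obtain ⟨k₁, hk₁⟩ := exists_boxIntegrable F.2
  obtain ⟨k₂, hk₂⟩ := exists_boxIntegrable G.2
  have hsub := sub_mem_compactL2 F.2 G.2
  obtain ⟨k, hk⟩ := exists_boxIntegrable hsub
  have h1 : (hankelCore lam F - hankelCore lam G : Lp ℂ 2 (mu lam)) =ᵐ[mu lam]
      hankel lam ((F : Lp ℂ 2 (mu lam)) - (G : Lp ℂ 2 (mu lam)) : Lp ℂ 2 (mu lam)) := by
    rw [hankel_congr_ae (Lp.coeFn_sub (F : Lp ℂ 2 (mu lam)) (G : Lp ℂ 2 (mu lam)))]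
    filter_upwards [Lp.coeFn_sub (hankelCore lam F) (hankelCore lam G), coeFn_hankelCore hlam F,
      coeFn_hankelCore hlam G, ae_mem_orthant lam] with y e1 e2 e3 hy
    rw [e1, Pi.sub_apply, e2, e3, hankel_eq lam _ hy, hankel_eq lam _ hy, hankel_eq lam _ hy,
      ← integral_sub (integrable_hankelSeries_mul hlam hk₁ hy)
        (integrable_hankelSeries_mul hlam hk₂ hy)]
    simp only [Pi.sub_apply, mul_sub]
  rw [Lp.norm_def, Lp.norm_def, eLpNorm_congr_ae h1]
  exact ENNReal.toReal_mono (Lp.memLp _).2.ne (eLpNorm_hankel_le hlam hk (Lp.memLp _))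

lemma continuous_hankelL2 {lam : Fin n → ℝ} (hlam : ∀ j, -1 / 2 < lam j) :
    Continuous (hankelL2 lam) :=
  ((dense_compactL2 lam).uniformContinuous_extend
    (lipschitzWith_hankelCore hlam).uniformContinuous).continuous

lemma coeFn_hankelL2 {lam : Fin n → ℝ} (hlam : ∀ j, -1 / 2 < lam j) {F : Lp ℂ 2 (mu lam)}
    (hF : F ∈ compactL2 lam) : hankelL2 lam F =ᵐ[mu lam] hankel lam F := by
  have h := (dense_compactL2 lam).extend_of_ind
    (lipschitzWith_hankelCore hlam).uniformContinuous ⟨F, hF⟩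
  have h2 := coeFn_hankelCore hlam ⟨F, hF⟩
  rw [← h] at h2
  exact h2

lemma continuous_integral_mul {lam : Fin n → ℝ} {G : EuclideanSpace ℝ (Fin n) → ℂ}
    (hG : MemLp G 2 (mu lam)) :
    Continuous fun F : Lp ℂ 2 (mu lam) => ∫ y, F y * G y ∂(mu lam) := by
  have hGc : MemLp (fun y => (starRingEnd ℂ) (G y)) 2 (mu lam) := hG.star
  have h : ∀ F : Lp ℂ 2 (mu lam), ∫ y, F y * G y ∂(mu lam) = inner ℂ hGc.toLp F := by
    intro F
    rw [L2.inner_def]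
    refine integral_congr_ae ?_
    filter_upwards [hGc.coeFn_toLp] with y hy
    rw [hy]
    simp [RCLike.inner_apply]
  simp only [h]
  exact continuous_const.inner continuous_id

/-- The Hankel transformation is symmetric. -/
lemma integral_hankelL2_mul {lam : Fin n → ℝ} (hlam : ∀ j, -1 / 2 < lam j) (F : Lp ℂ 2 (mu lam))
    {G : Lp ℂ 2 (mu lam)} (hG : G ∈ compactL2 lam) :
    ∫ y, hankelL2 lam F y * G y ∂(mu lam) = ∫ y, F y * hankel lam G y ∂(mu lam) := by
  refine (dense_compactL2 lam).induction (P := fun F => ∫ y, hankelL2 lam F y * G y ∂(mu lam) =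
    ∫ y, F y * hankel lam G y ∂(mu lam)) ?_ ?_ F
  · intro F hF
    obtain ⟨k₁, hk₁⟩ := exists_boxIntegrable hF
    obtain ⟨k₂, hk₂⟩ := exists_boxIntegrable hG
    have hF' := hk₁.mono (le_max_left k₁ k₂)
    have hG' := hk₂.mono (le_max_right k₁ k₂)
    set k := max k₁ k₂
    obtain ⟨M, hM⟩ := ((isCompact_box n k).prod (isCompact_box n k)).exists_bound_of_continuousOn
      (continuous_hankelSeries hlam).continuousOn
    have hint : Integrable (fun p : EuclideanSpace ℝ (Fin n) × EuclideanSpace ℝ (Fin n) =>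
        (hankelSeries lam p.1 p.2 : ℂ) * (F p.1 * G p.2)) ((mu lam).prod (mu lam)) := by
      have h1 : ∀ᵐ p ∂((mu lam).prod (mu lam)), p.1 ∉ box n k → F p.1 = 0 :=
        Measure.quasiMeasurePreserving_fst.ae hF'.2
      have h2 : ∀ᵐ p ∂((mu lam).prod (mu lam)), p.2 ∉ box n k → G p.2 = 0 :=
        Measure.quasiMeasurePreserving_snd.ae hG'.2
      refine ((hF'.1.mul_prod hG'.1).norm.const_mul M).mono'
        ((measurable_hankelSeries hlam).aestronglyMeasurable.mul (hF'.1.mul_prod hG'.1).1) ?_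
      filter_upwards [h1, h2] with p a1 a2
      by_cases b1 : p.1 ∈ box n k
      · by_cases b2 : p.2 ∈ box n k
        · rw [norm_mul, Complex.norm_real]
          gcongr
          exact hM p ⟨b1, b2⟩
        · simp [a2 b2]
      · simp [a1 b1]
    have e1 : ∫ y, hankelL2 lam F y * G y ∂(mu lam) =
        ∫ y, ∫ x, (hankelSeries lam x y : ℂ) * (F x * G y) ∂(mu lam) ∂(mu lam) := by
      refine integral_congr_ae ?_
      filter_upwards [coeFn_hankelL2 hlam hF, ae_mem_orthant lam] with y hy1 hy2
      rw [hy1, hankel_eq lam _ hy2, ← integral_mul_const]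
      simp only [mul_assoc]
    have e2 : ∫ x, F x * hankel lam G x ∂(mu lam) =
        ∫ x, ∫ y, (hankelSeries lam x y : ℂ) * (F x * G y) ∂(mu lam) ∂(mu lam) := by
      refine integral_congr_ae ?_
      filter_upwards [ae_mem_orthant lam] with x hx
      rw [hankel_eq lam _ hx, ← integral_const_mul]
      refine integral_congr_ae (Eventually.of_forall fun y => ?_)
      dsimp only
      rw [hankelSeries_symm]
      ring
    rw [e1, e2]
    exact (integral_integral_swap hint).symm
  · exact isClosed_eq ((continuous_integral_mul (Lp.memLp G)).comp (continuous_hankelL2 hlam))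
      (continuous_integral_mul (memLp_hankel hlam hG))

/-! ### The kernel near and away from the diagonal -/

/-- The function `y ↦ f(y) ∏ⱼ (yⱼ/xⱼ)^λⱼ`, against which `heatDensity` has to be integrated to give
the heat semigroup of the Bessel operator at the point `x`. -/
noncomputable def localDensity (lam : Fin n → ℝ) (f : EuclideanSpace ℝ (Fin n) → ℂ)
    (x y : EuclideanSpace ℝ (Fin n)) : ℂ :=
  f y * ratio lam x y

lemma measurable_localDensity (lam : Fin n → ℝ) {f : EuclideanSpace ℝ (Fin n) → ℂ}
    (hf : Continuous f) : Measurable fun p : EuclideanSpace ℝ (Fin n) × EuclideanSpace ℝ (Fin n) =>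
      localDensity lam f p.1 p.2 :=
  (hf.measurable.comp measurable_snd).mul (Complex.measurable_ofReal.comp (measurable_ratio lam))

lemma localDensity_self (lam : Fin n → ℝ) (f : EuclideanSpace ℝ (Fin n) → ℂ)
    {x : EuclideanSpace ℝ (Fin n)} (hx : x ∈ orthant n) : localDensity lam f x x = f x := by
  have : ratio lam x x = 1 := by
    unfold ratio
    refine Finset.prod_eq_one fun j _ => ?_
    rw [div_self (hx j).ne', Real.one_rpow]
  simp [localDensity, this]

lemma localDensity_eq_zero (lam : Fin n → ℝ) {f : EuclideanSpace ℝ (Fin n) → ℂ} {k : ℕ}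
    (hfk : tsupport f ⊆ box n k) (x : EuclideanSpace ℝ (Fin n)) {y : EuclideanSpace ℝ (Fin n)}
    (hy : y ∉ box n k) : localDensity lam f x y = 0 := by
  rw [localDensity, image_eq_zero_of_notMem_tsupport fun h => hy (hfk h), zero_mul]

lemma contDiff_mul_prod_rpow (lam : Fin n → ℝ) {f : EuclideanSpace ℝ (Fin n) → ℂ}
    (hf : ContDiff ℝ 1 f) {k : ℕ} (hfk : tsupport f ⊆ box n k) :
    ContDiff ℝ 1 fun y => f y * ((∏ j, y j ^ lam j : ℝ) : ℂ) := by
  refine contMDiff_iff_contDiff.1 (contMDiff_of_tsupport fun y hy => ContDiffAt.contMDiffAt ?_)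
  have hy' : y ∈ orthant n := box_subset n k (hfk ((tsupport_mul_subset_left) hy))
  have h : ContDiffAt ℝ 1 (fun y : EuclideanSpace ℝ (Fin n) => ∏ j, y j ^ lam j) y := by
    refine contDiffAt_prod (𝕜 := ℝ) fun j _ => ?_
    refine ContDiffAt.rpow_const_of_ne ?_ (hy' j).ne'
    exact (EuclideanSpace.proj (𝕜 := ℝ) j).contDiff.contDiffAt
  exact hf.contDiffAt.mul (Complex.ofRealCLM.contDiff.contDiffAt.comp y h)

/-- The density is the product of a function of `x` with the function `f(y) ∏ⱼ yⱼ^λⱼ`, which is `C¹`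
with compact support; this makes it Lipschitz in `y`, uniformly in `x`. -/
lemma exists_localDensity_lipschitz (lam : Fin n → ℝ) {f : EuclideanSpace ℝ (Fin n) → ℂ}
    (hf : ContDiff ℝ 1 f) {k : ℕ} (hfk : tsupport f ⊆ box n k) :
    ∃ M, 0 ≤ M ∧ ∀ x ∈ box n k, ∀ y, ‖localDensity lam f x y‖ ≤ M ∧
      ‖localDensity lam f x y - localDensity lam f x x‖ ≤ M * ‖y - x‖ := by
  set h : EuclideanSpace ℝ (Fin n) → ℂ := fun y => f y * ((∏ j, y j ^ lam j : ℝ) : ℂ) with hh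
  have hcf : HasCompactSupport f := (isCompact_box n k).of_isClosed_subset (isClosed_tsupport f) hfk
  have hch : HasCompactSupport h := hcf.mul_right
  have hcd : ContDiff ℝ 1 h := contDiff_mul_prod_rpow lam hf hfk
  obtain ⟨L, hL⟩ := hcd.lipschitzWith_of_hasCompactSupport hch one_ne_zero
  obtain ⟨D, hD⟩ := hcd.continuous.bounded_above_of_compact_support hch
  have hcont : ContinuousOn (fun x : EuclideanSpace ℝ (Fin n) => ∏ j, x j ^ (-lam j)) (box n k) := by
    refine continuousOn_finsetProd _ fun j _ => ?_
    refine ContinuousOn.rpow_const (by fun_prop) fun x hx => Or.inl (ne_of_gt (box_subset n k hx j))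
  obtain ⟨R, hR⟩ := (isCompact_box n k).exists_bound_of_continuousOn hcont
  have heq : ∀ x ∈ box n k, ∀ y,
      localDensity lam f x y = h y * ((∏ j, x j ^ (-lam j) : ℝ) : ℂ) := by
    intro x hx y
    by_cases hy : y ∈ box n k
    · simp only [localDensity, hh, mul_assoc]
      rw [← Complex.ofReal_mul, ← Finset.prod_mul_distrib, ratio]
      congr 2
      refine Finset.prod_congr rfl fun j _ => ?_
      rw [Real.div_rpow (box_subset n k hy j).le (box_subset n k hx j).le,
        Real.rpow_neg (box_subset n k hx j).le, div_eq_mul_inv]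
    · rw [localDensity_eq_zero lam hfk x hy, hh]
      simp [image_eq_zero_of_notMem_tsupport fun h => hy (hfk h)]
  refine ⟨|D| * |R| + L * |R|, by positivity, fun x hx y => ?_⟩
  have hRx : ‖((∏ j, x j ^ (-lam j) : ℝ) : ℂ)‖ ≤ |R| := by
    rw [Complex.norm_real]; exact (hR x hx).trans (le_abs_self _)
  rw [heq x hx y, heq x hx x]
  constructor
  · rw [norm_mul]
    have : ‖h y‖ * ‖((∏ j, x j ^ (-lam j) : ℝ) : ℂ)‖ ≤ |D| * |R| := by
      gcongr
      exact (hD y).trans (le_abs_self _)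
    have h2 : 0 ≤ (L : ℝ) * |R| := by positivity
    linarith
  · rw [← sub_mul, norm_mul]
    have h1 := hL.dist_le_mul y x
    rw [dist_eq_norm, dist_eq_norm] at h1
    calc _ ≤ (L * ‖y - x‖) * |R| := by gcongr
      _ ≤ _ := by
        have h2 : 0 ≤ |D| * |R| * ‖y - x‖ := by positivity
        linarith

/-- The integrand that defines the time derivative of the heat semigroup, compared with the
Euclidean one for small times. -/
lemma exists_localDensity_mul_bounds {lam : Fin n → ℝ} (hlam : ∀ j, -1 / 2 < lam j)
    {f : EuclideanSpace ℝ (Fin n) → ℂ} (hf : ContDiff ℝ 1 f) {k : ℕ} (hfk : tsupport f ⊆ box n k) :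
    ∃ C, 0 ≤ C ∧ ∀ x ∈ box n k, ∀ y,
      (∀ t, 0 < t → t ≤ 1 →
        ‖localDensity lam f x y * heatDensityDeriv lam x y t -
          localDensity lam f x x * gaussDeriv n t (y - x)‖ ≤
            C * (gauss n (2 * t) (y - x) + (√t)⁻¹ * gauss n (4 * t) (y - x)) ∧
        ‖localDensity lam f x y * heatDensityDeriv lam x y t‖ ≤
          C * (box n k).indicator 1 y * (t⁻¹ * gauss n (2 * t) (y - x))) ∧
      ∀ t, 1 ≤ t → ‖localDensity lam f x y * heatDensityDeriv lam x y t‖ ≤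
        C * (box n k).indicator 1 y * t ^ (-1 - decayExponent lam) := by
  obtain ⟨M, hM0, hM⟩ := exists_localDensity_lipschitz lam hf hfk
  obtain ⟨C, hC0, hC⟩ := exists_heatDensityDeriv_bounds hlam k
  set c := derivConst n * (9 * doublingConst n) * 2
  have hc0 : 0 ≤ c := by
    have := derivConst_pos n
    have := doublingConst_pos n
    positivity
  refine ⟨M * C + M * c, by positivity, fun x hx y => ⟨fun t ht ht1 => ?_, fun t ht => ?_⟩⟩
  · have hg2 := gauss_nonneg (n := n) (t := 2 * t) (by linarith) (y - x)
    have hg4 := gauss_nonneg (n := n) (t := 4 * t) (by linarith) (y - x)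
    have hlip : ‖localDensity lam f x y - localDensity lam f x x‖ * |gaussDeriv n t (y - x)| ≤
        M * c * ((√t)⁻¹ * gauss n (4 * t) (y - x)) :=
      calc _ ≤ M * ‖y - x‖ * |gaussDeriv n t (y - x)| := by gcongr; exact (hM x hx y).2
        _ = M * (‖y - x‖ * |gaussDeriv n t (y - x)|) := by ring
        _ ≤ M * (c * (√t)⁻¹ * gauss n (4 * t) (y - x)) :=
            mul_le_mul_of_nonneg_left (norm_mul_abs_gaussDeriv_le ht _) hM0
        _ = _ := by ring
    constructor
    · have hmain : ‖localDensity lam f x y * (heatDensityDeriv lam x y t - gaussDeriv n t (y - x))‖ ≤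
          M * C * gauss n (2 * t) (y - x) := by
        by_cases hy : y ∈ box n k
        · rw [norm_mul, ← Complex.ofReal_sub, Complex.norm_real, mul_assoc]
          gcongr
          · exact (hM x hx y).1
          · exact ((hC x hx y hy).1 t ht ht1).1
        · rw [localDensity_eq_zero lam hfk x hy, zero_mul, norm_zero]
          positivity
      calc _ = ‖localDensity lam f x y * (heatDensityDeriv lam x y t - gaussDeriv n t (y - x)) +
            (localDensity lam f x y - localDensity lam f x x) * gaussDeriv n t (y - x)‖ := by
              congr 1; ring
        _ ≤ M * C * gauss n (2 * t) (y - x) + M * c * ((√t)⁻¹ * gauss n (4 * t) (y - x)) := by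
          refine (norm_add_le _ _).trans (add_le_add hmain ?_)
          rw [norm_mul, Complex.norm_real]
          exact hlip
        _ ≤ _ := by
          have h1 : 0 ≤ M * C * ((√t)⁻¹ * gauss n (4 * t) (y - x)) := by positivity
          have h2 : 0 ≤ M * c * gauss n (2 * t) (y - x) := by positivity
          linarith
    · by_cases hy : y ∈ box n k
      · rw [norm_mul, Complex.norm_real, indicator_of_mem hy, Pi.one_apply, mul_one]
        calc _ ≤ M * (C * (t⁻¹ * gauss n (2 * t) (y - x))) := by
              gcongr
              · exact (hM x hx y).1
              · exact ((hC x hx y hy).1 t ht ht1).2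
          _ ≤ _ := by
            have h2 : 0 ≤ M * c * (t⁻¹ * gauss n (2 * t) (y - x)) := by positivity
            linarith
      · simp [localDensity_eq_zero lam hfk x hy, hy]
  · by_cases hy : y ∈ box n k
    · rw [norm_mul, Complex.norm_real, indicator_of_mem hy, Pi.one_apply, mul_one]
      have hp : 0 ≤ t ^ (-1 - decayExponent lam) := by positivity
      calc _ ≤ M * (C * t ^ (-1 - decayExponent lam)) := by
            gcongr
            · exact (hM x hx y).1
            · exact (hC x hx y hy).2 t ht
        _ ≤ _ := by
          have h2 : 0 ≤ M * c * t ^ (-1 - decayExponent lam) := by positivity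
          linarith
    · simp [localDensity_eq_zero lam hfk x hy, hy]

/-- The function `t^(-1/2)` for small and `t^(-1-κ)` for large times. -/
noncomputable def timeMajorant (κ t : ℝ) : ℝ :=
  if t ≤ 1 then t ^ (-(1 : ℝ) / 2) else t ^ (-1 - κ)

lemma timeMajorant_nonneg {κ t : ℝ} (ht : 0 < t) : 0 ≤ timeMajorant κ t := by
  unfold timeMajorant; split_ifs <;> positivity

lemma timeMajorant_of_le {κ t : ℝ} (ht : t ≤ 1) : timeMajorant κ t = t ^ (-(1 : ℝ) / 2) :=
  if_pos ht

lemma one_le_timeMajorant {κ t : ℝ} (h0 : 0 < t) (ht : t ≤ 1) : 1 ≤ timeMajorant κ t := by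
  rw [timeMajorant_of_le ht]
  exact Real.one_le_rpow_of_pos_of_le_one_of_nonpos h0 ht (by norm_num)

lemma inv_sqrt_eq_timeMajorant {κ t : ℝ} (h0 : 0 < t) (ht : t ≤ 1) :
    (√t)⁻¹ = timeMajorant κ t := by
  rw [timeMajorant_of_le ht, Real.sqrt_eq_rpow, ← Real.rpow_neg h0.le]
  norm_num

lemma rpow_le_timeMajorant {κ κ' t : ℝ} (h : κ ≤ κ') (ht : 1 ≤ t) :
    t ^ (-1 - κ') ≤ timeMajorant κ t := by
  unfold timeMajorant
  split_ifs with h1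
  · obtain rfl : t = 1 := le_antisymm h1 ht
    simp
  · exact Real.rpow_le_rpow_of_exponent_le ht (by linarith)

lemma integrableOn_timeMajorant {κ : ℝ} (hκ : 0 < κ) : IntegrableOn (timeMajorant κ) (Ioi 0) := by
  have hm : Measurable (timeMajorant κ) :=
    Measurable.ite measurableSet_Iic (by fun_prop) (by fun_prop)
  refine integrableOn_of_abs_le_rpow (C := 1) hm.aestronglyMeasurable hκ (fun t h0 h1 => ?_)
    fun t h1 => ?_
  · rw [timeMajorant_of_le h1, one_mul, abs_of_nonneg (by positivity)]
  · rw [abs_of_nonneg (timeMajorant_nonneg (by linarith)), one_mul]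
    unfold timeMajorant
    split_ifs with h2
    · obtain rfl : t = 1 := le_antisymm h2 h1
      simp
    · exact le_rfl

/-- The smaller one of the rates at which the Bessel and the Euclidean heat kernels decay. -/
noncomputable def commonDecay (lam : Fin n → ℝ) : ℝ := min (decayExponent lam) (n / 2)

lemma commonDecay_pos (hn : 1 ≤ n) {lam : Fin n → ℝ} (hlam : ∀ j, -1 / 2 < lam j) :
    0 < commonDecay lam := by
  have : (0 : ℝ) < n := by exact_mod_cast hn
  exact lt_min (decayExponent_pos hn hlam) (by positivity)

/-- Away from the diagonal, the kernel has an integrable majorant in time. -/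
lemma exists_heatDensityDeriv_le_timeMajorant {lam : Fin n → ℝ} (hlam : ∀ j, -1 / 2 < lam j)
    (k : ℕ) {ε : ℝ} (hε : 0 < ε) :
    ∃ C, 0 ≤ C ∧ ∀ x ∈ box n k, ∀ y ∈ box n k, ε ≤ ‖y - x‖ → ∀ t, 0 < t →
      |heatDensityDeriv lam x y t| ≤ C * timeMajorant (commonDecay lam) t := by
  obtain ⟨C, hC0, hC⟩ := exists_heatDensityDeriv_bounds hlam k
  obtain ⟨D, hD0, hD⟩ := exists_inv_mul_gauss_le n hε
  refine ⟨C * D + C, by positivity, fun x hx y hy hxy t ht => ?_⟩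
  have hm := timeMajorant_nonneg (κ := commonDecay lam) ht
  rcases le_total t 1 with h1 | h1
  · refine (((hC x hx y hy).1 t ht h1).2).trans ?_
    calc _ ≤ C * D := by gcongr; exact hD t ht h1 _ hxy
      _ ≤ (C * D + C) * 1 := by linarith
      _ ≤ _ := by gcongr; exact one_le_timeMajorant ht h1
  · refine ((hC x hx y hy).2 t h1).trans ?_
    have h2 := rpow_le_timeMajorant (min_le_left _ _ : commonDecay lam ≤ decayExponent lam) h1
    calc _ ≤ C * timeMajorant (commonDecay lam) t :=
          mul_le_mul_of_nonneg_left h2 hC0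
      _ ≤ _ := by
        have : 0 ≤ C * D * timeMajorant (commonDecay lam) t := by positivity
        linarith

lemma exists_subset_box_pair {x y : EuclideanSpace ℝ (Fin n)} (hx : x ∈ orthant n)
    (hy : y ∈ orthant n) : ∃ k, x ∈ box n k ∧ y ∈ box n k :=
  ((eventually_mem_box hx).and (eventually_mem_box hy)).exists

lemma exists_ae_norm_le {φ : ℝ → ℂ} (hφ : MemLp φ ∞ (volume.restrict (Ioi 0))) :
    ∃ B, 0 ≤ B ∧ ∀ᵐ t ∂(volume.restrict (Ioi (0 : ℝ))), ‖φ t‖ ≤ B := by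
  refine ⟨(eLpNorm φ ∞ (volume.restrict (Ioi 0))).toReal, ENNReal.toReal_nonneg, ?_⟩
  filter_upwards [ae_le_eLpNormEssSup (f := φ) (μ := volume.restrict (Ioi (0 : ℝ)))] with t ht
  rw [eLpNorm_exponent_top, ← toReal_enorm]
  refine ENNReal.toReal_mono ?_ ht
  rw [← eLpNorm_exponent_top]
  exact hφ.2.ne

lemma integrableOn_kernelIntegrand (hn : 1 ≤ n) {lam : Fin n → ℝ} (hlam : ∀ j, -1 / 2 < lam j)
    {φ : ℝ → ℂ} (hφ : MemLp φ ∞ (volume.restrict (Ioi 0))) {x y : EuclideanSpace ℝ (Fin n)}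
    (hx : x ∈ orthant n) (hy : y ∈ orthant n) (hxy : x ≠ y) :
    IntegrableOn (kernelIntegrand lam φ x y) (Ioi 0) := by
  obtain ⟨k, hxk, hyk⟩ := exists_subset_box_pair hx hy
  obtain ⟨C, hC0, hC⟩ := exists_heatDensityDeriv_le_timeMajorant hlam k
    (norm_pos_iff.2 (sub_ne_zero.2 hxy.symm))
  have hQ : IntegrableOn (fun t => heatDensityDeriv lam x y t) (Ioi 0) := by
    refine ((integrableOn_timeMajorant (commonDecay_pos hn hlam)).const_mul C).mono'
      ((measurable_heatDensityDeriv hlam).comp (measurable_const.prodMk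
        (measurable_const.prodMk measurable_id))).aestronglyMeasurable ?_
    filter_upwards [ae_restrict_mem measurableSet_Ioi] with t ht
    exact hC x hxk y hyk le_rfl t ht
  have h2 : IntegrableOn (fun t => φ t * ((weight lam y)⁻¹ * ratio lam x y *
      heatDensityDeriv lam x y t : ℝ)) (Ioi 0) := by
    obtain ⟨B, -, hB⟩ := exists_ae_norm_le hφ
    exact ((hQ.const_mul ((weight lam y)⁻¹ * ratio lam x y)).ofReal).bdd_mul hφ.1 hB
  refine h2.congr_fun (fun t ht => ?_) measurableSet_Ioi
  exact (kernelIntegrand_eq hlam φ hx hy ht).symm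

/-! ### The coefficient of the local term -/

/-- The coefficient `α(ε)` of the local term: the derivative of the mass that the Euclidean heat
kernel has in the ball of radius `ε`, integrated against `φ`. -/
noncomputable def jumpCoefficient (n : ℕ) (φ : ℝ → ℂ) (ε : ℝ) : ℂ :=
  ∫ t in Ioi (0 : ℝ), φ t * ballMassDeriv n ε t

lemma sq_mul_ballMassDeriv {ε : ℝ} (hε : 0 < ε) {s : ℝ} (hs : 0 < s) :
    ε ^ 2 * ballMassDeriv n ε (ε ^ 2 * s) = ballMassDeriv n 1 s := by
  rw [ballMassDeriv_eq hε (by positivity)]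
  field_simp

lemma integrableOn_ballMassDeriv_of_pos (hn : 1 ≤ n) {ε : ℝ} (hε : 0 < ε) :
    IntegrableOn (ballMassDeriv n ε) (Ioi 0) := by
  have h := (integrableOn_Ioi_comp_mul_left_iff (ballMassDeriv n ε) 0 (a := ε ^ 2)
    (by positivity)).1 ?_
  · rwa [mul_zero] at h
  · refine IntegrableOn.congr_fun ((integrableOn_ballMassDeriv hn).const_mul (ε ^ 2)⁻¹)
      (fun s hs => ?_) measurableSet_Ioi
    rw [← sq_mul_ballMassDeriv hε hs]
    field_simp

/-- The coefficient on the scale at which the ball has radius one. -/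
lemma jumpCoefficient_eq (φ : ℝ → ℂ) {ε : ℝ} (hε : 0 < ε) :
    jumpCoefficient n φ ε = ∫ s in Ioi (0 : ℝ), φ (ε ^ 2 * s) * ballMassDeriv n 1 s := by
  have h := integral_comp_mul_left_Ioi' (fun t => φ t * (ballMassDeriv n ε t : ℂ)) 0
    (b := ε ^ 2) (by positivity)
  rw [mul_zero] at h
  rw [jumpCoefficient, ← h, ← integral_smul]
  refine setIntegral_congr_fun measurableSet_Ioi fun s hs => ?_
  rw [← sq_mul_ballMassDeriv hε hs, Complex.real_smul]
  push_cast
  ring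

lemma quasiMeasurePreserving_mul_Ioi {c : ℝ} (hc : 0 < c) :
    Measure.QuasiMeasurePreserving (fun s => c * s) (volume.restrict (Ioi (0 : ℝ)))
      (volume.restrict (Ioi (0 : ℝ))) := by
  refine Measure.QuasiMeasurePreserving.restrict ⟨by fun_prop, ?_⟩ fun s hs => mul_pos hc hs
  rw [Real.map_volume_mul_left hc.ne']
  exact Measure.smul_absolutelyContinuous

lemma norm_jumpCoefficient_le (hn : 1 ≤ n) {φ : ℝ → ℂ} {B : ℝ}
    (hB : ∀ᵐ t ∂(volume.restrict (Ioi (0 : ℝ))), ‖φ t‖ ≤ B) {ε : ℝ} (hε : 0 < ε) :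
    ‖jumpCoefficient n φ ε‖ ≤ ∫ s in Ioi (0 : ℝ), B * |ballMassDeriv n 1 s| := by
  rw [jumpCoefficient_eq φ hε]
  refine norm_integral_le_of_norm_le ((integrableOn_ballMassDeriv hn).abs.const_mul B) ?_
  filter_upwards [(quasiMeasurePreserving_mul_Ioi (pow_pos hε 2)).ae hB] with s hs
  rw [norm_mul, Complex.norm_real, Real.norm_eq_abs]
  gcongr

/-- The limit is `φ(0⁺)` times the integral `-1` of `ballMassDeriv n 1`. -/
lemma tendsto_jumpCoefficient (hn : 1 ≤ n) {φ : ℝ → ℂ} (hφ : MemLp φ ∞ (volume.restrict (Ioi 0)))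
    {φ0 : ℂ} (h0 : Tendsto φ (𝓝[>] 0) (𝓝 φ0)) :
    Tendsto (jumpCoefficient n φ) (𝓝[>] 0) (𝓝 (-φ0)) := by
  obtain ⟨B, -, hB⟩ := exists_ae_norm_le hφ
  have hlim : Tendsto (fun ε => ∫ s in Ioi (0 : ℝ), φ (ε ^ 2 * s) * ballMassDeriv n 1 s) (𝓝[>] 0)
      (𝓝 (∫ s in Ioi (0 : ℝ), φ0 * ballMassDeriv n 1 s)) := by
    refine tendsto_integral_filter_of_dominated_convergence
      (fun s => B * |ballMassDeriv n 1 s|) ?_ ?_ ((integrableOn_ballMassDeriv hn).abs.const_mul B) ?_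
    · filter_upwards [self_mem_nhdsWithin] with ε hε
      exact (hφ.1.comp_quasiMeasurePreserving
        (quasiMeasurePreserving_mul_Ioi (pow_pos hε 2))).mul
        (integrableOn_ballMassDeriv hn).ofReal.1
    · filter_upwards [self_mem_nhdsWithin] with ε hε
      filter_upwards [(quasiMeasurePreserving_mul_Ioi (pow_pos hε 2)).ae hB] with s hs
      rw [norm_mul, Complex.norm_real, Real.norm_eq_abs]
      gcongr
    · filter_upwards [ae_restrict_mem measurableSet_Ioi] with s hs
      refine (h0.comp ?_).mul_const _
      refine tendsto_nhdsWithin_iff.2 ⟨?_, ?_⟩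
      · have : Tendsto (fun ε : ℝ => ε ^ 2 * s) (𝓝 0) (𝓝 (0 ^ 2 * s)) :=
          Continuous.tendsto (by fun_prop) 0
        simp only [ne_eq, OfNat.ofNat_ne_zero, not_false_eq_true, zero_pow, zero_mul] at this
        exact this.mono_left nhdsWithin_le_nhds
      · filter_upwards [self_mem_nhdsWithin] with ε hε
        exact mul_pos (pow_pos (mem_Ioi.1 hε) 2) (mem_Ioi.1 hs)
  rw [integral_const_mul, integral_complex_ofReal, integral_ballMassDeriv hn] at hlim
  simp only [Complex.ofReal_neg, Complex.ofReal_one, mul_neg, mul_one] at hlim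
  refine hlim.congr' ?_
  filter_upwards [self_mem_nhdsWithin] with ε hε using (jumpCoefficient_eq φ hε).symm

/-! ### The principal value -/

/-- The time derivative of the heat semigroup of the Bessel operator, applied to `f` at the point
`x`, with the integration restricted to `s`. -/
noncomputable def localAverage (lam : Fin n → ℝ) (f : EuclideanSpace ℝ (Fin n) → ℂ)
    (s : Set (EuclideanSpace ℝ (Fin n))) (x : EuclideanSpace ℝ (Fin n)) (t : ℝ) : ℂ :=
  ∫ y in s, localDensity lam f x y * heatDensityDeriv lam x y t

lemma measurable_localDensity_mul {lam : Fin n → ℝ} (hlam : ∀ j, -1 / 2 < lam j)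
    {f : EuclideanSpace ℝ (Fin n) → ℂ} (hf : Continuous f) :
    Measurable fun p : EuclideanSpace ℝ (Fin n) × EuclideanSpace ℝ (Fin n) × ℝ =>
      localDensity lam f p.1 p.2.1 * heatDensityDeriv lam p.1 p.2.1 p.2.2 :=
  ((measurable_localDensity lam hf).comp (measurable_fst.prodMk measurable_snd.fst)).mul
    (Complex.measurable_ofReal.comp (measurable_heatDensityDeriv hlam))

lemma measurable_localAverage {lam : Fin n → ℝ} (hlam : ∀ j, -1 / 2 < lam j)
    {f : EuclideanSpace ℝ (Fin n) → ℂ} (hf : Continuous f) (s : Set (EuclideanSpace ℝ (Fin n))) :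
    Measurable fun p : EuclideanSpace ℝ (Fin n) × ℝ => localAverage lam f s p.1 p.2 := by
  have h : Measurable fun q : (EuclideanSpace ℝ (Fin n) × ℝ) × EuclideanSpace ℝ (Fin n) =>
      localDensity lam f q.1.1 q.2 * heatDensityDeriv lam q.1.1 q.2 q.1.2 :=
    (measurable_localDensity_mul hlam hf).comp
      (measurable_fst.fst.prodMk (measurable_snd.prodMk measurable_fst.snd))
  exact (h.stronglyMeasurable.integral_prod_right' (ν := volume.restrict s)).measurable

lemma measurable_localAverage_apply {lam : Fin n → ℝ} (hlam : ∀ j, -1 / 2 < lam j)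
    {f : EuclideanSpace ℝ (Fin n) → ℂ} (hf : Continuous f) (s : Set (EuclideanSpace ℝ (Fin n)))
    (x : EuclideanSpace ℝ (Fin n)) : Measurable (localAverage lam f s x) := by
  have h : Measurable fun q : ℝ × EuclideanSpace ℝ (Fin n) =>
      localDensity lam f x q.2 * heatDensityDeriv lam x q.2 q.1 :=
    (measurable_localDensity_mul hlam hf).comp
      (measurable_const.prodMk (measurable_snd.prodMk measurable_fst))
  exact (h.stronglyMeasurable.integral_prod_right' (ν := volume.restrict s)).measurable

lemma integrable_gauss_sub {t : ℝ} (ht : 0 < t) (x : EuclideanSpace ℝ (Fin n)) :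
    Integrable fun y => gauss n t (y - x) :=
  (integrable_gauss ht).comp_sub_right x

lemma integral_gauss_sub {t : ℝ} (ht : 0 < t) (x : EuclideanSpace ℝ (Fin n)) :
    ∫ y, gauss n t (y - x) = 1 := by
  rw [integral_sub_right_eq_self (gauss n t) x, integral_gauss ht]

lemma integrable_indicator_box (n k : ℕ) :
    Integrable ((box n k).indicator (1 : EuclideanSpace ℝ (Fin n) → ℝ)) := by
  refine (integrable_indicator_iff (isCompact_box n k).measurableSet).2 ?_
  exact integrableOn_const (C := (1 : ℝ)) (isCompact_box n k).measure_lt_top.ne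

lemma integrable_localDensity_mul {lam : Fin n → ℝ} (hlam : ∀ j, -1 / 2 < lam j)
    {f : EuclideanSpace ℝ (Fin n) → ℂ} (hf : ContDiff ℝ 1 f) {k : ℕ} (hfk : tsupport f ⊆ box n k)
    {x : EuclideanSpace ℝ (Fin n)} (hx : x ∈ box n k) {t : ℝ} (ht : 0 < t) :
    Integrable fun y => localDensity lam f x y * heatDensityDeriv lam x y t := by
  obtain ⟨C, hC0, hC⟩ := exists_localDensity_mul_bounds hlam hf hfk
  have hm : Measurable fun y => localDensity lam f x y * heatDensityDeriv lam x y t :=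
    (measurable_localDensity_mul hlam hf.continuous).comp
      (measurable_const.prodMk (measurable_id.prodMk measurable_const))
  rcases le_total t 1 with h1 | h1
  · refine (((integrable_gauss_sub (by linarith : 0 < 2 * t) x).const_mul t⁻¹).const_mul C).mono'
      hm.aestronglyMeasurable (Eventually.of_forall fun y => ?_)
    refine (((hC x hx y).1 t ht h1).2).trans ?_
    have hg := gauss_nonneg (n := n) (t := 2 * t) (by linarith) (y - x)
    refine mul_le_mul_of_nonneg_right ?_ (by positivity)
    refine mul_le_of_le_one_right hC0 ?_
    exact indicator_le_self' (fun _ _ => zero_le_one) y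
  · exact (((integrable_indicator_box n k).const_mul C).mul_const _).mono'
      hm.aestronglyMeasurable (Eventually.of_forall fun y => (hC x hx y).2 t h1)

lemma integrable_gaussDeriv_sub {t : ℝ} (ht : 0 < t) (x : EuclideanSpace ℝ (Fin n)) :
    Integrable fun y => gaussDeriv n t (y - x) :=
  (integrable_gaussDeriv ht).comp_sub_right x

lemma integrable_mul_gaussDeriv_sub (c : ℂ) {t : ℝ} (ht : 0 < t) (x : EuclideanSpace ℝ (Fin n)) :
    Integrable fun y => c * (gaussDeriv n t (y - x) : ℂ) :=
  (integrable_gaussDeriv_sub ht x).ofReal.const_mul c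

lemma setIntegral_closedBall_gaussDeriv (x : EuclideanSpace ℝ (Fin n)) (ε t : ℝ) :
    ∫ y in Metric.closedBall x ε, gaussDeriv n t (y - x) = ballMassDeriv n ε t := by
  have h := (measurePreserving_sub_right volume x).setIntegral_preimage_emb
    (MeasurableEquiv.subRight x).measurableEmbedding (gaussDeriv n t) (Metric.closedBall 0 ε)
  have e : (fun y => y - x) ⁻¹' Metric.closedBall 0 ε = Metric.closedBall x ε := by
    ext y; simp [dist_eq_norm]
  rw [e] at h
  exact h

lemma localAverage_sub_eq {lam : Fin n → ℝ} (hlam : ∀ j, -1 / 2 < lam j)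
    {f : EuclideanSpace ℝ (Fin n) → ℂ} (hf : ContDiff ℝ 1 f) {k : ℕ} (hfk : tsupport f ⊆ box n k)
    {x : EuclideanSpace ℝ (Fin n)} (hx : x ∈ box n k) {t : ℝ} (ht : 0 < t)
    (s : Set (EuclideanSpace ℝ (Fin n))) :
    localAverage lam f s x t - f x * (∫ y in s, gaussDeriv n t (y - x) : ℝ) =
      ∫ y in s, (localDensity lam f x y * heatDensityDeriv lam x y t -
        localDensity lam f x x * gaussDeriv n t (y - x)) := by
  rw [integral_sub (f := fun y => localDensity lam f x y * (heatDensityDeriv lam x y t : ℂ))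
    (integrable_localDensity_mul hlam hf hfk hx ht).integrableOn
    (integrable_mul_gaussDeriv_sub _ ht x).integrableOn, integral_const_mul,
    integral_complex_ofReal, localDensity_self lam f (box_subset n k hx)]
  rfl

/-- The difference between the time derivatives of the two semigroups, restricted to a set `s`, has
an integrable majorant in time. For small times this holds for every `s`, by cancellation; for large
times both terms decay separately, the Euclidean one by hypothesis. -/
lemma exists_localAverage_sub_le {lam : Fin n → ℝ} (hlam : ∀ j, -1 / 2 < lam j)
    {f : EuclideanSpace ℝ (Fin n) → ℂ} (hf : ContDiff ℝ 1 f) {k : ℕ}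
    (hfk : tsupport f ⊆ box n k) :
    ∃ C, 0 ≤ C ∧ ∀ x ∈ box n k, ∀ t, 0 < t → ∀ s : Set (EuclideanSpace ℝ (Fin n)), ∀ D,
      (1 ≤ t → |∫ y in s, gaussDeriv n t (y - x)| ≤ D * t ^ (-1 - (n : ℝ) / 2)) → 0 ≤ D →
      ‖localAverage lam f s x t - f x * (∫ y in s, gaussDeriv n t (y - x) : ℝ)‖ ≤
        (C + C * D) * timeMajorant (commonDecay lam) t := by
  obtain ⟨C, hC0, hC⟩ := exists_localDensity_mul_bounds hlam hf hfk
  obtain ⟨F, hF⟩ := hf.continuous.bounded_above_of_compact_support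
    ((isCompact_box n k).of_isClosed_subset (isClosed_tsupport f) hfk)
  set I := ∫ y, (box n k).indicator (1 : EuclideanSpace ℝ (Fin n) → ℝ) y
  have hI0 : 0 ≤ I := integral_nonneg fun y => indicator_nonneg (fun _ _ => zero_le_one) y
  refine ⟨2 * C + C * I + |F|, by positivity, fun x hx t ht s D hD hD0 => ?_⟩
  have hm := timeMajorant_nonneg (κ := commonDecay lam) ht
  rcases le_total t 1 with h1 | h1
  · rw [localAverage_sub_eq hlam hf hfk hx ht]
    have hg2 := integrable_gauss_sub (by linarith : 0 < 2 * t) x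
    have hg4 := integrable_gauss_sub (by linarith : 0 < 4 * t) x
    have hint : Integrable fun y => C * (gauss n (2 * t) (y - x) +
        (√t)⁻¹ * gauss n (4 * t) (y - x)) := (hg2.add (hg4.const_mul _)).const_mul C
    have h2 := norm_integral_le_of_norm_le hint.integrableOn
      (Eventually.of_forall fun y => ((hC x hx y).1 t ht h1).1) (μ := volume.restrict s)
    refine h2.trans ((setIntegral_le_integral hint (Eventually.of_forall fun y => ?_)).trans ?_)
    · have := gauss_nonneg (n := n) (t := 2 * t) (by linarith) (y - x)
      have := gauss_nonneg (n := n) (t := 4 * t) (by linarith) (y - x)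
      simp only [Pi.zero_apply]
      positivity
    · rw [integral_const_mul, integral_add hg2 (hg4.const_mul _), integral_const_mul,
        integral_gauss_sub (by linarith), integral_gauss_sub (by linarith), mul_one,
        inv_sqrt_eq_timeMajorant (κ := commonDecay lam) ht h1]
      have h3 := one_le_timeMajorant (κ := commonDecay lam) ht h1
      calc _ ≤ C * (timeMajorant (commonDecay lam) t + timeMajorant (commonDecay lam) t) := by
            gcongr
        _ = (2 * C) * timeMajorant (commonDecay lam) t := by ring
        _ ≤ _ := by
          gcongr
          have : 0 ≤ C * I + |F| + (2 * C + C * I + |F|) * D := by positivity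
          linarith
  · have e1 : ‖localAverage lam f s x t‖ ≤ C * I * timeMajorant (commonDecay lam) t := by
      have hint : Integrable fun y => C * (box n k).indicator 1 y *
          t ^ (-1 - decayExponent lam) := ((integrable_indicator_box n k).const_mul C).mul_const _
      have h2 := norm_integral_le_of_norm_le hint.integrableOn
        (Eventually.of_forall fun y => (hC x hx y).2 t h1) (μ := volume.restrict s)
      refine h2.trans ((setIntegral_le_integral hint (Eventually.of_forall fun y => ?_)).trans ?_)
      · have : 0 ≤ (box n k).indicator (1 : EuclideanSpace ℝ (Fin n) → ℝ) y := indicator_nonneg (fun _ _ => zero_le_one) y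
        simp only [Pi.zero_apply]
        positivity
      · rw [integral_mul_const, integral_const_mul]
        exact mul_le_mul_of_nonneg_left (rpow_le_timeMajorant (min_le_left _ _) h1) (by positivity)
    have e2 : ‖f x * (∫ y in s, gaussDeriv n t (y - x) : ℝ)‖ ≤
        |F| * (D * timeMajorant (commonDecay lam) t) := by
      rw [norm_mul, Complex.norm_real]
      refine mul_le_mul ((hF x).trans (le_abs_self _)) ((hD h1).trans ?_) (norm_nonneg _)
        (abs_nonneg _)
      exact mul_le_mul_of_nonneg_left (rpow_le_timeMajorant (min_le_right _ _) h1) hD0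
    refine (norm_sub_le _ _).trans ((add_le_add e1 e2).trans ?_)
    have h4 : 0 ≤ (2 * C + |F| + (2 * C + C * I) * D) * timeMajorant (commonDecay lam) t := by
      positivity
    linarith

lemma exists_localAverage_univ_le {lam : Fin n → ℝ} (hlam : ∀ j, -1 / 2 < lam j)
    {f : EuclideanSpace ℝ (Fin n) → ℂ} (hf : ContDiff ℝ 1 f) {k : ℕ}
    (hfk : tsupport f ⊆ box n k) :
    ∃ C, 0 ≤ C ∧ ∀ x ∈ box n k, ∀ t, 0 < t →
      ‖localAverage lam f univ x t‖ ≤ C * timeMajorant (commonDecay lam) t := by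
  obtain ⟨C, hC0, hC⟩ := exists_localAverage_sub_le hlam hf hfk
  refine ⟨C, hC0, fun x hx t ht => ?_⟩
  have e : ∫ y in univ, gaussDeriv n t (y - x) = 0 := by
    rw [setIntegral_univ, integral_sub_right_eq_self (gaussDeriv n t) x, integral_gaussDeriv ht]
  have h := hC x hx t ht univ 0 (fun _ => by rw [e]; simp) le_rfl
  rw [e] at h
  simpa using h

lemma exists_localAverage_closedBall_le {lam : Fin n → ℝ} (hlam : ∀ j, -1 / 2 < lam j)
    {f : EuclideanSpace ℝ (Fin n) → ℂ} (hf : ContDiff ℝ 1 f) {k : ℕ}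
    (hfk : tsupport f ⊆ box n k) :
    ∃ C, 0 ≤ C ∧ ∀ x ∈ box n k, ∀ t, 0 < t → ∀ ε ≤ 1,
      ‖localAverage lam f (Metric.closedBall x ε) x t - f x * ballMassDeriv n ε t‖ ≤
        C * timeMajorant (commonDecay lam) t := by
  obtain ⟨C, hC0, hC⟩ := exists_localAverage_sub_le hlam hf hfk
  set D := derivConst n * volume.real (Metric.closedBall (0 : EuclideanSpace ℝ (Fin n)) 1)
  have hD0 : 0 ≤ D := mul_nonneg (derivConst_pos n).le measureReal_nonneg
  refine ⟨C + C * D, by positivity, fun x hx t ht ε hε => ?_⟩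
  have h := hC x hx t ht (Metric.closedBall x ε) D (fun h1 => ?_) hD0
  · rwa [setIntegral_closedBall_gaussDeriv] at h
  · have h2 := norm_setIntegral_le_of_norm_le_const (μ := volume) (s := Metric.closedBall x ε)
      (f := fun y => gaussDeriv n t (y - x)) measure_closedBall_lt_top
      (fun y _ => abs_gaussDeriv_le_rpow ht (y - x))
    refine h2.trans ?_
    have h3 : volume.real (Metric.closedBall x ε) ≤
        volume.real (Metric.closedBall (0 : EuclideanSpace ℝ (Fin n)) 1) := by
      rw [Measure.real, Measure.real, ← Measure.addHaar_closedBall_center volume x 1]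
      exact ENNReal.toReal_mono measure_closedBall_lt_top.ne
        (measure_mono (Metric.closedBall_subset_closedBall hε))
    calc _ ≤ derivConst n * t ^ (-1 - (n : ℝ) / 2) *
          volume.real (Metric.closedBall (0 : EuclideanSpace ℝ (Fin n)) 1) := by
            have := derivConst_pos n
            gcongr
      _ = _ := by ring

lemma tendsto_localAverage_closedBall (hn : 1 ≤ n) {lam : Fin n → ℝ} (hlam : ∀ j, -1 / 2 < lam j)
    {f : EuclideanSpace ℝ (Fin n) → ℂ} (hf : ContDiff ℝ 1 f) {k : ℕ}
    (hfk : tsupport f ⊆ box n k) {x : EuclideanSpace ℝ (Fin n)} (hx : x ∈ box n k) {t : ℝ}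
    (ht : 0 < t) :
    Tendsto (fun ε => localAverage lam f (Metric.closedBall x ε) x t - f x * ballMassDeriv n ε t)
      (𝓝[>] 0) (𝓝 0) := by
  have hvol : Tendsto (fun ε : ℝ => volume (Metric.closedBall x ε)) (𝓝[>] 0) (𝓝 0) := by
    have h1 : Tendsto (fun ε : ℝ => ENNReal.ofReal (ε ^ n) *
        volume (Metric.ball (0 : EuclideanSpace ℝ (Fin n)) 1)) (𝓝 0)
        (𝓝 (ENNReal.ofReal (0 ^ n) * volume (Metric.ball (0 : EuclideanSpace ℝ (Fin n)) 1))) := by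
      refine ENNReal.Tendsto.mul_const (ENNReal.tendsto_ofReal ?_)
        (Or.inr measure_ball_lt_top.ne)
      exact Continuous.tendsto (by fun_prop) 0
    rw [zero_pow (by omega), ENNReal.ofReal_zero, zero_mul] at h1
    refine (h1.mono_left nhdsWithin_le_nhds).congr' ?_
    filter_upwards [self_mem_nhdsWithin] with ε hε
    rw [Measure.addHaar_closedBall volume x (le_of_lt hε), finrank_euclideanSpace_fin]
  have hint : Integrable fun y => localDensity lam f x y * heatDensityDeriv lam x y t -
      localDensity lam f x x * gaussDeriv n t (y - x) :=
    (integrable_localDensity_mul hlam hf hfk hx ht).sub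
      (integrable_mul_gaussDeriv_sub _ ht x)
  refine (hint.tendsto_setIntegral_nhds_zero hvol).congr fun ε => ?_
  rw [← localAverage_sub_eq hlam hf hfk hx ht, setIntegral_closedBall_gaussDeriv]

lemma integrable_mul_localDensity_mul (hn : 1 ≤ n) {lam : Fin n → ℝ} (hlam : ∀ j, -1 / 2 < lam j)
    {φ : ℝ → ℂ} (hφ : MemLp φ ∞ (volume.restrict (Ioi 0)))
    {f : EuclideanSpace ℝ (Fin n) → ℂ} (hf : ContDiff ℝ 1 f) {k : ℕ}
    (hfk : tsupport f ⊆ box n k) {x : EuclideanSpace ℝ (Fin n)} (hx : x ∈ box n k) {ε : ℝ}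
    (hε : 0 < ε) :
    Integrable (fun p : EuclideanSpace ℝ (Fin n) × ℝ =>
      φ p.2 * (localDensity lam f x p.1 * heatDensityDeriv lam x p.1 p.2))
      ((volume.restrict {y | ε < ‖y - x‖}).prod (volume.restrict (Ioi 0))) := by
  obtain ⟨B, hB0, hB⟩ := exists_ae_norm_le hφ
  obtain ⟨M, hM0, hM⟩ := exists_localDensity_lipschitz lam hf hfk
  obtain ⟨C, hC0, hC⟩ := exists_heatDensityDeriv_le_timeMajorant hlam k hε
  have hs : MeasurableSet {y : EuclideanSpace ℝ (Fin n) | ε < ‖y - x‖} :=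
    (isOpen_lt continuous_const (by fun_prop)).measurableSet
  have hm : Measurable fun p : EuclideanSpace ℝ (Fin n) × ℝ =>
      localDensity lam f x p.1 * heatDensityDeriv lam x p.1 p.2 :=
    (measurable_localDensity_mul hlam hf.continuous).comp
      (measurable_const.prodMk (measurable_fst.prodMk measurable_snd))
  have hmaj : Integrable (fun p : EuclideanSpace ℝ (Fin n) × ℝ => (box n k).indicator
      (1 : EuclideanSpace ℝ (Fin n) → ℝ) p.1 * timeMajorant (commonDecay lam) p.2)
      ((volume.restrict {y | ε < ‖y - x‖}).prod (volume.restrict (Ioi 0))) :=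
    ((integrable_indicator_box n k).integrableOn (s := {y | ε < ‖y - x‖})).mul_prod
      (integrableOn_timeMajorant (commonDecay_pos hn hlam))
  refine (hmaj.const_mul (B * (M * C))).mono' (hφ.1.comp_snd.mul hm.aestronglyMeasurable) ?_
  filter_upwards [Measure.quasiMeasurePreserving_snd.ae hB,
    Measure.quasiMeasurePreserving_snd.ae (ae_restrict_mem measurableSet_Ioi),
    Measure.quasiMeasurePreserving_fst.ae (ae_restrict_mem hs)] with p h1 h2 h3
  by_cases hy : p.1 ∈ box n k
  · rw [norm_mul, norm_mul, Complex.norm_real, indicator_of_mem hy, Pi.one_apply, one_mul]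
    calc _ ≤ B * (M * (C * timeMajorant (commonDecay lam) p.2)) := by
          gcongr
          · exact (hM x hx p.1).1
          · exact hC x hx p.1 hy (le_of_lt h3) p.2 h2
      _ = _ := by ring
  · simp [localDensity_eq_zero lam hfk x hy, hy]

lemma weight_mul_mul_kernelK {lam : Fin n → ℝ} (hlam : ∀ j, -1 / 2 < lam j) (φ : ℝ → ℂ)
    (f : EuclideanSpace ℝ (Fin n) → ℂ) {x y : EuclideanSpace ℝ (Fin n)} (hx : x ∈ orthant n)
    (hy : y ∈ orthant n) :
    (weight lam y : ℂ) * (f y * kernelK lam φ x y) =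
      ∫ t in Ioi (0 : ℝ), φ t * (localDensity lam f x y * heatDensityDeriv lam x y t) := by
  rw [kernelK, ← integral_const_mul, ← integral_const_mul]
  refine setIntegral_congr_fun measurableSet_Ioi fun t ht => ?_
  rw [kernelIntegrand_eq hlam φ hx hy ht, localDensity]
  have hw : (weight lam y : ℂ) ≠ 0 := Complex.ofReal_ne_zero.2 (weight_pos lam hy).ne'
  push_cast
  field_simp

lemma integrableOn_mul_kernelK (hn : 1 ≤ n) {lam : Fin n → ℝ} (hlam : ∀ j, -1 / 2 < lam j)
    {φ : ℝ → ℂ} (hφ : MemLp φ ∞ (volume.restrict (Ioi 0)))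
    {f : EuclideanSpace ℝ (Fin n) → ℂ} (hf : ContDiff ℝ 1 f) {k : ℕ}
    (hfk : tsupport f ⊆ box n k) {x : EuclideanSpace ℝ (Fin n)} (hx : x ∈ box n k) {ε : ℝ}
    (hε : 0 < ε) :
    IntegrableOn (fun y => f y * kernelK lam φ x y) {y | ε < ‖y - x‖} (mu lam) := by
  have hs : MeasurableSet {y : EuclideanSpace ℝ (Fin n) | ε < ‖y - x‖} :=
    (isOpen_lt continuous_const (by fun_prop)).measurableSet
  rw [integrableOn_mu_iff lam _ hs]
  have h := (integrable_mul_localDensity_mul hn hlam hφ hf hfk hx hε).integral_prod_left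
  have h' : IntegrableOn (fun y => ∫ t in Ioi (0 : ℝ), φ t * (localDensity lam f x y *
    heatDensityDeriv lam x y t)) ({y | ε < ‖y - x‖} ∩ orthant n) :=
    IntegrableOn.mono_set h inter_subset_left
  refine h'.congr_fun (fun y hy => ?_) (hs.inter (orthant n).isOpen.measurableSet)
  exact (weight_mul_mul_kernelK hlam φ f (box_subset n k hx) hy.2).symm

lemma truncatedIntegral_eq (hn : 1 ≤ n) {lam : Fin n → ℝ} (hlam : ∀ j, -1 / 2 < lam j)
    {φ : ℝ → ℂ} (hφ : MemLp φ ∞ (volume.restrict (Ioi 0)))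
    {f : EuclideanSpace ℝ (Fin n) → ℂ} (hf : ContDiff ℝ 1 f) {k : ℕ}
    (hfk : tsupport f ⊆ box n k) {x : EuclideanSpace ℝ (Fin n)} (hx : x ∈ box n k) {ε : ℝ}
    (hε : 0 < ε) :
    truncatedIntegral lam φ f ε x =
      ∫ t in Ioi (0 : ℝ), φ t * localAverage lam f {y | ε < ‖y - x‖} x t := by
  have hs : MeasurableSet {y : EuclideanSpace ℝ (Fin n) | ε < ‖y - x‖} :=
    (isOpen_lt continuous_const (by fun_prop)).measurableSet
  have ho := (orthant n).isOpen.measurableSet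
  have h := integrable_mul_localDensity_mul hn hlam hφ hf hfk hx hε
  rw [truncatedIntegral, setIntegral_mu lam _ hs, setIntegral_congr_fun (hs.inter ho)
    fun y hy => weight_mul_mul_kernelK hlam φ f (box_subset n k hx) hy.2]
  have e : ∫ y in {y | ε < ‖y - x‖} ∩ (orthant n : Set (EuclideanSpace ℝ (Fin n))), ∫ t in Ioi (0 : ℝ),
      φ t * (localDensity lam f x y * heatDensityDeriv lam x y t) =
      ∫ y in {y | ε < ‖y - x‖}, ∫ t in Ioi (0 : ℝ),
        φ t * (localDensity lam f x y * heatDensityDeriv lam x y t) := by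
    refine (setIntegral_eq_of_subset_of_forall_sdiff_eq_zero hs inter_subset_left fun y hy => ?_).symm
    have : y ∉ box n k := fun h => hy.2 ⟨hy.1, box_subset n k h⟩
    simp [localDensity_eq_zero lam hfk x this]
  rw [e, integral_integral_swap h]
  simp only [integral_const_mul, localAverage]

/-- The function `S(x) = ∫ φ(t) ∂ₜ(W_t f)(x) dt`. It is the limit of the corrected truncated
integrals, and its negative is the multiplier transform of `f`. -/
noncomputable def principalValue (lam : Fin n → ℝ) (φ : ℝ → ℂ) (f : EuclideanSpace ℝ (Fin n) → ℂ)
    (x : EuclideanSpace ℝ (Fin n)) : ℂ :=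
  ∫ t in Ioi (0 : ℝ), φ t * localAverage lam f univ x t

lemma integrableOn_mul_localAverage_univ (hn : 1 ≤ n) {lam : Fin n → ℝ}
    (hlam : ∀ j, -1 / 2 < lam j) {φ : ℝ → ℂ} (hφ : MemLp φ ∞ (volume.restrict (Ioi 0)))
    {f : EuclideanSpace ℝ (Fin n) → ℂ} (hf : ContDiff ℝ 1 f) {k : ℕ}
    (hfk : tsupport f ⊆ box n k) {x : EuclideanSpace ℝ (Fin n)} (hx : x ∈ box n k) :
    IntegrableOn (fun t => φ t * localAverage lam f univ x t) (Ioi 0) := by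
  obtain ⟨B, hB0, hB⟩ := exists_ae_norm_le hφ
  obtain ⟨C, hC0, hC⟩ := exists_localAverage_univ_le hlam hf hfk
  have hm : AEStronglyMeasurable (fun t => φ t * localAverage lam f univ x t)
      (volume.restrict (Ioi 0)) :=
    hφ.1.mul (measurable_localAverage_apply hlam hf.continuous univ x).aestronglyMeasurable
  have hmaj : IntegrableOn (fun t => B * (C * timeMajorant (commonDecay lam) t)) (Ioi 0) :=
    ((integrableOn_timeMajorant (commonDecay_pos hn hlam)).const_mul C).const_mul B
  refine hmaj.mono' hm ?_
  filter_upwards [hB, ae_restrict_mem measurableSet_Ioi] with t h1 h2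
  rw [norm_mul]
  gcongr
  exact hC x hx t h2

/-- After the correction by the local term the truncated integrals converge. Near the diagonal the
kernel is compared with the Euclidean one, for which the correction compensates the truncation. -/
lemma tendsto_jumpCoefficient_mul_add_truncatedIntegral (hn : 1 ≤ n) {lam : Fin n → ℝ}
    (hlam : ∀ j, -1 / 2 < lam j) {φ : ℝ → ℂ} (hφ : MemLp φ ∞ (volume.restrict (Ioi 0)))
    {f : EuclideanSpace ℝ (Fin n) → ℂ} (hf : ContDiff ℝ 1 f) {k : ℕ}
    (hfk : tsupport f ⊆ box n k) {x : EuclideanSpace ℝ (Fin n)} (hx : x ∈ box n k) :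
    Tendsto (fun ε => jumpCoefficient n φ ε * f x + truncatedIntegral lam φ f ε x) (𝓝[>] 0)
      (𝓝 (principalValue lam φ f x)) := by
  obtain ⟨B, hB0, hB⟩ := exists_ae_norm_le hφ
  obtain ⟨C, hC0, hC⟩ := exists_localAverage_closedBall_le hlam hf hfk
  set D : ℝ → ℝ → ℂ := fun ε t =>
    localAverage lam f (Metric.closedBall x ε) x t - f x * ballMassDeriv n ε t with hD
  have hDm : ∀ ε, AEStronglyMeasurable (fun t => φ t * D ε t) (volume.restrict (Ioi 0)) := by
    intro ε
    have hm := measurable_localAverage_apply hlam hf.continuous (Metric.closedBall x ε) x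
    have hm2 : Measurable fun t => (ballMassDeriv n ε t : ℂ) :=
      Complex.measurable_ofReal.comp (measurable_ballMassDeriv n ε)
    exact hφ.1.mul (hm.sub (hm2.const_mul _)).aestronglyMeasurable
  have hmaj : IntegrableOn (fun t => B * (C * timeMajorant (commonDecay lam) t)) (Ioi 0) :=
    ((integrableOn_timeMajorant (commonDecay_pos hn hlam)).const_mul C).const_mul B
  have hDb : ∀ ε ≤ 1, ∀ᵐ t ∂(volume.restrict (Ioi (0 : ℝ))),
      ‖φ t * D ε t‖ ≤ B * (C * timeMajorant (commonDecay lam) t) := by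
    intro ε hε
    filter_upwards [hB, ae_restrict_mem measurableSet_Ioi] with t h1 h2
    rw [norm_mul]
    gcongr
    exact hC x hx t h2 ε hε
  have hA := integrableOn_mul_localAverage_univ hn hlam hφ hf hfk hx
  have hev : ∀ᶠ ε : ℝ in 𝓝[>] 0, 0 < ε ∧ ε ≤ 1 := by
    filter_upwards [Ioc_mem_nhdsGT (zero_lt_one' ℝ)] with ε hε using hε
  -- dominated convergence in `t`
  have hlim : Tendsto (fun ε => ∫ t in Ioi (0 : ℝ), φ t * D ε t) (𝓝[>] 0) (𝓝 0) := by
    have := tendsto_integral_filter_of_dominated_convergence (μ := volume.restrict (Ioi (0 : ℝ)))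
      (l := 𝓝[>] (0 : ℝ)) (F := fun ε t => φ t * D ε t) (f := fun t => φ t * 0) _
      (Eventually.of_forall hDm) (hev.mono fun ε h => hDb ε h.2) hmaj ?_
    · simpa using this
    · filter_upwards [ae_restrict_mem measurableSet_Ioi] with t ht
      exact (tendsto_localAverage_closedBall hn hlam hf hfk hx ht).const_mul (φ t)
  have hkey : ∀ ε, 0 < ε → ε ≤ 1 → principalValue lam φ f x - ∫ t in Ioi (0 : ℝ), φ t * D ε t =
      jumpCoefficient n φ ε * f x + truncatedIntegral lam φ f ε x := by
    intro ε hε hε1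
    have hDi : IntegrableOn (fun t => φ t * D ε t) (Ioi 0) := hmaj.mono' (hDm ε) (hDb ε hε1)
    have hJ : IntegrableOn (fun t => φ t * (ballMassDeriv n ε t : ℂ)) (Ioi 0) :=
      ((integrableOn_ballMassDeriv_of_pos hn hε).ofReal).bdd_mul hφ.1 hB
    have hAD : IntegrableOn (fun t => φ t * localAverage lam f univ x t - φ t * D ε t) (Ioi 0) :=
      hA.sub hDi
    rw [truncatedIntegral_eq hn hlam hφ hf hfk hx hε, principalValue, jumpCoefficient,
      ← integral_sub hA hDi, ← integral_mul_const, ← sub_eq_iff_eq_add',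
      ← integral_sub hAD (hJ.mul_const _)]
    refine setIntegral_congr_fun measurableSet_Ioi fun t ht => ?_
    have hi := integrable_localDensity_mul hlam hf hfk hx ht
    have hc : {y : EuclideanSpace ℝ (Fin n) | ε < ‖y - x‖} = (Metric.closedBall x ε)ᶜ := by
      ext y; simp [dist_eq_norm]
    have hsplit : localAverage lam f univ x t = localAverage lam f (Metric.closedBall x ε) x t +
        localAverage lam f {y | ε < ‖y - x‖} x t := by
      rw [hc, localAverage, setIntegral_univ]
      exact (integral_add_compl Metric.isClosed_closedBall.measurableSet hi).symm
    simp only [hD]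
    rw [hsplit]
    ring
  have h := tendsto_const_nhds (x := principalValue lam φ f x) |>.sub hlim
  rw [sub_zero] at h
  exact h.congr' (hev.mono fun ε h => hkey ε h.1 h.2)

/-! ### The multiplier transform of a test function -/

/-- Differentiation of a Laplace integral under the integral sign. -/
lemma hasDerivAt_integral_exp_mul {lam : Fin n → ℝ} {H : EuclideanSpace ℝ (Fin n) → ℂ}
    (hH : Integrable H (mu lam)) {t : ℝ} (ht : 0 < t) :
    HasDerivAt (fun s => ∫ y, (Real.exp (-s * ∑ j, y j ^ 2) : ℂ) * H y ∂(mu lam))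
      (∫ y, -((((∑ j, y j ^ 2) * Real.exp (-t * ∑ j, y j ^ 2) : ℝ) : ℂ) * H y) ∂(mu lam)) t := by
  have hm : ∀ s : ℝ, AEStronglyMeasurable (fun y : EuclideanSpace ℝ (Fin n) =>
      (Real.exp (-s * ∑ j, y j ^ 2) : ℂ)) (mu lam) := fun s =>
    Continuous.aestronglyMeasurable (by fun_prop)
  have hm' : AEStronglyMeasurable (fun y : EuclideanSpace ℝ (Fin n) =>
      (((∑ j, y j ^ 2) * Real.exp (-t * ∑ j, y j ^ 2) : ℝ) : ℂ)) (mu lam) :=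
    Continuous.aestronglyMeasurable (by fun_prop)
  have hnn : ∀ y : EuclideanSpace ℝ (Fin n), 0 ≤ ∑ j, y j ^ 2 := fun y =>
    Finset.sum_nonneg fun j _ => sq_nonneg _
  refine (hasDerivAt_integral_of_dominated_loc_of_deriv_le (μ := mu lam) (x₀ := t)
    (F := fun s y => (Real.exp (-s * ∑ j, y j ^ 2) : ℂ) * H y)
    (F' := fun s y => -((((∑ j, y j ^ 2) * Real.exp (-s * ∑ j, y j ^ 2) : ℝ) : ℂ) * H y))
    (bound := fun y => (2 / t) * ‖H y‖)
    (Ioi_mem_nhds (by linarith : t / 2 < t)) ?_ ?_ ?_ ?_ ?_ ?_).2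
  · exact Eventually.of_forall fun s => (hm s).mul hH.1
  · refine hH.bdd_mul (c := 1) (hm t) (Eventually.of_forall fun y => ?_)
    rw [Complex.norm_real, Real.norm_of_nonneg (Real.exp_pos _).le]
    refine Real.exp_le_one_iff.2 ?_
    have := hnn y
    nlinarith
  · exact (hm'.mul hH.1).neg
  · refine Eventually.of_forall fun y s hs => ?_
    have hs' : t / 2 < s := hs
    have h1 := mul_exp_neg_le_one (s * ∑ j, y j ^ 2)
    have h0 := hnn y
    rw [norm_neg, norm_mul, Complex.norm_real, Real.norm_of_nonneg (by positivity)]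
    refine mul_le_mul_of_nonneg_right ?_ (norm_nonneg _)
    rw [le_div_iff₀ ht, neg_mul]
    have h2 : 0 ≤ (∑ j, y j ^ 2) * Real.exp (-(s * ∑ j, y j ^ 2)) := by positivity
    nlinarith
  · exact hH.norm.const_mul _
  · refine Eventually.of_forall fun y s _ => ?_
    have h1 : HasDerivAt (fun s : ℝ => Real.exp (-s * ∑ j, y j ^ 2))
        (Real.exp (-s * ∑ j, y j ^ 2) * (-1 * ∑ j, y j ^ 2)) s :=
      ((hasDerivAt_neg s).mul_const _).exp
    have h2 := h1.ofReal_comp.mul_const (H y)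
    convert! h2 using 1
    push_cast
    ring

lemma hasDerivAt_heatSeries {lam : Fin n → ℝ} (hlam : ∀ j, -1 / 2 < lam j)
    {x y : EuclideanSpace ℝ (Fin n)} (hx : x ∈ orthant n) (hy : y ∈ orthant n) {t : ℝ}
    (ht : 0 < t) :
    HasDerivAt (fun s => heatSeries lam s x y)
      ((weight lam y)⁻¹ * ratio lam x y * heatDensityDeriv lam x y t) t := by
  refine (hasDerivAt_prod_heatKernel hlam hx hy ht).congr_of_eventuallyEq ?_
  filter_upwards [Ioi_mem_nhds ht] with s hs using (prod_heatKernel_eq lam hs hx hy).symm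

/-- The average with respect to `mu`, in which the inverse of the weight compensates its density. -/
lemma integral_inv_weight_mul (lam : Fin n → ℝ) {f : EuclideanSpace ℝ (Fin n) → ℂ} {k : ℕ}
    (hfk : tsupport f ⊆ box n k) (x : EuclideanSpace ℝ (Fin n)) (t : ℝ) :
    ∫ y, ((weight lam y)⁻¹ : ℝ) * (localDensity lam f x y * heatDensityDeriv lam x y t) ∂(mu lam) =
      localAverage lam f univ x t := by
  have ho := (orthant n).isOpen.measurableSet
  rw [← setIntegral_univ, setIntegral_mu lam _ MeasurableSet.univ, univ_inter, localAverage]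
  rw [setIntegral_eq_of_subset_of_forall_sdiff_eq_zero (t := univ) (s := orthant n)
    MeasurableSet.univ (subset_univ _) fun y hy => ?_]
  · refine setIntegral_congr_fun ho fun y hy => ?_
    have hw : (weight lam y : ℂ) ≠ 0 := Complex.ofReal_ne_zero.2 (weight_pos lam hy).ne'
    push_cast
    field_simp
  · have : y ∉ box n k := fun h => hy.2 (box_subset n k h)
    simp [localDensity_eq_zero lam hfk x this]

/-- Differentiation of the bilinear form of the heat semigroup. -/
lemma hasDerivAt_integral_heatSeries (hn : 1 ≤ n) {lam : Fin n → ℝ} (hlam : ∀ j, -1 / 2 < lam j)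
    {f : EuclideanSpace ℝ (Fin n) → ℂ} (hf : ContDiff ℝ 1 f) {k : ℕ}
    (hfk : tsupport f ⊆ box n k) (hfi : BoxIntegrable lam k f) {G : EuclideanSpace ℝ (Fin n) → ℂ}
    (hG : BoxIntegrable lam k G) {t : ℝ} (ht : 0 < t) :
    HasDerivAt (fun s => ∫ p, (heatSeries lam s p.1 p.2 : ℂ) * (G p.1 * f p.2)
      ∂((mu lam).prod (mu lam))) (∫ x, G x * localAverage lam f univ x t ∂(mu lam)) t := by
  obtain ⟨C, hC0, hC⟩ := exists_localDensity_mul_bounds hlam hf hfk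
  obtain ⟨M, hM⟩ := ((isCompact_box n k).prod (isCompact_box n k)).exists_bound_of_continuousOn
    (continuous_heatSeries hlam t).continuousOn
  obtain ⟨W, hW⟩ := (isCompact_box n k).exists_bound_of_continuousOn
    (((continuousOn_weight lam).mono (box_subset n k)).inv₀
      fun y hy => (weight_pos lam (box_subset n k hy)).ne')
  have hae1 : ∀ᵐ p ∂((mu lam).prod (mu lam)), p.1 ∈ orthant n :=
    Measure.quasiMeasurePreserving_fst.ae (ae_mem_orthant lam)
  have hae2 : ∀ᵐ p ∂((mu lam).prod (mu lam)), p.2 ∈ orthant n :=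
    Measure.quasiMeasurePreserving_snd.ae (ae_mem_orthant lam)
  have hae3 : ∀ᵐ p ∂((mu lam).prod (mu lam)), p.1 ∉ box n k → G p.1 = 0 :=
    Measure.quasiMeasurePreserving_fst.ae hG.2
  have hf0 : ∀ y ∉ box n k, f y = 0 := fun y hy =>
    image_eq_zero_of_notMem_tsupport fun h => hy (hfk h)
  have hWm : ∀ s, AEStronglyMeasurable (fun p : EuclideanSpace ℝ (Fin n) ×
      EuclideanSpace ℝ (Fin n) => (heatSeries lam s p.1 p.2 : ℂ)) ((mu lam).prod (mu lam)) :=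
    fun s => (Complex.continuous_ofReal.comp (continuous_heatSeries hlam s)).aestronglyMeasurable
  have hGf : Integrable (fun p : EuclideanSpace ℝ (Fin n) × EuclideanSpace ℝ (Fin n) =>
      G p.1 * f p.2) ((mu lam).prod (mu lam)) := hG.1.mul_prod hfi.1
  set C' := C * ((t / 2)⁻¹ * t ^ (-(n : ℝ) / 2) + 1) with hC'
  have hC'0 : 0 ≤ C' := by positivity
  have hbound : ∀ x ∈ box n k, ∀ y, ∀ s, t / 2 < s →
      ‖localDensity lam f x y * heatDensityDeriv lam x y s‖ ≤ C' * (box n k).indicator 1 y := by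
    intro x hx y s hs
    have hs0 : 0 < s := by linarith
    have hi : 0 ≤ (box n k).indicator (1 : EuclideanSpace ℝ (Fin n) → ℝ) y :=
      indicator_nonneg (fun _ _ => zero_le_one) y
    have hp : 0 ≤ (t / 2)⁻¹ * t ^ (-(n : ℝ) / 2) := by positivity
    rcases le_total s 1 with h1 | h1
    · refine (((hC x hx y).1 s hs0 h1).2).trans ?_
      have h2 : s⁻¹ * gauss n (2 * s) (y - x) ≤ (t / 2)⁻¹ * t ^ (-(n : ℝ) / 2) := by
        refine mul_le_mul (inv_anti₀ (by positivity) hs.le) ?_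
          (gauss_nonneg (by linarith) _) (by positivity)
        refine (gauss_le (by linarith) _).trans ?_
        exact Real.rpow_le_rpow_of_nonpos ht (by linarith)
          (by have : (0 : ℝ) ≤ n := n.cast_nonneg
              linarith)
      calc _ ≤ C * (box n k).indicator 1 y * ((t / 2)⁻¹ * t ^ (-(n : ℝ) / 2) + 1) :=
            mul_le_mul_of_nonneg_left (by linarith) (by positivity)
        _ = _ := by rw [hC']; ring
    · refine ((hC x hx y).2 s h1).trans ?_
      have h2 : s ^ (-1 - decayExponent lam) ≤ 1 :=
        Real.rpow_le_one_of_one_le_of_nonpos h1 (by linarith [decayExponent_pos hn hlam])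
      calc _ ≤ C * (box n k).indicator 1 y * ((t / 2)⁻¹ * t ^ (-(n : ℝ) / 2) + 1) :=
            mul_le_mul_of_nonneg_left (by linarith) (by positivity)
        _ = _ := by rw [hC']; ring
  have hone : Integrable ((box n k).indicator (1 : EuclideanSpace ℝ (Fin n) → ℝ)) (mu lam) := by
    refine (integrable_indicator_iff (isCompact_box n k).measurableSet).2 ?_
    exact integrableOn_const (C := (1 : ℝ))
      (mu_lt_top lam (isCompact_box n k) (box_subset n k)).ne
  have hbi : Integrable (fun p : EuclideanSpace ℝ (Fin n) × EuclideanSpace ℝ (Fin n) =>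
      ‖G p.1‖ * (|W| * (C' * (box n k).indicator 1 p.2))) ((mu lam).prod (mu lam)) :=
    hG.1.norm.mul_prod ((hone.const_mul C').const_mul |W|)
  have hder := hasDerivAt_integral_of_dominated_loc_of_deriv_le (μ := (mu lam).prod (mu lam))
    (x₀ := t) (F := fun s p => (heatSeries lam s p.1 p.2 : ℂ) * (G p.1 * f p.2))
    (F' := fun s p => G p.1 * (((weight lam p.2)⁻¹ : ℝ) *
      (localDensity lam f p.1 p.2 * heatDensityDeriv lam p.1 p.2 s)))
    (bound := fun p => ‖G p.1‖ * (|W| * (C' * (box n k).indicator 1 p.2)))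
    (Ioi_mem_nhds (by linarith : t / 2 < t)) ?_ ?_ ?_ ?_ hbi ?_
  · have e := integral_prod _ hder.1
    have h := hder.2
    rw [e] at h
    simp only [integral_const_mul, integral_inv_weight_mul lam hfk] at h
    exact h
  · exact Eventually.of_forall fun s => (hWm s).mul hGf.1
  · refine (hGf.norm.const_mul M).mono' ((hWm t).mul hGf.1) ?_
    filter_upwards [hae3] with p h3
    by_cases h1 : p.1 ∈ box n k
    · by_cases h2 : p.2 ∈ box n k
      · rw [norm_mul, Complex.norm_real]
        exact mul_le_mul_of_nonneg_right (hM p ⟨h1, h2⟩) (norm_nonneg _)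
      · simp [hf0 _ h2]
    · simp [h3 h1]
  · have m1 : Measurable fun p : EuclideanSpace ℝ (Fin n) × EuclideanSpace ℝ (Fin n) =>
        (((weight lam p.2)⁻¹ : ℝ) : ℂ) :=
      Complex.measurable_ofReal.comp ((measurable_weight lam).comp measurable_snd).inv
    have m2 : Measurable fun p : EuclideanSpace ℝ (Fin n) × EuclideanSpace ℝ (Fin n) =>
        localDensity lam f p.1 p.2 * heatDensityDeriv lam p.1 p.2 t :=
      (measurable_localDensity_mul hlam hf.continuous).comp
        (measurable_fst.prodMk (measurable_snd.prodMk measurable_const))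
    exact hG.1.1.comp_fst.mul (m1.mul m2).aestronglyMeasurable
  · filter_upwards [hae3] with p h3 s hs
    by_cases h1 : p.1 ∈ box n k
    · rw [norm_mul, norm_mul, Complex.norm_real]
      refine mul_le_mul_of_nonneg_left ?_ (norm_nonneg _)
      by_cases h2 : p.2 ∈ box n k
      · exact mul_le_mul ((hW p.2 h2).trans (le_abs_self _)) (hbound _ h1 _ s hs) (norm_nonneg _)
          (abs_nonneg _)
      · rw [localDensity_eq_zero lam hfk _ h2]
        simp [h2]
    · simp [h3 h1]
  · filter_upwards [hae1, hae2] with p h1 h2 s hs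
    have hs0 : 0 < s := by have : t / 2 < s := hs; linarith
    have h := (hasDerivAt_heatSeries hlam h1 h2 hs0).ofReal_comp.mul_const (G p.1 * f p.2)
    convert! h using 1
    rw [localDensity]
    push_cast
    ring

/-- The quadratic form of the generator of the heat semigroup, computed on both sides of the Hankel
transformation. -/
lemma integral_mul_hankel_mul_hankel (hn : 1 ≤ n) {lam : Fin n → ℝ} (hlam : ∀ j, -1 / 2 < lam j)
    {f : EuclideanSpace ℝ (Fin n) → ℂ} (hf : ContDiff ℝ 1 f) {k : ℕ}
    (hfk : tsupport f ⊆ box n k) (hfi : BoxIntegrable lam k f) {G : EuclideanSpace ℝ (Fin n) → ℂ}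
    (hG : BoxIntegrable lam k G)
    (hH : Integrable (fun y => hankel lam G y * hankel lam f y) (mu lam)) {t : ℝ} (ht : 0 < t) :
    ∫ y, (((∑ j, y j ^ 2) * Real.exp (-t * ∑ j, y j ^ 2) : ℝ) : ℂ) *
      (hankel lam G y * hankel lam f y) ∂(mu lam) =
      -∫ x, G x * localAverage lam f univ x t ∂(mu lam) := by
  have h1 := hasDerivAt_integral_exp_mul hH ht
  have h2 := hasDerivAt_integral_heatSeries hn hlam hf hfk hfi hG ht
  have h3 := h1.unique (h2.congr_of_eventuallyEq ?_)
  · rw [integral_neg] at h3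
    rw [← h3, neg_neg]
  · filter_upwards [Ioi_mem_nhds ht] with s hs
    exact (integral_exp_mul_hankel_mul_hankel hlam hG hfi hs).2

/-- Fubini's theorem for a symbol of Laplace transform type. -/
lemma integral_laplaceSymbol_mul {lam : Fin n → ℝ} {φ : ℝ → ℂ} (hn : 1 ≤ n)
    (hφ : MemLp φ ∞ (volume.restrict (Ioi 0))) {H : EuclideanSpace ℝ (Fin n) → ℂ}
    (hH : Integrable H (mu lam)) :
    ∫ y, laplaceSymbol n φ y * H y ∂(mu lam) = ∫ t in Ioi (0 : ℝ), φ t *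
      ∫ y, (((∑ j, y j ^ 2) * Real.exp (-t * ∑ j, y j ^ 2) : ℝ) : ℂ) * H y ∂(mu lam) := by
  obtain ⟨B, hB0, hB⟩ := exists_ae_norm_le hφ
  have hm : Measurable fun p : EuclideanSpace ℝ (Fin n) × ℝ =>
      (∑ j, p.1 j ^ 2) * Real.exp (-p.2 * ∑ j, p.1 j ^ 2) :=
    Continuous.measurable (by fun_prop)
  have hnn : ∀ y : EuclideanSpace ℝ (Fin n), 0 ≤ ∑ j, y j ^ 2 := fun y =>
    Finset.sum_nonneg fun j _ => sq_nonneg _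
  have hmaj : Integrable (fun p : EuclideanSpace ℝ (Fin n) × ℝ =>
      ((∑ j, p.1 j ^ 2) * Real.exp (-p.2 * ∑ j, p.1 j ^ 2)) * ‖H p.1‖)
      ((mu lam).prod (volume.restrict (Ioi 0))) := by
    have hm2 : AEStronglyMeasurable (fun p : EuclideanSpace ℝ (Fin n) × ℝ =>
      ((∑ j, p.1 j ^ 2) * Real.exp (-p.2 * ∑ j, p.1 j ^ 2)) * ‖H p.1‖)
      ((mu lam).prod (volume.restrict (Ioi 0))) :=
      hm.aestronglyMeasurable.mul hH.1.norm.comp_fst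
    have hexp : ∀ y ∈ orthant n, IntegrableOn (fun t : ℝ => (∑ j, y j ^ 2) *
        Real.exp (-t * ∑ j, y j ^ 2)) (Ioi 0) ∧ ∫ t in Ioi (0 : ℝ), (∑ j, y j ^ 2) *
        Real.exp (-t * ∑ j, y j ^ 2) = 1 := by
      intro y hy
      have hpos : 0 < ∑ j, y j ^ 2 :=
        Finset.sum_pos (fun j _ => pow_pos (hy j) 2) ⟨⟨0, hn⟩, Finset.mem_univ _⟩
      have e : ∀ t : ℝ, -t * ∑ j, y j ^ 2 = -(∑ j, y j ^ 2) * t := fun t => by ring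
      simp only [e]
      refine ⟨(integrableOn_exp_mul_Ioi (by linarith) 0).const_mul _, ?_⟩
      rw [integral_const_mul, integral_exp_mul_Ioi (by linarith)]
      simp
      field_simp
    rw [integrable_prod_iff hm2]
    constructor
    · filter_upwards [ae_mem_orthant lam] with y hy
      exact (hexp y hy).1.mul_const _
    · refine hH.norm.congr ?_
      filter_upwards [ae_mem_orthant lam] with y hy
      have e : ∀ t : ℝ, ‖((∑ j, y j ^ 2) * Real.exp (-t * ∑ j, y j ^ 2)) * ‖H y‖‖ =
          ((∑ j, y j ^ 2) * Real.exp (-t * ∑ j, y j ^ 2)) * ‖H y‖ := fun t =>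
        Real.norm_of_nonneg (mul_nonneg (mul_nonneg (hnn y) (Real.exp_pos _).le) (norm_nonneg _))
      simp only [e]
      rw [integral_mul_const, (hexp y hy).2, one_mul]
  have hint : Integrable (fun p : EuclideanSpace ℝ (Fin n) × ℝ => φ p.2 *
      ((((∑ j, p.1 j ^ 2) * Real.exp (-p.2 * ∑ j, p.1 j ^ 2) : ℝ) : ℂ) * H p.1))
      ((mu lam).prod (volume.restrict (Ioi 0))) := by
    refine (hmaj.const_mul B).mono' (hφ.1.comp_snd.mul
      ((Complex.measurable_ofReal.comp hm).aestronglyMeasurable.mul hH.1.comp_fst)) ?_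
    filter_upwards [Measure.quasiMeasurePreserving_snd.ae hB] with p hp
    rw [norm_mul, norm_mul, Complex.norm_real,
      Real.norm_of_nonneg (mul_nonneg (hnn _) (Real.exp_pos _).le)]
    exact mul_le_mul_of_nonneg_right hp
      (mul_nonneg (mul_nonneg (hnn _) (Real.exp_pos _).le) (norm_nonneg _))
  have e1 : ∀ y, laplaceSymbol n φ y * H y = ∫ t in Ioi (0 : ℝ), φ t *
      ((((∑ j, y j ^ 2) * Real.exp (-t * ∑ j, y j ^ 2) : ℝ) : ℂ) * H y) := by
    intro y
    rw [laplaceSymbol, ← integral_const_mul, ← integral_mul_const]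
    refine integral_congr_ae (Eventually.of_forall fun t => ?_)
    push_cast
    ring
  simp only [e1]
  rw [integral_integral_swap hint]
  simp only [integral_const_mul]

lemma integrable_mul_mul_localAverage (hn : 1 ≤ n) {lam : Fin n → ℝ} (hlam : ∀ j, -1 / 2 < lam j)
    {φ : ℝ → ℂ} (hφ : MemLp φ ∞ (volume.restrict (Ioi 0)))
    {f : EuclideanSpace ℝ (Fin n) → ℂ} (hf : ContDiff ℝ 1 f) {k : ℕ}
    (hfk : tsupport f ⊆ box n k) {G : EuclideanSpace ℝ (Fin n) → ℂ}
    (hG : BoxIntegrable lam k G) :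
    Integrable (fun p : EuclideanSpace ℝ (Fin n) × ℝ =>
      φ p.2 * (G p.1 * localAverage lam f univ p.1 p.2))
      ((mu lam).prod (volume.restrict (Ioi 0))) := by
  obtain ⟨B, hB0, hB⟩ := exists_ae_norm_le hφ
  obtain ⟨C, hC0, hC⟩ := exists_localAverage_univ_le hlam hf hfk
  have hmaj : Integrable (fun p : EuclideanSpace ℝ (Fin n) × ℝ =>
      ‖G p.1‖ * (B * (C * timeMajorant (commonDecay lam) p.2)))
      ((mu lam).prod (volume.restrict (Ioi 0))) :=
    hG.1.norm.mul_prod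
      (((integrableOn_timeMajorant (commonDecay_pos hn hlam)).const_mul C).const_mul B)
  have hm := (measurable_localAverage hlam hf.continuous univ).aestronglyMeasurable
    (μ := (mu lam).prod (volume.restrict (Ioi (0 : ℝ))))
  refine hmaj.mono' (hφ.1.comp_snd.mul (hG.1.1.comp_fst.mul hm)) ?_
  filter_upwards [Measure.quasiMeasurePreserving_snd.ae hB,
    Measure.quasiMeasurePreserving_snd.ae (ae_restrict_mem measurableSet_Ioi),
    Measure.quasiMeasurePreserving_fst.ae hG.2] with p h1 h2 h3
  by_cases h : p.1 ∈ box n k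
  · rw [norm_mul, norm_mul]
    calc _ ≤ B * (‖G p.1‖ * (C * timeMajorant (commonDecay lam) p.2)) := by
          gcongr
          exact hC _ h _ h2
      _ = _ := by ring
  · simp [h3 h]

/-- Fubini's theorem for the pairing of `principalValue` with a function of compact support. -/
lemma integrable_mul_principalValue (hn : 1 ≤ n) {lam : Fin n → ℝ} (hlam : ∀ j, -1 / 2 < lam j)
    {φ : ℝ → ℂ} (hφ : MemLp φ ∞ (volume.restrict (Ioi 0)))
    {f : EuclideanSpace ℝ (Fin n) → ℂ} (hf : ContDiff ℝ 1 f) {k : ℕ}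
    (hfk : tsupport f ⊆ box n k) {G : EuclideanSpace ℝ (Fin n) → ℂ}
    (hG : BoxIntegrable lam k G) :
    Integrable (fun x => G x * principalValue lam φ f x) (mu lam) ∧
    ∫ t in Ioi (0 : ℝ), φ t * ∫ x, G x * localAverage lam f univ x t ∂(mu lam) =
      ∫ x, G x * principalValue lam φ f x ∂(mu lam) := by
  have h := integrable_mul_mul_localAverage hn hlam hφ hf hfk hG
  have e : ∀ x, ∫ t in Ioi (0 : ℝ), φ t * (G x * localAverage lam f univ x t) =
      G x * principalValue lam φ f x := by
    intro x
    rw [principalValue, ← integral_const_mul]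
    refine integral_congr_ae (Eventually.of_forall fun t => ?_)
    ring
  constructor
  · have h2 := h.integral_prod_left
    simp only [e] at h2
    exact h2
  · simp only [← e, ← integral_const_mul]
    exact (integral_integral_swap h).symm

/-- The multiplier transform of a test function in the weak sense. -/
lemma integral_hankelMultiplier_mul (hn : 1 ≤ n) {lam : Fin n → ℝ} (hlam : ∀ j, -1 / 2 < lam j)
    {φ : ℝ → ℂ} (hφ : MemLp φ ∞ (volume.restrict (Ioi 0))) (f : TestFunction (orthant n) ℂ ⊤)
    {k : ℕ} (hfk : tsupport f ⊆ box n k) {G : EuclideanSpace ℝ (Fin n) → ℂ}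
    (hG2 : MemLp G 2 (mu lam)) (hG : ∀ᵐ y ∂(mu lam), y ∉ box n k → G y = 0) :
    ∫ x, hankelMultiplier lam (laplaceMultiplier lam hφ) (testFunctionL2 lam f) x * G x ∂(mu lam) =
      -∫ x, G x * principalValue lam φ f x ∂(mu lam) := by
  have hf : ContDiff ℝ 1 f := f.contDiff.of_le (by simp)
  have hf0 : ∀ y ∉ box n k, f y = 0 := fun y hy =>
    image_eq_zero_of_notMem_tsupport fun h => hy (hfk h)
  have hf2 := memLp_testFunction lam f
  have hfi := boxIntegrable_of_memLp hf2 (Eventually.of_forall hf0)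
  have hGi := boxIntegrable_of_memLp hG2 hG
  have hH : Integrable (fun y => hankel lam G y * hankel lam f y) (mu lam) :=
    (memLp_hankel_of_boxIntegrable hlam hGi hG2).integrable_mul
      (memLp_hankel_of_boxIntegrable hlam hfi hf2)
  have hfL : testFunctionL2 lam f ∈ compactL2 lam := by
    refine ⟨box n k, isCompact_box n k, box_subset n k, ?_⟩
    filter_upwards [hf2.coeFn_toLp] with y hy hyk
    rw [testFunctionL2, hy, hf0 y hyk]
  have hGL : hG2.toLp G ∈ compactL2 lam := by
    refine ⟨box n k, isCompact_box n k, box_subset n k, ?_⟩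
    filter_upwards [hG2.coeFn_toLp, hG] with y hy h hyk
    rw [hy, h hyk]
  have h1 : ∫ x, hankelMultiplier lam (laplaceMultiplier lam hφ) (testFunctionL2 lam f) x * G x
      ∂(mu lam) = ∫ y, laplaceSymbol n φ y * (hankel lam G y * hankel lam f y) ∂(mu lam) := by
    have e1 : ∫ x, hankelMultiplier lam (laplaceMultiplier lam hφ) (testFunctionL2 lam f) x * G x
        ∂(mu lam) = ∫ x, hankelMultiplier lam (laplaceMultiplier lam hφ) (testFunctionL2 lam f) x *
        hG2.toLp G x ∂(mu lam) :=
      integral_congr_ae (hG2.coeFn_toLp.mono fun x hx => by simp only [hx])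
    rw [e1, hankelMultiplier, integral_hankelL2_mul hlam _ hGL, hankel_congr_ae hG2.coeFn_toLp]
    refine integral_congr_ae ?_
    have hc := coeFn_hankelL2 hlam hfL
    rw [hankel_congr_ae (F := testFunctionL2 lam f) hf2.coeFn_toLp] at hc
    filter_upwards [Lp.coeFn_lpSMul (r := 2) (laplaceMultiplier lam hφ)
      (hankelL2 lam (testFunctionL2 lam f)), (memLp_laplaceSymbol lam hφ).coeFn_toLp, hc]
      with y h1 h2 h3
    rw [h1, Pi.smul_apply', h3, smul_eq_mul, laplaceMultiplier, h2]
    ring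
  rw [h1, integral_laplaceSymbol_mul hn hφ hH,
    ← (integrable_mul_principalValue hn hlam hφ hf hfk hGi).2, ← integral_neg]
  refine setIntegral_congr_fun measurableSet_Ioi fun t ht => ?_
  dsimp only
  rw [integral_mul_hankel_mul_hankel hn hlam hf hfk hfi hGi hH ht, mul_neg]

/-- The weak identity, tested on the indicators of the measurable subsets of a box. -/
lemma hankelMultiplier_ae_eq (hn : 1 ≤ n) {lam : Fin n → ℝ} (hlam : ∀ j, -1 / 2 < lam j)
    {φ : ℝ → ℂ} (hφ : MemLp φ ∞ (volume.restrict (Ioi 0))) (f : TestFunction (orthant n) ℂ ⊤) :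
    ∀ᵐ x ∂(mu lam), hankelMultiplier lam (laplaceMultiplier lam hφ) (testFunctionL2 lam f) x =
      -principalValue lam φ f x := by
  have hf : ContDiff ℝ 1 f := f.contDiff.of_le (by simp)
  obtain ⟨k₀, hk₀⟩ := exists_subset_box f.hasCompactSupport f.tsupport_subset
  set T := hankelMultiplier lam (laplaceMultiplier lam hφ) (testFunctionL2 lam f) with hT
  have hbox : ∀ k, k₀ ≤ k → ∀ᵐ x ∂((mu lam).restrict (box n k)), T x = -principalValue lam φ f x := by
    intro k hk
    have hfk : tsupport f ⊆ box n k := hk₀.trans (box_mono n hk)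
    have hbm := (isCompact_box n k).measurableSet
    have hfin := mu_lt_top lam (isCompact_box n k) (box_subset n k)
    have : IsFiniteMeasure ((mu lam).restrict (box n k)) := ⟨by simpa using hfin⟩
    have hG2 : ∀ s, MeasurableSet s → MemLp ((s ∩ box n k).indicator fun _ => (1 : ℂ)) 2 (mu lam) :=
      fun s hs => memLp_indicator_const 2 (hs.inter hbm) 1
        (Or.inr ((measure_mono inter_subset_right).trans_lt hfin).ne)
    have hG0 : ∀ s, ∀ᵐ y ∂(mu lam), y ∉ box n k →
        (s ∩ box n k).indicator (fun _ => (1 : ℂ)) y = 0 := fun s =>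
      Eventually.of_forall fun y hy => indicator_of_notMem (fun h => hy h.2) _
    have hmul : ∀ (s : Set (EuclideanSpace ℝ (Fin n))) (g : EuclideanSpace ℝ (Fin n) → ℂ) x,
        (s ∩ box n k).indicator (fun _ => (1 : ℂ)) x * g x = (s ∩ box n k).indicator g x := by
      intro s g x
      by_cases h : x ∈ s ∩ box n k <;> simp [h]
    have hTi : IntegrableOn T (box n k) (mu lam) :=
      ((Lp.memLp T).restrict (box n k)).integrable one_le_two
    have hSi : IntegrableOn (principalValue lam φ f) (box n k) (mu lam) := by
      have h := (integrable_mul_principalValue hn hlam hφ hf hfk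
        (boxIntegrable_of_memLp (hG2 univ MeasurableSet.univ) (hG0 univ))).1.congr
        (Eventually.of_forall (hmul univ _))
      rw [univ_inter] at h
      exact (integrable_indicator_iff hbm).1 h
    refine Integrable.ae_eq_of_forall_setIntegral_eq _ _ hTi hSi.neg fun s hs _ => ?_
    have h := integral_hankelMultiplier_mul hn hlam hφ f hfk (hG2 s hs) (hG0 s)
    rw [integral_congr_ae (Eventually.of_forall fun x => (mul_comm _ _).trans (hmul s T x)),
      integral_congr_ae (Eventually.of_forall (hmul s (principalValue lam φ f))),
      integral_indicator (hs.inter hbm), integral_indicator (hs.inter hbm)] at h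
    rw [Measure.restrict_restrict hs]
    exact h.trans (integral_neg _).symm
  have hall : ∀ᵐ x ∂(mu lam), ∀ k, k₀ ≤ k → x ∈ box n k → T x = -principalValue lam φ f x := by
    refine ae_all_iff.2 fun k => ?_
    by_cases hk : k₀ ≤ k
    · filter_upwards [(ae_restrict_iff' (isCompact_box n k).measurableSet).1 (hbox k hk)] with x hx _
      exact hx
    · exact Eventually.of_forall fun x h => absurd h hk
  filter_upwards [hall, ae_mem_orthant lam] with x hx hxo
  obtain ⟨k, h1, h2⟩ := ((eventually_mem_box hxo).and (eventually_ge_atTop k₀)).exists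
  exact hx k h2 h1

lemma exists_box (f : TestFunction (orthant n) ℂ ⊤) {x : EuclideanSpace ℝ (Fin n)}
    (hx : x ∈ orthant n) : ∃ k, tsupport f ⊆ box n k ∧ x ∈ box n k := by
  obtain ⟨k₀, hk₀⟩ := exists_subset_box f.hasCompactSupport f.tsupport_subset
  obtain ⟨k, h1, h2⟩ := ((eventually_mem_box hx).and (eventually_ge_atTop k₀)).exists
  exact ⟨k, hk₀.trans (box_mono n h2), h1⟩

end HankelMult

open HankelMult
theorem proposition2p1 (n : ℕ) (hn : 1 ≤ n) :
    -- the integrals defining the kernel and the truncated integrals converge absolutely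
    (∀ (φ : ℝ → ℂ), MemLp φ ∞ (volume.restrict (Ioi 0)) →
      ∀ (lam : Fin n → ℝ), (∀ j, -1 / 2 < lam j) → ∀ x ∈ orthant n,
        (∀ y ∈ orthant n, x ≠ y → IntegrableOn (kernelIntegrand lam φ x y) (Ioi 0)) ∧
        ∀ (f : TestFunction (orthant n) ℂ ⊤) (ε : ℝ), 0 < ε →
          IntegrableOn (fun y => f y * kernelK lam φ x y) {y | ε < ‖y - x‖} (mu lam)) ∧
    -- the representation with a bounded function `α`
    (∀ (φ : ℝ → ℂ) (hφ : MemLp φ ∞ (volume.restrict (Ioi 0))),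
      ∃ α : ℝ → ℂ, (∃ B : ℝ, ∀ ε, 0 < ε → ‖α ε‖ ≤ B) ∧
        ∀ (lam : Fin n → ℝ), (∀ j, -1 / 2 < lam j) → ∀ f : TestFunction (orthant n) ℂ ⊤,
          ∀ᵐ x ∂(volume.restrict (orthant n : Set (EuclideanSpace ℝ (Fin n)))),
            ∃ L : ℂ,
              Tendsto (fun ε => α ε * f x + truncatedIntegral lam φ f ε x) (𝓝[>] 0) (𝓝 L) ∧
              hankelMultiplier lam (laplaceMultiplier lam hφ) (testFunctionL2 lam f) x = -L) ∧
    -- the representation when `φ(0⁺)` exists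
    (∃ C : ℝ, 0 < C ∧
      ∀ (φ : ℝ → ℂ) (hφ : MemLp φ ∞ (volume.restrict (Ioi 0))) (φ0 : ℂ),
        Tendsto φ (𝓝[>] 0) (𝓝 φ0) →
        ∀ (lam : Fin n → ℝ), (∀ j, -1 / 2 < lam j) → ∀ f : TestFunction (orthant n) ℂ ⊤,
          ∀ᵐ x ∂(volume.restrict (orthant n : Set (EuclideanSpace ℝ (Fin n)))),
            ∃ L : ℂ, Tendsto (fun ε => truncatedIntegral lam φ f ε x) (𝓝[>] 0) (𝓝 L) ∧
              hankelMultiplier lam (laplaceMultiplier lam hφ) (testFunctionL2 lam f) x =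
                C * φ0 * f x - L) := by
  refine ⟨fun φ hφ lam hlam x hx => ⟨fun y hy hxy =>
    integrableOn_kernelIntegrand hn hlam hφ hx hy hxy, fun f ε hε => ?_⟩, fun φ hφ => ?_, ?_⟩
  · obtain ⟨k, hfk, hxk⟩ := exists_box f hx
    exact integrableOn_mul_kernelK hn hlam hφ (f.contDiff.of_le (by simp)) hfk hxk hε
  · obtain ⟨B, -, hB⟩ := exists_ae_norm_le hφ
    refine ⟨jumpCoefficient n φ, ⟨_, fun ε hε => norm_jumpCoefficient_le hn hB hε⟩,
      fun lam hlam f => ?_⟩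
    filter_upwards [(ae_mu_iff lam).1 (hankelMultiplier_ae_eq hn hlam hφ f),
      (ae_mu_iff lam).1 (ae_mem_orthant lam)] with x hT hx
    obtain ⟨k, hfk, hxk⟩ := exists_box f hx
    exact ⟨_, tendsto_jumpCoefficient_mul_add_truncatedIntegral hn hlam hφ
      (f.contDiff.of_le (by simp)) hfk hxk, hT⟩
  · refine ⟨1, one_pos, fun φ hφ φ0 h0 lam hlam f => ?_⟩
    filter_upwards [(ae_mu_iff lam).1 (hankelMultiplier_ae_eq hn hlam hφ f),
      (ae_mu_iff lam).1 (ae_mem_orthant lam)] with x hT hx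
    obtain ⟨k, hfk, hxk⟩ := exists_box f hx
    have h := tendsto_jumpCoefficient_mul_add_truncatedIntegral hn hlam hφ
      (f.contDiff.of_le (by simp)) hfk hxk
    have h2 := h.sub ((tendsto_jumpCoefficient hn hφ h0).mul_const (f x))
    simp only [add_sub_cancel_left] at h2
    refine ⟨_, h2, ?_⟩
    rw [hT]
    push_cast
    ring
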